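/- **Setting.** Let $(\mathsf X,\mathcal X)$ be a measurable space, $M_0$ a probability measure on it, $(M_t)_{t\ge1}$ Markov kernels on it and $(g_t)_{t\ge0}$ non-negative measurable functions. Assume: - (A1) for a measure $\nu$, $M_0$ has a density $m_0$ and, for all $t\ge1$ and $x$, $M_t(x,\cdot)$ has a density $m_t(x,\cdot)$ with respect to $\nu$, where $m_t\ge 0$ is jointly measurable; - (A2) there is $G_\infty>0$ with $0<g_t(x)\le G_\infty$ for all $t,x$; - (A3) $m_t(x',x)>0$ for all $t\ge1$ and $x,x'$; - (A4) there is $\sigma_+>0$ with $m_t(x',x)\le\sigma_+$ for all $t\ge1$ and $x,x'$. Let $Q_{t+1}(x,dy)=g_t(x)M_{t+1}(x,dy)$, $Q_{s+1:t}=Q_{s+1}\otimes\cdots\otimes Q_t$ (the identity if $s=t$), with last marginal $\bar Q_{s+1:t}$; $\gamma_{0:t}=M_0\otimes Q_{1:t}$, with last marginal $\gamma_t$; $\eta_t=\gamma_t/\gamma_t(\mathbf 1)$ and $\phi_t(dx)=g_t(x)\eta_t(dx)/\eta_t(g_t)$. Let $B_s(x_{s+1},dx_s)=m_{s+1}(x_s,x_{s+1})\phi_s(dx_s)/\phi_s(m_{s+1}(\cdot,x_{s+1}))$,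 $T_t=B_{t-1}\otimes\cdots\otimes B_0$ ($T_0=\mathrm{Id}$), $T_t[h](x_t)=\int h(x_{0:t})\,T_t(x_t,dx_{0:t-1})$ and $\phi_{0:t|t}(h)=\phi_t(T_t[h])$. For $b\in\{0,1\}^{t+1}$ let $\mu_{b,t}$ be the measure on $\mathsf X^{t+1}\times\mathsf X^{t+1}$ given by $$\mu_{b,t}(dx_{0:t},dx'_{0:t})=M_0^{b_0}(dx_0,dx_0')\prod_{s=0}^{t-1}g_s(x_s)g_s(x'_s)\prod_{s=1}^tM_s^{b_s}(x_{s-1},x'_{s-1};dx_s,dx'_s),$$ $$M_0^{c}(dx,dx')=M_0(dx)\{\mathbb 1_{c=0}M_0(dx')+\mathbb 1_{c=1}\delta_{x}(dx')\},$$ $$M_s^{c}(x,x';dz,dz')=M_s(x,dz)\{\mathbb 1_{c=0}M_s(x',dz')+\mathbb 1_{c=1}\delta_{z}(dz')\}.$$ Let $e_s$ be the vector with $1$ at position $s$ and $0$ elsewhere. **Particle filter.** For each $N\ge1$ let $(\xi_t^i,A_t^i)_{t\ge0,\,1\le i\le N}$ be the bootstrap particle filter with multinomial resampling, on a common probability space: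 $\xi_0^{1:N}$ are i.i.d. with law $M_0$ and, given the particles up to time $t$ and the ancestors up to time $t-1$, the pairs $(A_t^i,\xi_{t+1}^i)$, $1\le i\le N$, are independent, $A_t^i$ having the categorical law with weights $W_t^{j}=g_t(\xi_t^j)/\Omega_t$, $\Omega_t=\sum_jg_t(\xi_t^j)$, and $\xi_{t+1}^i$ being drawn from $M_{t+1}(\xi_t^{A_t^i},\cdot)$. Write $\gamma_t^N(\mathbf 1)=\prod_{s<t}N^{-1}\Omega_s$. For $s\ge1$ put $$\beta_s^N(x,i)=\frac{g_{s-1}(\xi^i_{s-1})m_s(\xi_{s-1}^i,x)}{\sum_jg_{s-1}(\xi^j_{s-1})m_s(\xi_{s-1}^j,x)},\qquad \beta_s(k,i)=\beta_s^N(\xi_s^k,i).$$ Let $T_t^N$ be $T_t$ with every $B_s(x,\cdot)$ replaced by $\sum_i\beta^N_{s+1}(x,i)\delta_{\xi_s^i}$, and let $\phi^N_{0:t|t}(h)=\sum_{k_{0:t}}W_t^{k_t}\prod_{s=1}^t\beta_s(k_s,k_{s-1})\,h(\xi_0^{k_0},\dots,\xi_t^{k_t})$. For $N\ge2$ and $h:\mathsf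 X^{t+1}\times\mathsf X^{t+1}\to\mathbb R$ put $$\mu^{\mathsf{BS}}_{b,t}(h)=\prod_{s=0}^tN^{b_s}\Big(\tfrac N{N-1}\Big)^{1-b_s}\gamma_t^N(\mathbf 1)^2\sum_{k,l\in\{1,\dots,N\}^{t+1}}\Lambda_1(k)\Lambda_2(k;l)\,I_b(k,l)\,h(\xi^{k},\xi^{l}),$$ where $\xi^{k}=(\xi_0^{k_0},\dots,\xi_t^{k_t})$, $I_b(k,l)=\prod_{s=0}^t\{\mathbb 1_{k_s=l_s}\mathbb 1_{b_s=1}+\mathbb 1_{k_s\ne l_s}\mathbb 1_{b_s=0}\}$, $\Lambda_1(k)=N^{-1}\prod_{s=1}^t\beta_s(k_s,k_{s-1})$ and $\Lambda_2(k;l)=N^{-1}\prod_{s=1}^t\{\mathbb 1_{l_s=k_s}W_{s-1}^{l_{s-1}}+\mathbb 1_{l_s\ne k_s}\beta_s(l_s,l_{s-1})\}$. An *additive functional* is $h_{0:t}(x_{0:t})=\sum_{\ell=0}^{t-1}\tilde h_\ell(x_\ell,x_{\ell+1})$ with bounded measurable $\tilde h_\ell$; for it write $\tilde h_{s:t}(x_{s:t})=\sum_{\ell=s}^{t-1}\tilde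 h_\ell(x_\ell,x_{\ell+1})$ and $h_{0:s}=\tilde h_{0:s}$. **Theorem.** Assume (A1)–(A4) and let $t\in\mathbb N$. (i) For all $s\in\{0,\dots,t\}$, all bounded measurable $\tilde h_{s:t},\tilde f_{s:t}:\mathsf X^{t-s+1}\to\mathbb R$ (arbitrary, not necessarily additive) and $c_t,d_t:\mathsf X\to\mathbb R$, and all additive functionals $h_{0:s},f_{0:s}$, $$\lim_{N\to\infty}\Big\|\mu^{\mathsf{BS}}_{e_s,t}\big([T_s^N[h_{0:s}]c_t+\tilde h_{s:t}]\otimes[T_s^N[f_{0:s}]d_t+\tilde f_{s:t}]\big)-\mu_{e_s,t}\big([T_s[h_{0:s}]c_t+\tilde h_{s:t}]\otimes[T_s[f_{0:s}]d_t+\tilde f_{s:t}]\big)\Big\|_2=0,$$ where $T_s[h_{0:s}]c_t+\tilde h_{s:t}$ is the function $x_{0:t}\mapsto T_s[h_{0:s}](x_s)c_t(x_t)+\tilde h_{s:t}(x_{s:t})$, and likewise for the others. (ii) For every additive functional $h_{0:t}$, the estimator $$\sum_{s=0}^t\frac{\mu^{\mathsf{BS}}_{e_s,t}\big([g_t\{T_s^N[h_{0:s}]+\tilde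 h_{s:t}-\phi^N_{0:t|t}(h_{0:t})\}]^{\otimes2}\big)}{\gamma_{t+1}^N(\mathbf 1)^2}$$ converges in probability, as $N\to\infty$, to the asymptotic variance of the FFBS estimator $$\sum_{s=0}^t\frac{\eta_s\big(G_{s,t}[g_t\{h_{0:t}-\phi_{0:t|t}(h_{0:t})\}]^2\big)}{\eta_s(\bar Q_{s+1:t}[g_t])^2},\qquad G_{s,t}[h]=T_s\big[Q_{s+1:t}[h]\big].$$ -/

import Mathlib

open MeasureTheory ProbabilityTheory Filter Topology
open scoped ENNReal

namespace FFBS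

/-- Paths `x_{0:t}` with values in `X`. -/
abbrev Path (X : Type*) (t : ℕ) : Type _ := (i : Finset.Iic t) → (fun _ : ℕ => X) i

/-- The last point `x_t` of a path `x_{0:t}`. -/
def last {X : Type*} {t : ℕ} (x : Path X t) : X := x ⟨t, Finset.mem_Iic.2 le_rfl⟩

lemma measurable_last {X : Type*} [MeasurableSpace X] {t : ℕ} :
    Measurable (last : Path X t → X) := measurable_pi_apply _

/-- The point `x_s` of a path `x_{0:t}`, where `s ≤ t`. -/
def point {X : Type*} {t : ℕ} (x : Path X t) (s : ℕ) (h : s ≤ t) : X :=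
  x ⟨s, Finset.mem_Iic.2 h⟩

/-- The path `x_{0:t+1}` obtained from `x_{0:t}` and `x_{t+1} = y`. -/
def snoc {X : Type*} {t : ℕ} (x : Path X t) (y : X) : Path X (t + 1) :=
  fun i => if h : (i : ℕ) ≤ t then point x i h else y

/-- The segment `x_{s:t}` of a path `x_{0:t}`. -/
def segment {X : Type*} {t : ℕ} (s : ℕ) (x : Path X t) : Finset.Icc s t → X :=
  fun i => point x i (Finset.mem_Icc.1 i.2).2

/-- Bounded measurable real functions. -/
def BddMeasurable {E : Type*} [MeasurableSpace E] (f : E → ℝ) : Prop :=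
  Measurable f ∧ ∃ C : ℝ, ∀ x, |f x| ≤ C

/-- For `q = (h̃_ℓ)_ℓ`, the additive functional `∑_{ℓ=s}^{t-1} h̃_ℓ(x_ℓ, x_{ℓ+1})` of the path
`x_{0:t}`. It is `h_{0:t}` when `s = 0`, and `h̃_{s:t}` (which depends on `x_{s:t}` only) in
general. -/
def additive {X : Type*} (q : ℕ → X → X → ℝ) (s t : ℕ) (x : Path X t) : ℝ :=
  ∑ ℓ : Finset.Ico s t,
    q ℓ (point x ℓ (Finset.mem_Ico.1 ℓ.2).2.le) (point x (ℓ + 1) (Finset.mem_Ico.1 ℓ.2).2)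

/-- A Feynman-Kac model: initial law `M_0`, transition kernels `M_t` for `t ≥ 1` (the value
`trans 0` is never used) and nonnegative measurable potentials `g_t`. -/
structure FeynmanKac (E : Type*) [MeasurableSpace E] where
  init : Measure E
  init_prob : IsProbabilityMeasure init
  trans : ℕ → Kernel E E
  trans_markov : ∀ t, IsMarkovKernel (trans t)
  pot : ℕ → E → ℝ
  pot_measurable : ∀ t, Measurable (pot t)
  pot_nonneg : ∀ t x, 0 ≤ pot t x

attribute [instance] FeynmanKac.init_prob FeynmanKac.trans_markov

namespace FeynmanKac

variable {E : Type*} [MeasurableSpace E] (F : FeynmanKac E)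

/-- The unnormalized kernel `Q_{t+1}(x_t, dx_{t+1}) = g_t(x_t) M_{t+1}(x_t, dx_{t+1})`. -/
noncomputable def Q (t : ℕ) : Kernel E E :=
  (F.trans (t + 1)).withDensity (fun x _ => ENNReal.ofReal (F.pot t x))

/-- `Q_{t+1}` seen as a kernel from paths `x_{0:t}`, through the last point `x_t`. -/
noncomputable def Qstep (t : ℕ) : Kernel (Path E t) E :=
  (F.Q t).comap last measurable_last

/-- The kernel `Q_{s+1:t}`, from paths `x_{0:s}` to paths `x_{0:t}`: it extends the path `x_{0:s}`
by `Q_{s+1}(x_s, dx_{s+1}) ⋯ Q_t(x_{t-1}, dx_t)`. -/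
noncomputable def Qpath (s t : ℕ) : Kernel (Path E s) (Path E t) :=
  Kernel.partialTraj (X := fun _ => E) (κ := F.Qstep) s t

/-- The marginal `Q̄_{s+1:t}` of `Q_{s+1:t}` in its last variable, here for `t = s + r`. -/
noncomputable def Qmarg (s : ℕ) : ℕ → Kernel E E
  | 0 => Kernel.id
  | r + 1 => F.Q (s + r) ∘ₖ Qmarg s r

/-- The measure `γ_{0:t}` on paths. -/
noncomputable def joint (t : ℕ) : Measure (Path E t) :=
  F.Qpath 0 t ∘ₘ F.init.map (fun x _ => x)

/-- The marginal `γ_t` of `γ_{0:t}` in `x_t`. -/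
noncomputable def marg (t : ℕ) : Measure E := (F.joint t).map last

/-- The predictive law `η_t = γ_t / γ_t(1)`. -/
noncomputable def pred (t : ℕ) : Measure E := (F.marg t Set.univ)⁻¹ • F.marg t

/-- The filtering law `φ_t(dx) = g_t(x) η_t(dx) / η_t(g_t)`. -/
noncomputable def filt (t : ℕ) : Measure E :=
  (F.pred t).withDensity (fun x => ENNReal.ofReal (F.pot t x / ∫ y, F.pot t y ∂F.pred t))

instance (t : ℕ) : SFinite (F.joint t) := by
  unfold joint Qpath; infer_instance

instance (t : ℕ) : SFinite (F.marg t) := by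
  unfold marg; infer_instance

instance (t : ℕ) : SFinite (F.pred t) := by
  unfold pred; infer_instance

instance (t : ℕ) : SFinite (F.filt t) := by
  unfold filt; infer_instance

/-- The transition kernel of the pair `(X_t, X'_t)`: the two coordinates move independently if
`c = false`, and the second one is put on the first one if `c = true`. -/
noncomputable def pairTrans (c : Bool) (t : ℕ) : Kernel (E × E) (E × E) :=
  bif c then ((F.trans t).comap Prod.fst measurable_fst).map (fun z => (z, z))
  else F.trans t ∥ₖ F.trans t

/-- The initial law of the pair. -/
noncomputable def pairInit (c : Bool) : Measure (E × E) :=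
  bif c then F.init.map (fun z => (z, z)) else F.init.prod F.init

/-- The bivariate Feynman-Kac model attached to `b` (`b_t = 1` is `b t = true`), with potentials
`g_t(x) g_t(x')`. -/
noncomputable def pair (b : ℕ → Bool) : FeynmanKac (E × E) where
  init := F.pairInit (b 0)
  init_prob := by
    unfold pairInit
    cases b 0
    · exact (inferInstance : IsProbabilityMeasure (F.init.prod F.init))
    · exact Measure.isProbabilityMeasure_map (by fun_prop)
  trans t := F.pairTrans (b t) t
  trans_markov t := by
    unfold pairTrans
    cases b t
    · exact (inferInstance : IsMarkovKernel (F.trans t ∥ₖ F.trans t))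
    · exact Kernel.IsMarkovKernel.map _ (by fun_prop)
  pot t p := F.pot t p.1 * F.pot t p.2
  pot_measurable t :=
    ((F.pot_measurable t).comp measurable_fst).mul ((F.pot_measurable t).comp measurable_snd)
  pot_nonneg t p := mul_nonneg (F.pot_nonneg t _) (F.pot_nonneg t _)

/-- The measure `μ_{b,t}`, as a law on paths of pairs `(x_i, x'_i)_{i ≤ t}`. -/
noncomputable def mu (b : ℕ → Bool) (t : ℕ) : Measure (Path (E × E) t) := (F.pair b).joint t

/-- `μ_{b,t}(h)` for a function `h` of `(x_{0:t}, x'_{0:t})`. -/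
noncomputable def muInt (b : ℕ → Bool) (t : ℕ) (h : Path E t → Path E t → ℝ) : ℝ :=
  ∫ p, h (fun i => (p i).1) (fun i => (p i).2) ∂F.mu b t

/-- The backward kernel `B_s(x_{s+1}, dx_s) = m_{s+1}(x_s, x_{s+1}) φ_s(dx_s) / φ_s(m_{s+1}(·, x_{s+1}))`,
where `m t` is the density of `M_t`. -/
noncomputable def bwKer (m : ℕ → E → E → ℝ) (s : ℕ) : Kernel E E :=
  (Kernel.const E (F.filt s)).withDensity
    (fun x' x => ENNReal.ofReal (m (s + 1) x x' / ∫ y, m (s + 1) y x' ∂F.filt s))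

/-- The backward path kernel `T_t = B_{t-1} ⊗ ⋯ ⊗ B_0`: the law of `x_{0:t}` given its last point
`x_t` (which is kept as the last coordinate of the path). -/
noncomputable def bwPath (m : ℕ → E → E → ℝ) : (t : ℕ) → Kernel E (Path E t)
  | 0 => Kernel.deterministic (fun x _ => x) (by fun_prop)
  | t + 1 => (Kernel.id ×ₖ (bwPath m t ∘ₖ F.bwKer m t)).map (fun p => snoc p.2 p.1)

/-- `T_t[h](x)`. -/
noncomputable def bw (m : ℕ → E → E → ℝ) (t : ℕ) (h : Path E t → ℝ) (x : E) : ℝ :=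
  ∫ p, h p ∂F.bwPath m t x

/-- The joint smoothing expectation `φ_{0:t|t}(h)`. -/
noncomputable def smooth (m : ℕ → E → E → ℝ) (t : ℕ) (h : Path E t → ℝ) : ℝ :=
  ∫ x, F.bw m t h x ∂F.filt t

/-- `G_{s,t}[h](x_s) = T_s[Q_{s+1:t}[h]](x_s)`. -/
noncomputable def G (m : ℕ → E → E → ℝ) (s t : ℕ) (h : Path E t → ℝ) (x : E) : ℝ :=
  F.bw m s (fun p => ∫ y, h y ∂F.Qpath s t p) x

/-- The asymptotic variance of the FFBS estimator of `φ_{0:t|t}(h)`. -/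
noncomputable def asymptVar (m : ℕ → E → E → ℝ) (t : ℕ) (h : Path E t → ℝ) : ℝ :=
  ∑ s ∈ Finset.range (t + 1),
    (∫ x, (F.G m s t (fun y => F.pot t (last y) * (h y - F.smooth m t h)) x) ^ 2 ∂F.pred s) /
      (∫ x, (∫ y, F.pot t y ∂F.Qmarg s (t - s) x) ∂F.pred s) ^ 2

/-- `M_0` has the density `m0` with respect to `ν`, and `M_t(x, ·)` the density `m t x`, for every
`t ≥ 1`. -/
structure HasDensities (ν : Measure E) (m0 : E → ℝ) (m : ℕ → E → E → ℝ) : Prop where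
  init_measurable : Measurable m0
  init_nonneg : ∀ x, 0 ≤ m0 x
  init_eq : F.init = ν.withDensity (fun x => ENNReal.ofReal (m0 x))
  trans_measurable : ∀ t, 1 ≤ t → Measurable (Function.uncurry (m t))
  trans_nonneg : ∀ t, 1 ≤ t → ∀ x y, 0 ≤ m t x y
  trans_eq : ∀ t, 1 ≤ t → ∀ x, F.trans t x = ν.withDensity (fun y => ENNReal.ofReal (m t x y))

/-! ### Functionals of a particle cloud

A cloud `z : ℕ → Fin N → E` is a realization `z s i = ξ^i_s` of the particles. -/

section Cloud

variable {N : ℕ} (m : ℕ → E → E → ℝ) (z : ℕ → Fin N → E)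

/-- `Ω_t = ∑_i g_t(ξ^i_t)`. -/
noncomputable def totalWeight (t : ℕ) : ℝ := ∑ i, F.pot t (z t i)

/-- The normalized weight of `ξ^i_t`. -/
noncomputable def weight (t : ℕ) (i : Fin N) : ℝ := F.pot t (z t i) / F.totalWeight z t

/-- `γ_t^N(1) = ∏_{s<t} N^{-1} Ω_s`. -/
noncomputable def massN (t : ℕ) : ℝ :=
  ∏ s ∈ Finset.range t, (N : ℝ)⁻¹ * F.totalWeight z s

/-- The backward weight `β^N_{s+1}(y, ξ^i_s)` of the particle `ξ^i_s` at `x_{s+1} = y`. -/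
noncomputable def beta (s : ℕ) (y : E) (i : Fin N) : ℝ :=
  F.pot s (z s i) * m (s + 1) (z s i) y / ∑ j, F.pot s (z s j) * m (s + 1) (z s j) y

/-- `β^BS_{s+1}(k, i)`. -/
noncomputable def betaBS (s : ℕ) (k i : Fin N) : ℝ := F.beta m z s (z (s + 1) k) i

/-- The particle path `(ξ^{k_0}_0, …, ξ^{k_t}_t)`. -/
def cloudPath {t : ℕ} (k : Fin (t + 1) → Fin N) : Path E t :=
  fun s => z s (k ⟨s, Nat.lt_succ_of_le (Finset.mem_Iic.1 s.2)⟩)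

/-- `Λ^BS_{1,t}(k_{0:t})`. -/
noncomputable def lambda1 (t : ℕ) (k : Fin (t + 1) → Fin N) : ℝ :=
  (N : ℝ)⁻¹ * ∏ s : Fin t, F.betaBS m z s (k s.succ) (k s.castSucc)

/-- `Λ^BS_{2,t}(k_{0:t}; l_{0:t})`. -/
noncomputable def lambda2 (t : ℕ) (k l : Fin (t + 1) → Fin N) : ℝ :=
  (N : ℝ)⁻¹ * ∏ s : Fin t,
    if l s.succ = k s.succ then F.weight z s (l s.castSucc)
    else F.betaBS m z s (l s.succ) (l s.castSucc)

/-- The coalescence indicator `I_{b,t}`. -/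
def coal (b : ℕ → Bool) (t : ℕ) (k l : Fin (t + 1) → Fin N) : ℝ :=
  ∏ s : Fin (t + 1), if (k s = l s ↔ b s = true) then 1 else 0

/-- The estimator `μ^BS_{b,t}(h)`; the conditional expectation given the particles is the sum
against `Λ^BS_{1,t}(k) Λ^BS_{2,t}(k; l)`. -/
noncomputable def muBS (b : ℕ → Bool) (t : ℕ) (h : Path E t → Path E t → ℝ) : ℝ :=
  (∏ s ∈ Finset.range (t + 1), if b s then (N : ℝ) else (N : ℝ) / ((N : ℝ) - 1)) *
    F.massN z t ^ 2 *
    ∑ k : Fin (t + 1) → Fin N, ∑ l : Fin (t + 1) → Fin N,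
      F.lambda1 m z t k * F.lambda2 m z t k l *
        (coal b t k l * h (cloudPath z k) (cloudPath z l))

/-- `T^N_t[h](x)`: each backward kernel of `T_t` is replaced by its particle approximation. -/
noncomputable def bwN : (t : ℕ) → (Path E t → ℝ) → E → ℝ
  | 0, h, x => h (fun _ => x)
  | t + 1, h, x => ∑ i, F.beta m z t x i * bwN t (fun p => h (snoc p x)) (z t i)

/-- The FFBS estimator `φ^N_{0:t|t}(h)`. -/
noncomputable def smoothN (t : ℕ) (h : Path E t → ℝ) : ℝ :=
  ∑ k : Fin (t + 1) → Fin N,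
    F.weight z t (k (Fin.last t)) *
      (∏ s : Fin t, F.betaBS m z s (k s.succ) (k s.castSucc)) * h (cloudPath z k)

end Cloud

end FeynmanKac

/-- The vector `e_s`. -/
def e (s : ℕ) : ℕ → Bool := fun r => decide (r = s)

/-- The estimator of the FFBS asymptotic variance for the additive functional given by `q`. -/
noncomputable def FeynmanKac.varBS {E : Type*} [MeasurableSpace E] (F : FeynmanKac E) {N : ℕ}
    (m : ℕ → E → E → ℝ) (z : ℕ → Fin N → E) (t : ℕ) (q : ℕ → E → E → ℝ) : ℝ :=
  ∑ s : Fin (t + 1),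
    (let H : Path E t → ℝ := fun x =>
      F.pot t (last x) *
        (F.bwN m z s (additive q 0 s) (point x s (Nat.le_of_lt_succ s.2)) + additive q s t x -
          F.smoothN m z t (additive q 0 t))
    F.muBS m z (e s) t (fun x x' => H x * H x')) / F.massN z (t + 1) ^ 2

/-- The σ-field generated by the particles up to time `t` and the ancestors up to time `t - 1`. -/
abbrev history {X Ω : Type*} [MeasurableSpace X] {N : ℕ}
    (ξ : ℕ → Fin N → Ω → X) (A : ℕ → Fin N → Ω → Fin N) (t : ℕ) : MeasurableSpace Ω :=
  (⨆ s : Fin (t + 1), ⨆ i, MeasurableSpace.comap (ξ s i) inferInstance) ⊔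
    (⨆ s : Fin t, ⨆ i, MeasurableSpace.comap (A s i) ⊤)

/-- The bootstrap particle filter with multinomial resampling: `ξ t i` is the `i`-th particle at
time `t` and `A t i` the index of the parent at time `t` of the particle `ξ (t+1) i`. Given the
history up to time `t`, the pairs `(A t i, ξ (t+1) i)` are independent, `A t i` being categorical
with the normalized weights and `ξ (t+1) i` being drawn from `M_{t+1}(ξ t (A t i), ·)`. -/
structure IsBootstrapFilter {X Ω : Type*} [MeasurableSpace X] [MeasurableSpace Ω]
    (F : FeynmanKac X) (P : Measure Ω) {N : ℕ}
    (ξ : ℕ → Fin N → Ω → X) (A : ℕ → Fin N → Ω → Fin N) : Prop where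
  measurable_particle : ∀ t i, Measurable (ξ t i)
  measurable_ancestor : ∀ t i, Measurable (A t i)
  law_init : P.map (fun ω i => ξ 0 i ω) = Measure.pi (fun _ : Fin N => F.init)
  law_step : ∀ (t : ℕ) (a : Fin N → Fin N) (C : Fin N → Set X), (∀ i, MeasurableSet (C i)) →
    P⟦{ω | ∀ i, A t i ω = a i ∧ ξ (t + 1) i ω ∈ C i} | history ξ A t⟧ =ᵐ[P]
      fun ω => ∏ i, F.weight (fun s j => ξ s j ω) t (a i) *
        (F.trans (t + 1) (ξ t (a i) ω)).real (C i)

end FFBS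

/-! Only the particles matter. Summing over the ancestors, the generation at time `r + 1` is, given
the past, an i.i.d. sample from the weighted mixture `mix` (`IsBootstrapFilter.isParticleLaw`). The
backward weights are the posterior law of the parent given the child under this mixture, so
integrating out a new particle turns `beta` into a forward weight and a forward move
(`integral_beta_mul`).

Write μ^BS as a recursion on its terminal indices (`pairSum`). Given the past, μ^BS at time `t + 1`
is then a sum over single particles, or over pairs of distinct particles, of an i.i.d. sample. By
the reversal identity its conditional mean is μ^BS at time `t` applied to `pairPush`
(`integral_stepBS`), which is the recursion satisfied by μ itself (`muInt_succ`). Only pairs that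
share an index are correlated, so the conditional variance is controlled by `energy`, the sum of the
squared row sums of the weights. The energy starts below `4 / N` and its mean grows by at most `8 *
G ^ 4` per step. For a fixed test function the mean square error is therefore of order 1/N
(`exists_integral_muBS_sub_sq_le`).

The test functions of the theorem depend on the particles through T_s^N. On additive functionals the
error of T_s^N obeys a recursion in s: a `beta`-average of the previous errors, plus a
`beta`-average of a function `bwDev` that is centred for the backward kernel. Integrating the second
term against `mix` cancels the random denominator of `beta`. What remains is a ν-integral of
absolute particle estimates of centred functions; these vanish pointwise by the law of large numbers
and are dominated by a ν-integrable function. So the error vanishes in mean along the particles at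
time s (`tendsto_integral_margN_bwErr`), without a rate and without a lower bound on the densities.

The effect of this error on μ^BS is bounded in mean by going back from time t to time s
(`integral_muBS_point_le`). At time s the two lineages coalesce, and there μ^BS is at most a
constant times the empirical measure (`muBS_e_le`). Boundedness, together with the L² convergence of
the total mass, upgrades the L¹ bound to L² (`tendsto_integral_muBS_sub_sq`). This gives (i).

For (ii), the random centring is factored out of the quadratic form. The coefficients converge by
(i), the centring and the normalization by the law of large numbers and the same error bound, and
the continuous mapping theorem concludes. The limit is the asymptotic variance because under
μ_{e_s,t} the lineages are independent except for their meeting at time s, so each term reduces to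
γ_s(1) times the γ_s-integral of a squared `influence` (`muInt_influence`, `asymptVar_term_eq`). -/

namespace FFBS

/-! ### The Markov law of the particles once the ancestors are summed out -/

/-- The realizations of a particle system with `N` particles. -/
abbrev Cloud (X : Type*) (N : ℕ) : Type _ := ℕ → Fin N → X

namespace FeynmanKac

variable {X : Type*} [MeasurableSpace X] (F : FeynmanKac X) {N : ℕ}

/-- The conditional law of each particle at time `r + 1` given the cloud up to time `r`. -/
noncomputable def mix (z : Cloud X N) (r : ℕ) : Measure X :=
  ∑ i, ENNReal.ofReal (F.weight z r i) • F.trans (r + 1) (z r i)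

instance (z : Cloud X N) (r : ℕ) : IsFiniteMeasure (F.mix z r) := by
  unfold mix
  have (i : Fin N) : IsFiniteMeasure
      (ENNReal.ofReal (F.weight z r i) • F.trans (r + 1) (z r i)) :=
    Measure.smul_finite _ ENNReal.ofReal_ne_top
  infer_instance

lemma totalWeight_nonneg (z : Cloud X N) (r : ℕ) : 0 ≤ F.totalWeight z r :=
  Finset.sum_nonneg fun _ _ => F.pot_nonneg _ _

lemma weight_nonneg (z : Cloud X N) (r : ℕ) (i : Fin N) : 0 ≤ F.weight z r i :=
  div_nonneg (F.pot_nonneg _ _) (F.totalWeight_nonneg z r)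

lemma totalWeight_pos (hg : ∀ t x, 0 < F.pot t x) [NeZero N] (z : Cloud X N) (r : ℕ) :
    0 < F.totalWeight z r :=
  Finset.sum_pos (fun _ _ => hg _ _) Finset.univ_nonempty

lemma sum_weight (hg : ∀ t x, 0 < F.pot t x) [NeZero N] (z : Cloud X N) (r : ℕ) :
    ∑ i, F.weight z r i = 1 := by
  unfold weight
  rw [← Finset.sum_div]
  exact div_self (F.totalWeight_pos hg z r).ne'

lemma measurable_totalWeight (r : ℕ) :
    Measurable (fun z : Cloud X N => F.totalWeight z r) := by
  unfold totalWeight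
  exact Finset.measurable_sum _ fun i _ =>
    (F.pot_measurable r).comp ((measurable_pi_apply i).comp (measurable_pi_apply r))

lemma measurable_weight (r : ℕ) (i : Fin N) :
    Measurable (fun z : Cloud X N => F.weight z r i) :=
  ((F.pot_measurable r).comp ((measurable_pi_apply i).comp (measurable_pi_apply r))).div
    (F.measurable_totalWeight r)

lemma mix_real_apply (z : Cloud X N) (r : ℕ) (s : Set X) :
    (F.mix z r).real s = ∑ i, F.weight z r i * (F.trans (r + 1) (z r i)).real s := by
  simp only [mix, Measure.real, Measure.coe_finsetSum, Finset.sum_apply, Measure.smul_apply,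
    smul_eq_mul]
  rw [ENNReal.toReal_sum fun i _ => ENNReal.mul_ne_top ENNReal.ofReal_ne_top (measure_ne_top _ _)]
  exact Finset.sum_congr rfl fun i _ => by
    rw [ENNReal.toReal_mul, ENNReal.toReal_ofReal (F.weight_nonneg _ _ _)]

lemma isProbabilityMeasure_mix (hg : ∀ t x, 0 < F.pot t x) [NeZero N] (z : Cloud X N) (r : ℕ) :
    IsProbabilityMeasure (F.mix z r) := by
  constructor
  have h := F.mix_real_apply z r Set.univ
  simp only [probReal_univ, mul_one, F.sum_weight hg] at h
  rwa [Measure.real, ENNReal.toReal_eq_one_iff] at h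

lemma integral_mix (z : Cloud X N) (r : ℕ) (f : X → ℝ)
    (hf : ∀ i, Integrable f (F.trans (r + 1) (z r i))) :
    ∫ x, f x ∂F.mix z r = ∑ i, F.weight z r i * ∫ x, f x ∂F.trans (r + 1) (z r i) := by
  unfold mix
  rw [integral_finsetSum_measure fun i _ => (hf i).smul_measure ENNReal.ofReal_ne_top]
  exact Finset.sum_congr rfl fun i _ => by
    rw [integral_smul_measure, ENNReal.toReal_ofReal (F.weight_nonneg _ _ _), smul_eq_mul]

lemma measurable_mix (r : ℕ) : Measurable (fun z : Cloud X N => F.mix z r) := by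
  refine Measure.measurable_of_measurable_coe _ fun s hs => ?_
  simp only [mix, Measure.coe_finsetSum, Finset.sum_apply, Measure.smul_apply, smul_eq_mul]
  refine Finset.measurable_sum _ fun i _ => (F.measurable_weight r i).ennreal_ofReal.mul ?_
  exact ((F.trans (r + 1)).measurable_coe hs).comp
    ((measurable_pi_apply i).comp (measurable_pi_apply r))

lemma mix_congr {z z' : Cloud X N} {r : ℕ} (h : z r = z' r) : F.mix z r = F.mix z' r := by
  simp only [mix, weight, totalWeight, h]

/-- The conditional law of the `N` particles at time `r + 1` given the cloud up to time `r`. -/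
noncomputable def moveKer (hg : ∀ t x, 0 < F.pot t x) [NeZero N] (r : ℕ) :
    Kernel (Cloud X N) (Fin N → X) where
  toFun z := Measure.pi fun _ => F.mix z r
  measurable' := by
    have (z : Cloud X N) := F.isProbabilityMeasure_mix hg z r
    -- Measurability of a family of probability measures is tested on a generating π-system. On
    -- boxes the product measure is a finite product of `mix` masses.
    refine Measurable.measure_of_isPiSystem_of_isProbabilityMeasure
      (S := Set.pi Set.univ '' Set.pi Set.univ fun _ : Fin N => {s : Set X | MeasurableSet s})
      generateFrom_pi.symm isPiSystem_pi ?_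
    rintro _ ⟨C, hC, rfl⟩
    simp only [Measure.pi_pi]
    exact Finset.measurable_prod _ fun i _ =>
      (Measure.measurable_coe (hC i (Set.mem_univ i))).comp (F.measurable_mix r)

instance (hg : ∀ t x, 0 < F.pot t x) [NeZero N] (r : ℕ) :
    IsMarkovKernel (F.moveKer hg r : Kernel (Cloud X N) (Fin N → X)) := by
  constructor
  intro z
  have := F.isProbabilityMeasure_mix hg z r
  exact inferInstanceAs (IsProbabilityMeasure (Measure.pi fun _ : Fin N => F.mix z r))

/-- The law of a bootstrap particle filter, as a measure on clouds. -/
structure IsParticleLaw (L : Measure (Cloud X N)) : Prop where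
  prob : IsProbabilityMeasure L
  init : L.map (fun z => z 0) = Measure.pi fun _ => F.init
  -- The Markov property is phrased with test functions that read the first cloud only up to time
  -- `r`, so no filtration has to be carried along.
  step : ∀ (r : ℕ) (f : Cloud X N → (Fin N → X) → ℝ),
    BddMeasurable (Function.uncurry f) →
    (∀ z z' y, (∀ u ≤ r, z u = z' u) → f z y = f z' y) →
    ∫ z, f z (z (r + 1)) ∂L = ∫ z, ∫ y, f z y ∂Measure.pi (fun _ => F.mix z r) ∂L

end FeynmanKac

open FeynmanKac

variable {X Ω : Type*} [MeasurableSpace X] {F : FeynmanKac X}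
  {N : ℕ} {ξ : ℕ → Fin N → Ω → X} {A : ℕ → Fin N → Ω → Fin N}

lemma measurable_history_particle {r u : ℕ} (hu : u ≤ r) (i : Fin N) :
    Measurable[history ξ A r] (ξ u i) := by
  refine Measurable.of_comap_le (le_trans ?_ le_sup_left)
  exact le_iSup_of_le (⟨u, Nat.lt_succ_of_le hu⟩ : Fin (r + 1))
    (le_iSup (fun i => MeasurableSpace.comap (ξ u i) inferInstance) i)

variable [MeasurableSpace Ω] {P : Measure Ω}

lemma IsBootstrapFilter.history_le (h : IsBootstrapFilter F P ξ A) (r : ℕ) :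
    history ξ A r ≤ ‹MeasurableSpace Ω› := by
  refine sup_le (iSup_le fun s => iSup_le fun i => ?_) (iSup_le fun s => iSup_le fun i => ?_)
  · exact (h.measurable_particle s i).comap_le
  · exact (h.measurable_ancestor s i).comap_le

lemma IsBootstrapFilter.measurable_cloud (h : IsBootstrapFilter F P ξ A) :
    Measurable (fun ω => (fun u i => ξ u i ω : Cloud X N)) :=
  measurable_pi_lambda _ fun u => measurable_pi_lambda _ fun i => h.measurable_particle u i

/-- Summing the joint law of parents and positions over all ancestor vectors turns the products of
weights and moves into a product of mixtures. The ancestors disappear and the new particles become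
conditionally i.i.d. -/
lemma IsBootstrapFilter.measure_inter_box [IsProbabilityMeasure P]
    (h : IsBootstrapFilter F P ξ A) (r : ℕ)
    {B : Set Ω} (hB : MeasurableSet[history ξ A r] B) {C : Fin N → Set X}
    (hC : ∀ i, MeasurableSet (C i)) :
    P.real (B ∩ {ω | ∀ i, ξ (r + 1) i ω ∈ C i}) =
      ∫ ω in B, ∏ i, (F.mix (fun u j => ξ u j ω) r).real (C i) ∂P := by
  have hB' : MeasurableSet B := h.history_le r B hB
  set S : (Fin N → Fin N) → Set Ω := fun a => {ω | ∀ i, A r i ω = a i ∧ ξ (r + 1) i ω ∈ C i}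
  have hS (a : Fin N → Fin N) : MeasurableSet (S a) := by
    simp only [S, Set.ofPred_forall]
    refine MeasurableSet.iInter fun i => MeasurableSet.inter ?_ ?_
    · exact h.measurable_ancestor r i (measurableSet_singleton (a i))
    · exact h.measurable_particle (r + 1) i (hC i)
  -- Integrability is inherited from the conditional expectation with which the product agrees
  -- almost everywhere.
  have hint (a : Fin N → Fin N) : Integrable (fun ω => ∏ i, F.weight (fun s j => ξ s j ω) r (a i) *
        (F.trans (r + 1) (ξ r (a i) ω)).real (C i)) P :=
    (integrable_condExp (m := history ξ A r) (μ := P)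
      (f := (S a).indicator fun _ => (1 : ℝ))).congr (h.law_step r a C hC)
  have hset : B ∩ {ω | ∀ i, ξ (r + 1) i ω ∈ C i} = ⋃ a, B ∩ S a := by
    ext ω
    simp only [S, Set.mem_inter_iff, Set.mem_ofPred_eq, Set.mem_iUnion]
    constructor
    · rintro ⟨h1, h2⟩
      exact ⟨fun i => A r i ω, h1, fun i => ⟨rfl, h2 i⟩⟩
    · rintro ⟨a, h1, h2⟩
      exact ⟨h1, fun i => (h2 i).2⟩
  rw [hset, measureReal_iUnion_fintype]
  rotate_left
  · intro a a' haa
    refine Set.disjoint_left.2 fun ω h1 h2 => haa (funext fun i => ?_)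
    rw [← (h1.2 i).1, ← (h2.2 i).1]
  · exact fun a => hB'.inter (hS a)
  have hone (a : Fin N → Fin N) : P.real (B ∩ S a) = ∫ ω in B, ∏ i, F.weight (fun s j => ξ s j ω) r (a i) *
        (F.trans (r + 1) (ξ r (a i) ω)).real (C i) ∂P := by
    have e1 := setIntegral_condExp (m := history ξ A r) (μ := P) (h.history_le r)
      (f := (S a).indicator fun _ => (1 : ℝ)) ((integrable_const _).indicator (hS a)) hB
    rw [setIntegral_congr_ae hB' ((h.law_step r a C hC).mono fun ω hω _ => hω),
      setIntegral_indicator (hS a)] at e1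
    rw [e1]; simp
  simp_rw [hone]
  rw [← integral_finsetSum _ fun a _ => (hint a).integrableOn]
  refine integral_congr_ae (ae_of_all _ fun ω => ?_)
  simp only [mix_real_apply]
  -- Distributivity: a product over particles of sums over parents is a sum over ancestor vectors of
  -- products.
  rw [Finset.prod_univ_sum, Fintype.piFinset_univ]

/-- The cloud `z` frozen from time `r` on. -/
def freeze (r : ℕ) (z : Cloud X N) : Cloud X N := fun u => z (min u r)

lemma measurable_freeze (r : ℕ) : Measurable (freeze r : Cloud X N → Cloud X N) :=
  measurable_pi_lambda _ fun _ => measurable_pi_apply _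

/-- The frozen cloud contains exactly the past particles and is measurable for `history`. The
conditional statement can thus be recast as an identity of joint laws, from which integrals of
arbitrary bounded functions of past and present follow. -/
lemma IsBootstrapFilter.map_eq_compProd [IsProbabilityMeasure P]
    (h : IsBootstrapFilter F P ξ A) (hg : ∀ t x, 0 < F.pot t x) [NeZero N] (r : ℕ) :
    P.map (fun ω => (freeze r (fun u i => ξ u i ω : Cloud X N), fun i => ξ (r + 1) i ω)) =
      (P.map fun ω => freeze r (fun u i => ξ u i ω : Cloud X N)) ⊗ₘ F.moveKer hg r := by
  have hZ : Measurable fun ω => freeze r (fun u i => ξ u i ω : Cloud X N) :=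
    (measurable_freeze r).comp h.measurable_cloud
  have hY : Measurable fun ω => fun i => ξ (r + 1) i ω :=
    measurable_pi_lambda _ fun i => h.measurable_particle (r + 1) i
  have hp : IsProbabilityMeasure (P.map fun ω => freeze r (fun u i => ξ u i ω : Cloud X N)) :=
    Measure.isProbabilityMeasure_map hZ.aemeasurable
  have hp' : IsProbabilityMeasure
    (P.map (fun ω => (freeze r (fun u i => ξ u i ω : Cloud X N), fun i => ξ (r + 1) i ω))) :=
    Measure.isProbabilityMeasure_map (hZ.prodMk hY).aemeasurable
  refine Measure.ext_prod_iff.2 fun {B T} hB hT => ?_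
  rw [Measure.compProd_apply_prod hB hT,
    setLIntegral_map hB ((F.moveKer hg r).measurable_coe hT) hZ,
    Measure.map_apply (hZ.prodMk hY) (hB.prod hT)]
  set B' : Set Ω := (fun ω => freeze r (fun u i => ξ u i ω : Cloud X N)) ⁻¹' B
  have hB'h : MeasurableSet[history ξ A r] B' := by
    have : Measurable[history ξ A r] (fun ω => freeze r (fun u i => ξ u i ω : Cloud X N)) :=
      @measurable_pi_lambda _ _ _ (history ξ A r) _ _ fun u =>
        @measurable_pi_lambda _ _ _ (history ξ A r) _ _ fun i =>
          measurable_history_particle (min_le_right u r) i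
    exact this hB
  have hB' : MeasurableSet B' := hZ hB
  -- With the past event fixed, both sides are finite measures on the new generation, so agreement
  -- on boxes and on the total mass suffices.
  have key : (P.restrict B').map (fun ω => fun i => ξ (r + 1) i ω) =
      F.moveKer hg r ∘ₘ ((P.restrict B').map fun ω => freeze r (fun u i => ξ u i ω : Cloud X N)) := by
    refine ext_of_generate_finite (Set.pi Set.univ '' Set.pi Set.univ
      fun _ : Fin N => {s : Set X | MeasurableSet s}) generateFrom_pi.symm isPiSystem_pi ?_ ?_
    · rintro _ ⟨C, hC, rfl⟩
      have hC' : ∀ i, MeasurableSet (C i) := fun i => hC i (Set.mem_univ i)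
      have hCm : MeasurableSet (Set.pi Set.univ C) := MeasurableSet.univ_pi hC'
      rw [Measure.map_apply hY hCm, Measure.restrict_apply (hY hCm),
        Measure.bind_apply hCm (Kernel.aemeasurable _),
        lintegral_map ((F.moveKer hg r).measurable_coe hCm) hZ]
      have e1 := h.measure_inter_box r hB'h hC'
      rw [Set.inter_comm]
      have e2 : (fun ω i => ξ (r + 1) i ω) ⁻¹' Set.pi Set.univ C =
          {ω | ∀ i, ξ (r + 1) i ω ∈ C i} := by ext ω; simp
      rw [e2]
      have e3 : ∀ ω, F.moveKer hg r (freeze r (fun u i => ξ u i ω : Cloud X N)) (Set.pi Set.univ C)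
          = ENNReal.ofReal (∏ i, (F.mix (fun u j => ξ u j ω) r).real (C i)) := by
        intro ω
        have : F.mix (freeze r (fun u i => ξ u i ω : Cloud X N)) r = F.mix (fun u j => ξ u j ω) r :=
          F.mix_congr (by simp [freeze])
        change Measure.pi (fun _ => F.mix (freeze r (fun u i => ξ u i ω : Cloud X N)) r) _ = _
        rw [this, Measure.pi_pi, ENNReal.ofReal_prod_of_nonneg fun _ _ => measureReal_nonneg]
        simp
      simp_rw [e3]
      rw [← ofReal_integral_eq_lintegral_ofReal, ← e1, ofReal_measureReal]
      · refine Integrable.mono' (integrable_const (1 : ℝ)) ?_ (ae_of_all _ fun ω => ?_)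
        · refine (Finset.measurable_prod _ fun i _ => ?_).aestronglyMeasurable
          exact ((Measure.measurable_coe (hC' i)).comp
            ((F.measurable_mix r).comp h.measurable_cloud)).ennreal_toReal
        · have (z : Cloud X N) := F.isProbabilityMeasure_mix hg z r
          rw [Real.norm_of_nonneg (Finset.prod_nonneg fun _ _ => measureReal_nonneg)]
          exact Finset.prod_le_one (fun _ _ => measureReal_nonneg) fun _ _ => measureReal_le_one
      · exact ae_of_all _ fun ω => Finset.prod_nonneg fun _ _ => measureReal_nonneg
    · rw [Measure.bind_apply MeasurableSet.univ (Kernel.aemeasurable _)]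
      simp [Measure.map_apply hY, Measure.map_apply hZ]
  have e4 := congrArg (fun μ => μ T) key
  rw [Measure.map_apply hY hT, Measure.restrict_apply (hY hT),
    Measure.bind_apply hT (Kernel.aemeasurable _),
    lintegral_map ((F.moveKer hg r).measurable_coe hT) hZ, Set.inter_comm] at e4
  exact e4

/-- A test function that reads the past only up to `r` does not notice that the cloud is frozen
there, so the disintegration of the joint law becomes the one-step identity for clouds. -/
theorem IsBootstrapFilter.isParticleLaw [IsProbabilityMeasure P]
    (h : IsBootstrapFilter F P ξ A) (hg : ∀ t x, 0 < F.pot t x) [NeZero N] :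
    F.IsParticleLaw (P.map fun ω => (fun u i => ξ u i ω : Cloud X N)) where
  prob := Measure.isProbabilityMeasure_map h.measurable_cloud.aemeasurable
  init := by
    rw [Measure.map_map (measurable_pi_apply 0) h.measurable_cloud]
    exact h.law_init
  step := by
    rintro r f ⟨hf, C, hC⟩ hdep
    have hZ : Measurable fun ω => freeze r (fun u i => ξ u i ω : Cloud X N) :=
      (measurable_freeze r).comp h.measurable_cloud
    have hY : Measurable fun ω => fun i => ξ (r + 1) i ω :=
      measurable_pi_lambda _ fun i => h.measurable_particle (r + 1) i
    have hfr (z : Cloud X N) (y) : f (freeze r z) y = f z y :=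
      hdep _ _ y fun u hu => by simp [freeze, min_eq_left hu]
    have hp : IsProbabilityMeasure (P.map fun ω => freeze r (fun u i => ξ u i ω : Cloud X N)) :=
      Measure.isProbabilityMeasure_map hZ.aemeasurable
    have e1 := congrArg (fun μ => ∫ p, Function.uncurry f p ∂μ) (h.map_eq_compProd hg r)
    have hfint : Integrable (Function.uncurry f)
        ((P.map fun ω => freeze r (fun u i => ξ u i ω : Cloud X N)) ⊗ₘ F.moveKer hg r) :=
      Integrable.of_bound hf.aestronglyMeasurable C (ae_of_all _ hC)
    have hmm : StronglyMeasurable fun z : Cloud X N => ∫ y, f z y ∂F.moveKer hg r z :=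
      StronglyMeasurable.integral_kernel_prod_right hf.stronglyMeasurable
    rw [integral_map (hZ.prodMk hY).aemeasurable hf.aestronglyMeasurable,
      Measure.integral_compProd hfint] at e1
    simp only [Function.uncurry] at e1
    rw [integral_map hZ.aemeasurable hmm.aestronglyMeasurable] at e1
    have hm2 : Measurable fun z : Cloud X N => f z (z (r + 1)) :=
      hf.comp (measurable_id.prodMk (measurable_pi_apply (r + 1)))
    have hm3 : Measurable fun z : Cloud X N => ∫ y, f z y ∂Measure.pi (fun _ => F.mix z r) :=
      hmm.measurable
    rw [integral_map h.measurable_cloud.aemeasurable hm2.aestronglyMeasurable,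
      integral_map h.measurable_cloud.aemeasurable hm3.aestronglyMeasurable]
    simp_rw [hfr] at e1
    rw [e1]
    refine integral_congr_ae (ae_of_all _ fun ω => ?_)
    have : F.mix (freeze r (fun u i => ξ u i ω : Cloud X N)) r = F.mix (fun u j => ξ u j ω) r :=
      F.mix_congr (by simp [freeze])
    change ∫ y, _ ∂Measure.pi (fun _ => F.mix (freeze r (fun u i => ξ u i ω : Cloud X N)) r) = _
    rw [this]

end FFBS

/-! ### Closure properties of bounded measurable functions -/

namespace FFBS

section BddMeasurable

variable {E E' : Type*} [MeasurableSpace E] [MeasurableSpace E'] {f g : E → ℝ}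

lemma BddMeasurable.integrable (hf : BddMeasurable f) (μ : Measure E) [IsFiniteMeasure μ] :
    Integrable f μ := by
  obtain ⟨hm, C, hC⟩ := hf
  exact Integrable.of_bound hm.aestronglyMeasurable C (ae_of_all _ hC)

lemma BddMeasurable.const (c : ℝ) : BddMeasurable fun _ : E => c :=
  ⟨measurable_const, |c|, fun _ => le_rfl⟩

lemma BddMeasurable.add (hf : BddMeasurable f) (hg : BddMeasurable g) :
    BddMeasurable fun x => f x + g x := by
  obtain ⟨hm, C, hC⟩ := hf
  obtain ⟨hm', C', hC'⟩ := hg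
  exact ⟨hm.add hm', C + C', fun x => (abs_add_le _ _).trans (add_le_add (hC x) (hC' x))⟩

lemma BddMeasurable.neg (hf : BddMeasurable f) : BddMeasurable fun x => -f x := by
  obtain ⟨hm, C, hC⟩ := hf
  exact ⟨hm.neg, C, fun x => by rw [abs_neg]; exact hC x⟩

lemma BddMeasurable.sub (hf : BddMeasurable f) (hg : BddMeasurable g) :
    BddMeasurable fun x => f x - g x := by
  simpa only [sub_eq_add_neg] using hf.add hg.neg

lemma BddMeasurable.mul (hf : BddMeasurable f) (hg : BddMeasurable g) :
    BddMeasurable fun x => f x * g x := by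
  obtain ⟨hm, C, hC⟩ := hf
  obtain ⟨hm', C', hC'⟩ := hg
  refine ⟨hm.mul hm', C * C', fun x => ?_⟩
  rw [abs_mul]
  exact mul_le_mul (hC x) (hC' x) (abs_nonneg _) ((abs_nonneg _).trans (hC x))

lemma BddMeasurable.pow (hf : BddMeasurable f) (n : ℕ) : BddMeasurable fun x => f x ^ n := by
  induction n with
  | zero => simpa using BddMeasurable.const (E := E) 1
  | succ n ih => simpa only [pow_succ] using ih.mul hf

lemma BddMeasurable.abs (hf : BddMeasurable f) : BddMeasurable fun x => |f x| := by
  obtain ⟨hm, C, hC⟩ := hf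
  exact ⟨hm.abs, C, fun x => by rw [abs_abs]; exact hC x⟩

lemma BddMeasurable.comp (hf : BddMeasurable f) {φ : E' → E} (hφ : Measurable φ) :
    BddMeasurable fun x => f (φ x) := by
  obtain ⟨hm, C, hC⟩ := hf
  exact ⟨hm.comp hφ, C, fun x => hC _⟩

lemma BddMeasurable.sum {ι : Type*} (s : Finset ι) {f : ι → E → ℝ}
    (hf : ∀ i ∈ s, BddMeasurable (f i)) : BddMeasurable fun x => ∑ i ∈ s, f i x := by
  classical
  induction s using Finset.induction_on with
  | empty => simpa using BddMeasurable.const (E := E) 0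
  | insert a s ha ih =>
    simp only [Finset.sum_insert ha]
    exact (hf a (Finset.mem_insert_self a s)).add
      (ih fun i hi => hf i (Finset.mem_insert_of_mem hi))

lemma BddMeasurable.ite {p : Prop} [Decidable p] (hf : BddMeasurable f) (hg : BddMeasurable g) :
    BddMeasurable fun x => if p then f x else g x := by
  split_ifs <;> assumption

/-- The integral of a bounded measurable function against a Markov kernel. -/
lemma BddMeasurable.integral_kernel {κ : Kernel E E'} [IsMarkovKernel κ] {f : E → E' → ℝ}
    (hf : BddMeasurable (Function.uncurry f)) : BddMeasurable fun x => ∫ y, f x y ∂κ x := by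
  obtain ⟨hm, C, hC⟩ := hf
  refine ⟨(StronglyMeasurable.integral_kernel_prod_right hm.stronglyMeasurable).measurable, C,
    fun x => ?_⟩
  have := norm_integral_le_of_norm_le_const (μ := κ x) (f := f x) (C := C)
    (ae_of_all _ fun y => hC (x, y))
  simpa using this

end BddMeasurable

/-! ### Moments of sums over one or two coordinates of an i.i.d. sample -/

section Iid

variable {X : Type*} [MeasurableSpace X] {N : ℕ} (ρ : Measure X) [IsProbabilityMeasure ρ]

lemma iIndepFun_eval_pi :
    iIndepFun (fun (i : Fin N) (y : Fin N → X) => y i) (Measure.pi fun _ => ρ) :=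
  iIndepFun_pi (X := fun _ x => x) fun _ => aemeasurable_id

lemma map_eval_pi (k : Fin N) : (Measure.pi fun _ : Fin N => ρ).map (fun y => y k) = ρ :=
  (measurePreserving_eval (fun _ : Fin N => ρ) k).map_eq

lemma map_eval_pair_pi {k l : Fin N} (hkl : k ≠ l) :
    (Measure.pi fun _ : Fin N => ρ).map (fun y => (y k, y l)) = ρ.prod ρ := by
  have h := (iIndepFun_eval_pi (N := N) ρ).indepFun hkl
  rw [indepFun_iff_map_prod_eq_prod_map_map (measurable_pi_apply k).aemeasurable
    (measurable_pi_apply l).aemeasurable, map_eval_pi, map_eval_pi] at h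
  exact h

lemma map_eval_triple_pi {k l j : Fin N} (hkl : k ≠ l) (hkj : k ≠ j) (hlj : l ≠ j) :
    (Measure.pi fun _ : Fin N => ρ).map (fun y => ((y k, y l), y j)) = (ρ.prod ρ).prod ρ := by
  have h := (iIndepFun_eval_pi (N := N) ρ).indepFun_prodMk (fun i => measurable_pi_apply i)
    k l j hkj hlj
  rw [indepFun_iff_map_prod_eq_prod_map_map
    ((measurable_pi_apply k).prodMk (measurable_pi_apply l)).aemeasurable
    (measurable_pi_apply j).aemeasurable, map_eval_pi, map_eval_pair_pi ρ hkl] at h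
  exact h

variable {F H : X → X → ℝ}

lemma integral_eval_pair_pi (hF : Measurable (Function.uncurry F)) {k l : Fin N} (hkl : k ≠ l) :
    ∫ y, F (y k) (y l) ∂(Measure.pi fun _ : Fin N => ρ) =
      ∫ p, Function.uncurry F p ∂ρ.prod ρ := by
  rw [← map_eval_pair_pi ρ hkl, integral_map
    ((measurable_pi_apply k).prodMk (measurable_pi_apply l)).aemeasurable hF.aestronglyMeasurable]
  rfl

/-- A bounded measurable function of two coordinates. -/
lemma BddMeasurable.eval_pair (hF : BddMeasurable (Function.uncurry F)) (k l : Fin N) :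
    BddMeasurable fun y : Fin N → X => F (y k) (y l) :=
  hF.comp (φ := fun y : Fin N → X => (y k, y l))
    ((measurable_pi_apply k).prodMk (measurable_pi_apply l))

/-- The mean of a sum of i.i.d. bounded variables. -/
lemma integral_sum_eval_pi {f : X → ℝ} (hf : BddMeasurable f) :
    ∫ y, ∑ k, f (y k) ∂(Measure.pi fun _ : Fin N => ρ) = N * ∫ x, f x ∂ρ := by
  rw [integral_finsetSum _ fun k _ => (hf.comp (measurable_pi_apply k)).integrable _]
  simp_rw [integral_comp_eval (μ := fun _ : Fin N => ρ) hf.1.aestronglyMeasurable]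
  simp

/-- The variance of a sum of i.i.d. bounded variables. -/
lemma integral_sum_eval_pi_sub_sq_le {f : X → ℝ} (hf : BddMeasurable f) :
    ∫ y, (∑ k, f (y k) - N * ∫ x, f x ∂ρ) ^ 2 ∂(Measure.pi fun _ : Fin N => ρ) ≤
      N * ∫ x, f x ^ 2 ∂ρ := by
  set θ := ∫ x, f x ∂ρ
  set D : X → ℝ := fun x => f x - θ
  have hD : BddMeasurable D := hf.sub (BddMeasurable.const θ)
  have hD0 : ∫ x, D x ∂ρ = 0 := by
    simp only [D]
    rw [integral_sub (hf.integrable _) (integrable_const _)]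
    simp [θ]
  have h1 (y : Fin N → X) : (∑ k, f (y k) - N * θ) ^ 2 = ∑ k, ∑ l, D (y k) * D (y l) := by
    rw [← Finset.sum_mul_sum, ← pow_two]
    simp [D, Finset.sum_sub_distrib]
  have hm : BddMeasurable (Function.uncurry fun x y => D x * D y) :=
    (hD.comp measurable_fst).mul (hD.comp measurable_snd)
  simp_rw [h1]
  rw [integral_finsetSum _ fun k _ =>
    (BddMeasurable.sum _ fun l _ => hm.eval_pair k l).integrable _]
  have h2 (k : Fin N) : ∫ y, ∑ l, D (y k) * D (y l) ∂(Measure.pi fun _ : Fin N => ρ) =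
      ∫ x, D x ^ 2 ∂ρ := by
    rw [integral_finsetSum _ fun l _ => (hm.eval_pair k l).integrable _,
      Finset.sum_eq_single k]
    · simp_rw [← pow_two]
      exact integral_comp_eval (μ := fun _ : Fin N => ρ) (i := k) (f := fun x => D x ^ 2)
        (hD.pow 2).1.aestronglyMeasurable
    -- Distinct coordinates are independent and `D` is centred, so only the diagonal terms survive.
    · intro l _ hl
      rw [integral_eval_pair_pi ρ (F := fun x y => D x * D y) hm.1 hl.symm]
      have := integral_prod_mul (μ := ρ) (ν := ρ) D D
      simp only [Function.uncurry_def]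
      rw [this, hD0, zero_mul]
    · simp
  simp_rw [h2]
  rw [Finset.sum_const, Finset.card_univ, Fintype.card_fin, nsmul_eq_mul]
  refine mul_le_mul_of_nonneg_left ?_ (Nat.cast_nonneg N)
  have h3 : ∫ x, D x ^ 2 ∂ρ = ∫ x, f x ^ 2 ∂ρ - θ ^ 2 := by
    have : ∀ x, D x ^ 2 = f x ^ 2 - (2 * θ * f x - θ ^ 2) := fun x => by simp only [D]; ring
    simp_rw [this]
    rw [integral_sub ((hf.pow 2).integrable _)
      ((((BddMeasurable.const _).mul hf).sub (BddMeasurable.const _)).integrable _),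
      integral_sub ((hf.integrable _).const_mul _) (integrable_const _), integral_const_mul]
    simp [θ]; ring
  rw [h3]
  linarith [sq_nonneg θ]

/-- The sum of `F (y_k) (y_l)` over the pairs `k ≠ l`. -/
def offSum (F : X → X → ℝ) (y : Fin N → X) : ℝ :=
  ∑ k, ∑ l, if k = l then 0 else F (y k) (y l)

/-- The sum of `F (y_k) (y_l)` over the `l ≠ k`. -/
def rowSum (F : X → X → ℝ) (y : Fin N → X) (k : Fin N) : ℝ :=
  ∑ l, if k = l then 0 else F (y k) (y l)

lemma BddMeasurable.rowSum (hF : BddMeasurable (Function.uncurry F)) (k : Fin N) :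
    BddMeasurable fun y : Fin N → X => rowSum F y k :=
  BddMeasurable.sum _ fun l _ => (BddMeasurable.const 0).ite (hF.eval_pair k l)

lemma BddMeasurable.offSum (hF : BddMeasurable (Function.uncurry F)) :
    BddMeasurable fun y : Fin N → X => offSum F y :=
  BddMeasurable.sum _ fun k _ => hF.rowSum k

lemma sum_sum_ite_const (c : ℝ) :
    ∑ k : Fin N, ∑ l : Fin N, (if k = l then 0 else c) = N * (N - 1) * c := by
  have (k l : Fin N) : (if k = l then 0 else c) = c - if k = l then c else 0 := by
    split_ifs <;> simp
  simp_rw [this, Finset.sum_sub_distrib]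
  simp
  ring

lemma integral_offSum (hF : BddMeasurable (Function.uncurry F)) :
    ∫ y, offSum F y ∂(Measure.pi fun _ : Fin N => ρ) =
      N * (N - 1) * ∫ p, Function.uncurry F p ∂ρ.prod ρ := by
  have h1 (y : Fin N → X) : offSum F y = ∑ k, rowSum F y k := rfl
  simp_rw [h1]
  rw [integral_finsetSum (f := fun k (y : Fin N → X) => rowSum F y k) _
    fun k _ => (hF.rowSum k).integrable _, ← sum_sum_ite_const]
  refine Finset.sum_congr rfl fun k _ => ?_
  unfold rowSum
  rw [integral_finsetSum _ fun l _ =>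
    ((BddMeasurable.const 0).ite (hF.eval_pair k l)).integrable _]
  refine Finset.sum_congr rfl fun l _ => ?_
  split_ifs with h
  · simp
  · exact integral_eval_pair_pi ρ hF.1 h

/-- Pairs with no common index are independent and have zero covariance. Otherwise the covariance is
at most the mean of the product, which `H` dominates. The indicators count shared indices; counting
several at once only weakens the bound. -/
lemma integral_pair_cov_le (hF : BddMeasurable (Function.uncurry F))
    (hH : BddMeasurable (Function.uncurry H)) (hFH : ∀ x y, |F x y| ≤ H x y)
    {k l k' l' : Fin N} (hkl : k ≠ l) (hkl' : k' ≠ l') :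
    ∫ y, (F (y k) (y l) - ∫ p, Function.uncurry F p ∂ρ.prod ρ) *
        (F (y k') (y l') - ∫ p, Function.uncurry F p ∂ρ.prod ρ)
          ∂(Measure.pi fun _ : Fin N => ρ) ≤
      ((if k = k' then 1 else 0) + (if k = l' then 1 else 0) + (if l = k' then 1 else 0) +
        if l = l' then 1 else 0) *
        ∫ y, H (y k) (y l) * H (y k') (y l') ∂(Measure.pi fun _ : Fin N => ρ) := by
  have hH0 (x y : X) : 0 ≤ H x y := (abs_nonneg _).trans (hFH x y)
  have hI0 : 0 ≤ ∫ y, H (y k) (y l) * H (y k') (y l') ∂(Measure.pi fun _ : Fin N => ρ) :=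
    integral_nonneg fun y => mul_nonneg (hH0 _ _) (hH0 _ _)
  set θ := ∫ p, Function.uncurry F p ∂ρ.prod ρ
  have i1 := (hF.eval_pair k l).integrable (Measure.pi fun _ : Fin N => ρ)
  have i2 := (hF.eval_pair k' l').integrable (Measure.pi fun _ : Fin N => ρ)
  have i3 := ((hF.eval_pair k l).mul (hF.eval_pair k' l')).integrable
    (Measure.pi fun _ : Fin N => ρ)
  have e : ∫ y, (F (y k) (y l) - θ) * (F (y k') (y l') - θ) ∂(Measure.pi fun _ : Fin N => ρ) =
      ∫ y, F (y k) (y l) * F (y k') (y l') ∂(Measure.pi fun _ : Fin N => ρ) - θ ^ 2 := by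
    have : ∀ y : Fin N → X, (F (y k) (y l) - θ) * (F (y k') (y l') - θ) =
      F (y k) (y l) * F (y k') (y l') - (θ * F (y k) (y l) + θ * F (y k') (y l') - θ ^ 2) :=
      fun y => by ring
    simp_rw [this]
    have j1 := (((BddMeasurable.const θ).mul (hF.eval_pair k l)).add
      ((BddMeasurable.const θ).mul (hF.eval_pair k' l')))
    rw [integral_sub i3 ((j1.sub (BddMeasurable.const _)).integrable _),
      integral_sub (j1.integrable _) (integrable_const _),
      integral_add (i1.const_mul θ) (i2.const_mul θ), integral_const_mul, integral_const_mul,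
      integral_eval_pair_pi ρ hF.1 hkl, integral_eval_pair_pi ρ hF.1 hkl']
    simp [θ]; ring
  rw [e]
  by_cases hd : k ≠ k' ∧ k ≠ l' ∧ l ≠ k' ∧ l ≠ l'
  · obtain ⟨h1, h2, h3, h4⟩ := hd
    have hind := (iIndepFun_eval_pi (N := N) ρ).indepFun_prodMk_prodMk
      (fun i => measurable_pi_apply i) k l k' l' h1 h2 h3 h4
    have h5 := (hind.comp hF.1 hF.1).integral_fun_mul_eq_mul_integral
      (hF.eval_pair k l).1.aestronglyMeasurable (hF.eval_pair k' l').1.aestronglyMeasurable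
    simp only [Function.comp_apply, Function.uncurry_apply_pair] at h5
    rw [h5, integral_eval_pair_pi ρ hF.1 hkl, integral_eval_pair_pi ρ hF.1 hkl']
    simp [h1, h2, h3, h4, θ, pow_two]
  · have h1 : (1 : ℝ) ≤ (if k = k' then 1 else 0) + (if k = l' then 1 else 0) +
        (if l = k' then 1 else 0) + if l = l' then 1 else 0 := by
      have : k = k' ∨ k = l' ∨ l = k' ∨ l = l' := by tauto
      rcases this with h | h | h | h <;> simp only [h, if_true] <;> split_ifs <;> norm_num
    refine le_trans ?_ (le_mul_of_one_le_left hI0 h1)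
    refine (sub_le_self _ (sq_nonneg θ)).trans (integral_mono i3
      (((hH.eval_pair k l).mul (hH.eval_pair k' l')).integrable _) fun y => ?_)
    calc F (y k) (y l) * F (y k') (y l') ≤ |F (y k) (y l)| * |F (y k') (y l')| := by
          rw [← abs_mul]; exact le_abs_self _
      _ ≤ _ := mul_le_mul (hFH _ _) (hFH _ _) (abs_nonneg _) (hH0 _ _)

/-- The variance of a sum over pairs of i.i.d. variables, bounded by its diagonal terms. -/
lemma integral_offSum_sub_sq_le (hF : BddMeasurable (Function.uncurry F))
    (hH : BddMeasurable (Function.uncurry H)) (hFH : ∀ x y, |F x y| ≤ H x y)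
    (hsymm : ∀ x y, H x y = H y x) :
    ∫ y, (offSum F y - N * (N - 1) * ∫ p, Function.uncurry F p ∂ρ.prod ρ) ^ 2
        ∂(Measure.pi fun _ : Fin N => ρ) ≤
      4 * ∫ y, ∑ k, rowSum H y k ^ 2 ∂(Measure.pi fun _ : Fin N => ρ) := by
  set θ := ∫ p, Function.uncurry F p ∂ρ.prod ρ
  set D : Fin N → Fin N → (Fin N → X) → ℝ :=
    fun k l y => if k = l then 0 else F (y k) (y l) - θ
  set K : Fin N → Fin N → (Fin N → X) → ℝ :=
    fun k l y => if k = l then 0 else H (y k) (y l)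
  set w : Fin N → Fin N → Fin N → Fin N → ℝ := fun k l k' l' =>
    (if k = k' then 1 else 0) + (if k = l' then 1 else 0) + (if l = k' then 1 else 0) +
        if l = l' then 1 else 0
  have hD (k l) : BddMeasurable (D k l) :=
    (BddMeasurable.const 0).ite ((hF.eval_pair k l).sub (BddMeasurable.const θ))
  have hK (k l) : BddMeasurable (K k l) := (BddMeasurable.const 0).ite (hH.eval_pair k l)
  have hKs (k l y) : K k l y = K l k y := by simp only [K, eq_comm (a := k), hsymm (y k)]
  have h1 (y : Fin N → X) : (offSum F y - N * (N - 1) * θ) ^ 2 =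
      ∑ k, ∑ l, ∑ k', ∑ l', D k l y * D k' l' y := by
    have : offSum F y - N * (N - 1) * θ = ∑ k, ∑ l, D k l y := by
      rw [← sum_sum_ite_const, offSum, ← Finset.sum_sub_distrib]
      refine Finset.sum_congr rfl fun k _ => ?_
      rw [← Finset.sum_sub_distrib]
      refine Finset.sum_congr rfl fun l _ => ?_
      simp only [D]; split_ifs <;> simp
    rw [this, pow_two]
    simp only [Finset.sum_mul]
    simp only [Finset.mul_sum]
  -- Each of the four possible coincidences identifies one index of each pair and, by the symmetry
  -- of `H`, leaves a sum of squared row sums. This is the origin of the constant 4.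
  have h2 (y : Fin N → X) : ∑ k, ∑ l, ∑ k', ∑ l', w k l k' l' * (K k l y * K k' l' y) =
      4 * ∑ k, rowSum H y k ^ 2 := by
    have hrow (k) : rowSum H y k ^ 2 = ∑ l, ∑ l', K k l y * K k l' y := by
      rw [← Finset.sum_mul_sum, pow_two]; rfl
    have hs : ∑ l, ∑ k, ∑ l', K k l y * K l l' y = ∑ k, rowSum H y k ^ 2 := by
      simp_rw [hrow]
      exact Finset.sum_congr rfl fun l _ => Finset.sum_congr rfl fun k _ =>
        Finset.sum_congr rfl fun l' _ => by rw [hKs k l]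
    have a1 : ∑ k, ∑ l, ∑ k', ∑ l', (if k = k' then 1 else 0) * (K k l y * K k' l' y) =
        ∑ k, rowSum H y k ^ 2 := by
      simp_rw [hrow]
      refine Finset.sum_congr rfl fun k _ => Finset.sum_congr rfl fun l _ => ?_
      rw [Finset.sum_eq_single k] <;> simp +contextual [eq_comm]
    have a2 : ∑ k, ∑ l, ∑ k', ∑ l', (if k = l' then 1 else 0) * (K k l y * K k' l' y) =
        ∑ k, rowSum H y k ^ 2 := by
      simp_rw [hrow]
      refine Finset.sum_congr rfl fun k _ => Finset.sum_congr rfl fun l _ =>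
        Finset.sum_congr rfl fun k' _ => ?_
      simp [hKs k' k]
    have a3 : ∑ k, ∑ l, ∑ k', ∑ l', (if l = k' then 1 else 0) * (K k l y * K k' l' y) =
        ∑ k, rowSum H y k ^ 2 := by
      rw [Finset.sum_comm, ← hs]
      refine Finset.sum_congr rfl fun l _ => Finset.sum_congr rfl fun k _ => ?_
      rw [Finset.sum_eq_single l] <;> simp +contextual [eq_comm]
    have a4 : ∑ k, ∑ l, ∑ k', ∑ l', (if l = l' then 1 else 0) * (K k l y * K k' l' y) =
        ∑ k, rowSum H y k ^ 2 := by
      rw [Finset.sum_comm, ← hs]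
      refine Finset.sum_congr rfl fun l _ => Finset.sum_congr rfl fun k _ =>
        Finset.sum_congr rfl fun k' _ => ?_
      simp [hKs k' l]
    simp only [w, add_mul, Finset.sum_add_distrib]
    rw [a1, a2, a3, a4]; ring
  simp_rw [h1]
  rw [← integral_const_mul]
  simp_rw [← h2]
  have hDD (k l k' l') : BddMeasurable fun y => D k l y * D k' l' y := (hD k l).mul (hD k' l')
  have hKK (k l k' l') : BddMeasurable fun y => w k l k' l' * (K k l y * K k' l' y) :=
    (BddMeasurable.const _).mul ((hK k l).mul (hK k' l'))
  have b1 (k l k') := fun l' (_ : l' ∈ Finset.univ) => hDD k l k' l'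
  have b2 (k l k') := fun l' (_ : l' ∈ Finset.univ) => hKK k l k' l'
  have c1 (k l) := fun k' (_ : k' ∈ Finset.univ) => BddMeasurable.sum _ (b1 k l k')
  have c2 (k l) := fun k' (_ : k' ∈ Finset.univ) => BddMeasurable.sum _ (b2 k l k')
  have d1 (k) := fun l (_ : l ∈ Finset.univ) => BddMeasurable.sum _ (c1 k l)
  have d2 (k) := fun l (_ : l ∈ Finset.univ) => BddMeasurable.sum _ (c2 k l)
  rw [integral_finsetSum _ fun k _ => (BddMeasurable.sum _ (d1 k)).integrable _,
    integral_finsetSum _ fun k _ => (BddMeasurable.sum _ (d2 k)).integrable _]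
  refine Finset.sum_le_sum fun k _ => ?_
  rw [integral_finsetSum _ fun l hl => (d1 k l hl).integrable _,
    integral_finsetSum _ fun l hl => (d2 k l hl).integrable _]
  refine Finset.sum_le_sum fun l _ => ?_
  rw [integral_finsetSum _ fun k' hl => (c1 k l k' hl).integrable _,
    integral_finsetSum _ fun k' hl => (c2 k l k' hl).integrable _]
  refine Finset.sum_le_sum fun k' _ => ?_
  rw [integral_finsetSum _ fun l' hl => (b1 k l k' l' hl).integrable _,
    integral_finsetSum _ fun l' hl => (b2 k l k' l' hl).integrable _]
  refine Finset.sum_le_sum fun l' _ => ?_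
  rw [integral_const_mul]
  by_cases hkl : k = l
  · simp [D, K, hkl]
  by_cases hkl' : k' = l'
  · simp [D, K, hkl']
  simp only [D, K, hkl, hkl', if_false]
  exact integral_pair_cov_le ρ hF hH hFH hkl hkl'

/-- The second moment of the row sums. -/
lemma integral_sum_rowSum_sq_le (hH : BddMeasurable (Function.uncurry H)) :
    ∫ y, ∑ k, rowSum H y k ^ 2 ∂(Measure.pi fun _ : Fin N => ρ) ≤
      N ^ 3 * ∫ x, (∫ y, H x y ∂ρ) ^ 2 ∂ρ + N ^ 2 * ∫ p, Function.uncurry H p ^ 2 ∂ρ.prod ρ := by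
  set a := ∫ x, (∫ y, H x y ∂ρ) ^ 2 ∂ρ
  set b := ∫ p, Function.uncurry H p ^ 2 ∂ρ.prod ρ
  have ha : 0 ≤ a := integral_nonneg fun _ => sq_nonneg _
  have hb : 0 ≤ b := integral_nonneg fun _ => sq_nonneg _
  set K : Fin N → Fin N → (Fin N → X) → ℝ :=
    fun k l y => if k = l then 0 else H (y k) (y l)
  have hK (k l) : BddMeasurable (K k l) := (BddMeasurable.const 0).ite (hH.eval_pair k l)
  -- Given coordinate `k`, two other distinct coordinates are independent, which gives `a`; a
  -- repeated coordinate gives the plain second moment `b`. Counting the triples produces the powers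
  -- `N ^ 3` and `N ^ 2`.
  have hterm (k l l') : ∫ y, K k l y * K k l' y ∂(Measure.pi fun _ : Fin N => ρ) ≤
      a + if l = l' then b else 0 := by
    by_cases h1 : k = l
    · simp only [K, h1, if_true, zero_mul, integral_zero]; split_ifs <;> positivity
    by_cases h2 : k = l'
    · simp only [K, h2, if_true, mul_zero, integral_zero]; split_ifs <;> positivity
    simp only [K, h1, h2, if_false]
    by_cases h3 : l = l'
    · subst h3
      simp only [if_true, ← pow_two]
      have hsq : BddMeasurable (Function.uncurry fun x y => H x y ^ 2) := hH.pow 2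
      rw [integral_eval_pair_pi ρ (F := fun x y => H x y ^ 2) hsq.1 h1]
      exact le_add_of_nonneg_left ha
    · simp only [h3, if_false, add_zero]
      apply le_of_eq
      have hm : BddMeasurable fun p : (X × X) × X => H p.2 p.1.1 * H p.2 p.1.2 :=
        (hH.comp (measurable_snd.prodMk (measurable_fst.comp measurable_fst))).mul
          (hH.comp (measurable_snd.prodMk (measurable_snd.comp measurable_fst)))
      have e := map_eval_triple_pi (N := N) ρ h3 (Ne.symm h1) (Ne.symm h2)
      have e2 := integral_map (μ := Measure.pi fun _ : Fin N => ρ)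
        (φ := fun y => ((y l, y l'), y k)) (by fun_prop) hm.1.aestronglyMeasurable
      rw [e, integral_prod_symm _ (hm.integrable _)] at e2
      simp only at e2
      rw [← e2]
      refine integral_congr_ae (ae_of_all _ fun x => ?_)
      simp only
      rw [integral_prod_mul (μ := ρ) (ν := ρ) (fun y => H x y) (fun y => H x y), pow_two]
  have hrow (y : Fin N → X) (k) : rowSum H y k ^ 2 = ∑ l, ∑ l', K k l y * K k l' y := by
    rw [← Finset.sum_mul_sum, pow_two]; rfl
  simp_rw [hrow]
  have b1 (k l) := fun l' (_ : l' ∈ Finset.univ) => (hK k l).mul (hK k l')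
  have c1 (k) := fun l (_ : l ∈ Finset.univ) => BddMeasurable.sum _ (b1 k l)
  rw [integral_finsetSum _ fun k _ => (BddMeasurable.sum _ (c1 k)).integrable _]
  calc _ ≤ ∑ k : Fin N, ∑ l : Fin N, ∑ l' : Fin N, (a + if l = l' then b else 0) := by
        refine Finset.sum_le_sum fun k _ => ?_
        rw [integral_finsetSum _ fun l hl => (c1 k l hl).integrable _]
        refine Finset.sum_le_sum fun l _ => ?_
        rw [integral_finsetSum _ fun l' hl => (b1 k l l' hl).integrable _]
        exact Finset.sum_le_sum fun l' _ => hterm k l l'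
    _ = _ := by simp [Finset.sum_add_distrib]; ring

end Iid

end FFBS

/-! ### Paths and one-step recursions for the Feynman-Kac measures -/

namespace FFBS

section Paths

variable {X : Type*}

@[simp] lemma last_snoc {t : ℕ} (p : Path X t) (y : X) : last (snoc p y) = y := by
  simp [last, snoc]

@[simp] lemma point_snoc {t s : ℕ} (p : Path X t) (y : X) (h : s ≤ t) :
    point (snoc p y) s (h.trans (Nat.le_succ t)) = point p s h := by
  simp [point, snoc, h]

@[simp] lemma point_self {t : ℕ} (p : Path X t) : point p t le_rfl = last p := rfl

variable [MeasurableSpace X]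

lemma measurable_point {t s : ℕ} (h : s ≤ t) : Measurable fun p : Path X t => point p s h :=
  measurable_pi_apply _

lemma measurable_snoc {t : ℕ} : Measurable fun p : Path X t × X => snoc p.1 p.2 := by
  refine measurable_pi_lambda _ fun i => ?_
  by_cases h : (i : ℕ) ≤ t
  · simp only [snoc, h, dif_pos]
    exact (measurable_point h).comp measurable_fst
  · simp only [snoc, h, dif_neg, not_false_eq_true]
    exact measurable_snd

/-- This is the bridge between the gluing of paths used by `Kernel.partialTraj` and `snoc`, in terms
of which all recursions are written. -/
lemma IicProdIoc_piSingleton {t : ℕ} (p : Path X t) (y : X) :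
    IicProdIoc (X := fun _ => X) t (t + 1)
      (p, MeasurableEquiv.piSingleton (X := fun _ => X) t y) = snoc p y := by
  funext i
  simp only [IicProdIoc, snoc, point, MeasurableEquiv.piSingleton]
  split_ifs with h
  · rfl
  · simp

end Paths

lemma integral_bind_of_bdd {E E' : Type*} [MeasurableSpace E] [MeasurableSpace E'] (μ : Measure E)
    [IsFiniteMeasure μ] (κ : Kernel E E') [IsFiniteKernel κ] {f : E' → ℝ} (hf : BddMeasurable f) :
    ∫ y, f y ∂(κ ∘ₘ μ) = ∫ x, ∫ y, f y ∂κ x ∂μ := by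
  rw [Measure.comp_eq_comp_const_apply, Kernel.integral_comp, Kernel.const_apply]
  rw [← Measure.comp_eq_comp_const_apply]
  exact hf.integrable _

lemma integral_kernel_map {E E' E'' : Type*} [MeasurableSpace E] [MeasurableSpace E']
    [MeasurableSpace E''] (κ : Kernel E E') {φ : E' → E''} (hφ : Measurable φ) {f : E'' → ℝ}
    (hf : BddMeasurable f) (x : E) : ∫ y, f y ∂κ.map φ x = ∫ y, f (φ y) ∂κ x := by
  rw [Kernel.map_apply _ hφ, integral_map hφ.aemeasurable hf.1.aestronglyMeasurable]

namespace FeynmanKac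

variable {X : Type*} [MeasurableSpace X] (F : FeynmanKac X) {G : ℝ}

lemma Q_apply (t : ℕ) (x : X) : F.Q t x = ENNReal.ofReal (F.pot t x) • F.trans (t + 1) x := by
  rw [Q, Kernel.withDensity_apply _
    ((F.pot_measurable t).comp measurable_fst).ennreal_ofReal, withDensity_const]

lemma integral_Q (t : ℕ) (x : X) (f : X → ℝ) :
    ∫ y, f y ∂F.Q t x = F.pot t x * ∫ y, f y ∂F.trans (t + 1) x := by
  rw [Q_apply, integral_smul_measure, ENNReal.toReal_ofReal (F.pot_nonneg _ _), smul_eq_mul]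

lemma isFiniteKernel_Q (hG : ∀ t x, F.pot t x ≤ G) (t : ℕ) : IsFiniteKernel (F.Q t) :=
  Kernel.isFiniteKernel_withDensity_of_bounded _ (B := ENNReal.ofReal G) ENNReal.ofReal_ne_top
    fun x _ => ENNReal.ofReal_le_ofReal (hG t x)

lemma isFiniteKernel_Qstep (hG : ∀ t x, F.pot t x ≤ G) (t : ℕ) : IsFiniteKernel (F.Qstep t) := by
  have := F.isFiniteKernel_Q hG t
  unfold Qstep; infer_instance

lemma isFiniteKernel_Qpath (hG : ∀ t x, F.pot t x ≤ G) (s t : ℕ) :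
    IsFiniteKernel (F.Qpath s t) := by
  have := F.isFiniteKernel_Qstep hG
  unfold Qpath; infer_instance

lemma isFiniteMeasure_joint (hG : ∀ t x, F.pot t x ≤ G) (t : ℕ) :
    IsFiniteMeasure (F.joint t) := by
  have := F.isFiniteKernel_Qpath hG 0 t
  unfold joint; infer_instance

lemma isFiniteMeasure_marg (hG : ∀ t x, F.pot t x ≤ G) (t : ℕ) :
    IsFiniteMeasure (F.marg t) := by
  have := F.isFiniteMeasure_joint hG t
  unfold marg; infer_instance

lemma bddMeasurable_pot (hG : ∀ t x, F.pot t x ≤ G) (t : ℕ) : BddMeasurable (F.pot t) :=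
  ⟨F.pot_measurable t, G, fun x => by rw [abs_of_nonneg (F.pot_nonneg t x)]; exact hG t x⟩

/-- The function `x_{0:t} ↦ g_t(x_t) ∫ φ(x_{0:t+1}) M_{t+1}(x_t, dx_{t+1})`. -/
noncomputable def push {t : ℕ} (φ : Path X (t + 1) → ℝ) (p : Path X t) : ℝ :=
  F.pot t (last p) * ∫ y, φ (snoc p y) ∂F.trans (t + 1) (last p)

lemma bddMeasurable_push (hG : ∀ t x, F.pot t x ≤ G) {t : ℕ} {φ : Path X (t + 1) → ℝ}
    (hφ : BddMeasurable φ) : BddMeasurable (F.push φ) :=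
  ((F.bddMeasurable_pot hG t).comp measurable_last).mul
    (BddMeasurable.integral_kernel (κ := (F.trans (t + 1)).comap last measurable_last)
      (f := fun p y => φ (snoc p y)) (hφ.comp measurable_snoc))

/-- The last transition is peeled off by the semigroup property of `Kernel.partialTraj` and then
written out explicitly. Later path integrals are computed by iterating this identity rather than by
handling the kernels. -/
lemma integral_Qpath_succ (hG : ∀ t x, F.pot t x ≤ G) {s t : ℕ} (hst : s ≤ t)
    {φ : Path X (t + 1) → ℝ} (hφ : BddMeasurable φ) (p : Path X s) :
    ∫ q, φ q ∂F.Qpath s (t + 1) p = ∫ q, F.push φ q ∂F.Qpath s t p := by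
  have i1 := F.isFiniteKernel_Qstep hG
  have i2 := F.isFiniteKernel_Qpath hG s t
  have i3 := F.isFiniteKernel_Qpath hG t (t + 1)
  have h1 : F.Qpath s (t + 1) = F.Qpath t (t + 1) ∘ₖ F.Qpath s t :=
    Kernel.partialTraj_succ_eq_comp hst
  rw [h1, Kernel.integral_comp (hφ.integrable _)]
  refine integral_congr_ae (ae_of_all _ fun q => ?_)
  have h2 : F.Qpath t (t + 1) = (Kernel.id ×ₖ ((F.Qstep t).map
      (MeasurableEquiv.piSingleton (X := fun _ => X) t))).map
      (IicProdIoc (X := fun _ => X) t (t + 1)) := Kernel.partialTraj_succ_self t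
  have h3 : BddMeasurable fun q => φ (IicProdIoc (X := fun _ => X) t (t + 1) q) :=
    hφ.comp measurable_IicProdIoc
  simp only
  rw [h2, integral_kernel_map _ (φ := IicProdIoc (X := fun _ => X) t (t + 1))
      measurable_IicProdIoc hφ, Kernel.prod_apply, Kernel.id_apply,
    integral_prod _ (h3.integrable _)]
  have h4 : Measurable fun x : Path X t => ∫ y, φ (IicProdIoc (X := fun _ => X) t (t + 1) (x, y))
      ∂((F.Qstep t).map (MeasurableEquiv.piSingleton (X := fun _ => X) t)) q :=
    (StronglyMeasurable.integral_prod_right' h3.1.stronglyMeasurable).measurable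
  rw [integral_dirac' _ _ h4.stronglyMeasurable, integral_kernel_map _
    (MeasurableEquiv.piSingleton (X := fun _ => X) t).measurable
    (f := fun y => φ (IicProdIoc (X := fun _ => X) t (t + 1) (q, y)))
    (h3.comp measurable_prodMk_left)]
  simp_rw [IicProdIoc_piSingleton]
  rw [Qstep, Kernel.comap_apply, integral_Q]
  rfl

lemma integral_Qpath_self {s : ℕ} {φ : Path X s → ℝ} (hφ : BddMeasurable φ) (p : Path X s) :
    ∫ q, φ q ∂F.Qpath s s p = φ p := by
  rw [Qpath, Kernel.partialTraj_self, Kernel.id_apply, integral_dirac' _ _ hφ.1.stronglyMeasurable]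

lemma integral_joint (hG : ∀ t x, F.pot t x ≤ G) (t : ℕ) {φ : Path X t → ℝ}
    (hφ : BddMeasurable φ) :
    ∫ q, φ q ∂F.joint t = ∫ x, ∫ q, φ q ∂F.Qpath 0 t (fun _ => x) ∂F.init := by
  have i2 := F.isFiniteKernel_Qpath hG 0 t
  have hm : Measurable fun x : X => (fun _ => x : Path X 0) := by fun_prop
  have : IsProbabilityMeasure (F.init.map fun x => (fun _ => x : Path X 0)) :=
    Measure.isProbabilityMeasure_map hm.aemeasurable
  rw [joint, integral_bind_of_bdd _ _ hφ, integral_map hm.aemeasurable]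
  exact (StronglyMeasurable.integral_kernel_prod_right' (κ := F.Qpath 0 t) (f := fun p => φ p.2)
    (hφ.1.comp measurable_snd).stronglyMeasurable).aestronglyMeasurable

lemma integral_joint_zero (hG : ∀ t x, F.pot t x ≤ G) {φ : Path X 0 → ℝ} (hφ : BddMeasurable φ) :
    ∫ q, φ q ∂F.joint 0 = ∫ x, φ (fun _ => x) ∂F.init := by
  rw [F.integral_joint hG 0 hφ]
  simp_rw [F.integral_Qpath_self hφ]

lemma integral_joint_succ (hG : ∀ t x, F.pot t x ≤ G) {t : ℕ} {φ : Path X (t + 1) → ℝ}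
    (hφ : BddMeasurable φ) : ∫ q, φ q ∂F.joint (t + 1) = ∫ q, F.push φ q ∂F.joint t := by
  rw [F.integral_joint hG _ hφ, F.integral_joint hG _ (F.bddMeasurable_push hG hφ)]
  simp_rw [F.integral_Qpath_succ hG t.zero_le hφ]

lemma integral_marg (t : ℕ) {f : X → ℝ} (hf : BddMeasurable f) :
    ∫ x, f x ∂F.marg t = ∫ p, f (last p) ∂F.joint t := by
  rw [marg, integral_map measurable_last.aemeasurable hf.1.aestronglyMeasurable]

lemma integral_marg_zero (hG : ∀ t x, F.pot t x ≤ G) {f : X → ℝ} (hf : BddMeasurable f) :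
    ∫ x, f x ∂F.marg 0 = ∫ x, f x ∂F.init := by
  rw [integral_marg _ _ hf, F.integral_joint_zero hG (hf.comp measurable_last)]
  rfl

/-- The function `x ↦ g_t(x) ∫ f(y) M_{t+1}(x, dy)`. -/
noncomputable def pushFun (t : ℕ) (f : X → ℝ) (x : X) : ℝ :=
  F.pot t x * ∫ y, f y ∂F.trans (t + 1) x

lemma bddMeasurable_pushFun (hG : ∀ t x, F.pot t x ≤ G) (t : ℕ) {f : X → ℝ}
    (hf : BddMeasurable f) : BddMeasurable (F.pushFun t f) :=
  (F.bddMeasurable_pot hG t).mul (BddMeasurable.integral_kernel (κ := F.trans (t + 1))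
    (f := fun _ y => f y) (hf.comp measurable_snd))

lemma integral_marg_succ (hG : ∀ t x, F.pot t x ≤ G) (t : ℕ) {f : X → ℝ} (hf : BddMeasurable f) :
    ∫ x, f x ∂F.marg (t + 1) = ∫ x, F.pushFun t f x ∂F.marg t := by
  rw [integral_marg _ _ hf, F.integral_joint_succ hG (hf.comp measurable_last),
    integral_marg _ _ (F.bddMeasurable_pushFun hG t hf)]
  simp only [push, last_snoc, pushFun]

/-- The function `(x_{0:t}, x'_{0:t}) ↦ g_t(x_t) g_t(x'_t) ∫ h d M_{t+1}^{c}(x_t, x'_t; ·)`. -/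
noncomputable def pairPush (c : Bool) {t : ℕ} (h : Path X (t + 1) → Path X (t + 1) → ℝ)
    (p p' : Path X t) : ℝ :=
  F.pot t (last p) * F.pot t (last p') *
    bif c then ∫ y, h (snoc p y) (snoc p' y) ∂F.trans (t + 1) (last p)
    else ∫ y, ∫ y', h (snoc p y) (snoc p' y') ∂F.trans (t + 1) (last p') ∂F.trans (t + 1) (last p)

lemma bddMeasurable_unzip {t : ℕ} {h : Path X t → Path X t → ℝ}
    (hh : BddMeasurable (Function.uncurry h)) :
    BddMeasurable fun p : Path (X × X) t => h (fun i => (p i).1) (fun i => (p i).2) :=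
  hh.comp (φ := fun p : Path (X × X) t =>
    ((fun i => (p i).1 : Path X t), (fun i => (p i).2 : Path X t))) (by fun_prop)

lemma bddMeasurable_pairPush (hG : ∀ t x, F.pot t x ≤ G) (c : Bool) {t : ℕ}
    {h : Path X (t + 1) → Path X (t + 1) → ℝ} (hh : BddMeasurable (Function.uncurry h)) :
    BddMeasurable (Function.uncurry (F.pairPush c h)) := by
  refine BddMeasurable.mul (f := fun p : Path X t × Path X t => F.pot t (last p.1) * F.pot t (last p.2))
    (((F.bddMeasurable_pot hG t).comp (φ := fun p : Path X t × Path X t => last p.1)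
      (measurable_last.comp measurable_fst)).mul
    ((F.bddMeasurable_pot hG t).comp (φ := fun p : Path X t × Path X t => last p.2)
      (measurable_last.comp measurable_snd))) ?_
  cases c
  · refine BddMeasurable.integral_kernel
      (κ := (F.trans (t + 1)).comap (fun p : Path X t × Path X t => last p.1)
        (measurable_last.comp measurable_fst))
      (f := fun p y => ∫ y', h (snoc p.1 y) (snoc p.2 y') ∂F.trans (t + 1) (last p.2)) ?_
    refine BddMeasurable.integral_kernel
      (κ := (F.trans (t + 1)).comap (fun p : (Path X t × Path X t) × X => last p.1.2)
        (measurable_last.comp (measurable_snd.comp measurable_fst)))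
      (f := fun p y' => h (snoc p.1.1 p.2) (snoc p.1.2 y')) ?_
    refine hh.comp (φ := fun p : ((Path X t × Path X t) × X) × X =>
      (snoc p.1.1.1 p.1.2, snoc p.1.1.2 p.2)) ?_
    exact (measurable_snoc.comp (f := fun p : ((Path X t × Path X t) × X) × X =>
        (p.1.1.1, p.1.2)) (by fun_prop)).prodMk
      (measurable_snoc.comp (f := fun p : ((Path X t × Path X t) × X) × X =>
        (p.1.1.2, p.2)) (by fun_prop))
  · refine BddMeasurable.integral_kernel
      (κ := (F.trans (t + 1)).comap (fun p : Path X t × Path X t => last p.1)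
        (measurable_last.comp measurable_fst))
      (f := fun p y => h (snoc p.1 y) (snoc p.2 y)) ?_
    refine hh.comp (φ := fun p : (Path X t × Path X t) × X =>
      (snoc p.1.1 p.2, snoc p.1.2 p.2)) ?_
    exact (measurable_snoc.comp (f := fun p : (Path X t × Path X t) × X =>
        (p.1.1, p.2)) (by fun_prop)).prodMk
      (measurable_snoc.comp (f := fun p : (Path X t × Path X t) × X =>
        (p.1.2, p.2)) (by fun_prop))

lemma pot_pair_le (hG : ∀ t x, F.pot t x ≤ G) (b : ℕ → Bool) (t : ℕ) (x : X × X) :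
    (F.pair b).pot t x ≤ G * G :=
  mul_le_mul (hG _ _) (hG _ _) (F.pot_nonneg _ _) ((F.pot_nonneg t x.1).trans (hG _ _))

lemma muInt_zero (hG : ∀ t x, F.pot t x ≤ G) (b : ℕ → Bool) {h : Path X 0 → Path X 0 → ℝ}
    (hh : BddMeasurable (Function.uncurry h)) :
    F.muInt b 0 h = bif b 0 then ∫ x, h (fun _ => x) (fun _ => x) ∂F.init
      else ∫ x, ∫ x', h (fun _ => x) (fun _ => x') ∂F.init ∂F.init := by
  have hm : BddMeasurable fun x : X × X => h (fun _ => x.1) (fun _ => x.2) :=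
    hh.comp (φ := fun x : X × X => ((fun _ => x.1 : Path X 0), (fun _ => x.2 : Path X 0)))
      (by fun_prop)
  rw [muInt, mu, integral_joint_zero _ (F.pot_pair_le hG b) (bddMeasurable_unzip hh)]
  simp only [pair, pairInit]
  cases b 0
  · exact integral_prod _ (hm.integrable _)
  · exact integral_map (by fun_prop) hm.1.aestronglyMeasurable

/-- The bivariate model is itself a Feynman-Kac model, on `X × X`, so the univariate recursion
applies and only the pair kernel has to be unfolded for each value of the flag. The particle
estimators will be shown to satisfy the same recursion in conditional mean. -/
lemma muInt_succ (hG : ∀ t x, F.pot t x ≤ G) (b : ℕ → Bool) {t : ℕ}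
    {h : Path X (t + 1) → Path X (t + 1) → ℝ} (hh : BddMeasurable (Function.uncurry h)) :
    F.muInt b (t + 1) h = F.muInt b t (F.pairPush (b (t + 1)) h) := by
  rw [muInt, mu, integral_joint_succ _ (F.pot_pair_le hG b) (bddMeasurable_unzip hh)]
  refine integral_congr_ae (ae_of_all _ fun p => ?_)
  simp only [push, pairPush]
  congr 1
  have h1 : ∀ y : X × X, h (fun i => (snoc p y i).1) (fun i => (snoc p y i).2) =
      h (snoc (fun i => (p i).1) y.1) (snoc (fun i => (p i).2) y.2) := by
    intro y
    congr 1 <;> · funext i; simp only [snoc, point]; split_ifs <;> rfl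
  simp_rw [h1]
  have hm : BddMeasurable fun y : X × X =>
      h (snoc (fun i => (p i).1) y.1) (snoc (fun i => (p i).2) y.2) :=
    hh.comp (φ := fun y : X × X => (snoc (fun i => (p i).1) y.1, snoc (fun i => (p i).2) y.2))
      ((measurable_snoc.comp (f := fun y : X × X => ((fun i => (p i).1 : Path X t), y.1))
        (by fun_prop)).prodMk
      (measurable_snoc.comp (f := fun y : X × X => ((fun i => (p i).2 : Path X t), y.2))
        (by fun_prop)))
  simp only [pair, pairTrans]
  cases b (t + 1)
  · simp only [cond_false]
    rw [Kernel.parallelComp_apply]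
    exact integral_prod _ (hm.integrable _)
  · simp only [cond_true]
    rw [integral_kernel_map _ (by fun_prop) hm, Kernel.comap_apply]
    rfl

end FeynmanKac

end FFBS

/-! ### Weights, masses and the reversal identity under the standing assumptions -/

namespace FFBS

namespace FeynmanKac

variable {X : Type*} [MeasurableSpace X]

/-- The assumptions (A1)-(A4), with the bound `G` for the potentials and `σ` for the densities. -/
structure IsDominated (F : FeynmanKac X) (ν : Measure X) (m : ℕ → X → X → ℝ) (G σ : ℝ) :
    Prop where
  G_nonneg : 0 ≤ G
  pot_pos : ∀ t x, 0 < F.pot t x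
  pot_le : ∀ t x, F.pot t x ≤ G
  trans_eq : ∀ t x, F.trans (t + 1) x = ν.withDensity fun y => ENNReal.ofReal (m (t + 1) x y)
  measurable_dens : ∀ t, Measurable (Function.uncurry (m (t + 1)))
  dens_pos : ∀ t x y, 0 < m (t + 1) x y
  dens_le : ∀ t x y, m (t + 1) x y ≤ σ

variable {F : FeynmanKac X} {ν : Measure X} {m : ℕ → X → X → ℝ} {G σ : ℝ}

section Deterministic

variable {N : ℕ}

lemma massN_zero (z : Cloud X N) : F.massN z 0 = 1 := by simp [massN]

lemma massN_succ (z : Cloud X N) (r : ℕ) :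
    F.massN z (r + 1) = F.massN z r * ((N : ℝ)⁻¹ * F.totalWeight z r) :=
  Finset.prod_range_succ _ _

lemma massN_nonneg (z : Cloud X N) (r : ℕ) : 0 ≤ F.massN z r :=
  Finset.prod_nonneg fun _ _ => mul_nonneg (by positivity) (F.totalWeight_nonneg z _)

lemma massN_congr {z z' : Cloud X N} {r : ℕ} (h : ∀ u < r, z u = z' u) :
    F.massN z r = F.massN z' r :=
  Finset.prod_congr rfl fun s hs => by
    simp only [totalWeight, h s (Finset.mem_range.1 hs)]

namespace IsDominated

variable (h : F.IsDominated ν m G σ)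

include h

lemma mean_totalWeight_le (z : Cloud X N) (r : ℕ) : (N : ℝ)⁻¹ * F.totalWeight z r ≤ G := by
  rcases Nat.eq_zero_or_pos N with rfl | hN
  · simpa using h.G_nonneg
  rw [inv_mul_le_iff₀ (by positivity)]
  calc F.totalWeight z r ≤ ∑ _i : Fin N, G := Finset.sum_le_sum fun i _ => h.pot_le _ _
    _ = N * G := by simp

lemma massN_le (z : Cloud X N) (r : ℕ) : F.massN z r ≤ G ^ r := by
  calc F.massN z r ≤ ∏ _s ∈ Finset.range r, G := Finset.prod_le_prod
        (fun _ _ => mul_nonneg (by positivity) (F.totalWeight_nonneg z _))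
        fun s _ => h.mean_totalWeight_le z s
    _ = G ^ r := by simp

lemma bddMeasurable_massN (r : ℕ) : BddMeasurable fun z : Cloud X N => F.massN z r :=
  ⟨Finset.measurable_prod _ fun s _ => measurable_const.mul (F.measurable_totalWeight s), G ^ r,
    fun z => by rw [abs_of_nonneg (massN_nonneg z r)]; exact h.massN_le z r⟩

lemma massN_pos [NeZero N] (z : Cloud X N) (r : ℕ) : 0 < F.massN z r :=
  Finset.prod_pos fun s _ => mul_pos (by have := NeZero.pos N; positivity)
    (F.totalWeight_pos h.pot_pos z s)

lemma beta_denom_pos [NeZero N] (z : Cloud X N) (r : ℕ) (x : X) :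
    0 < ∑ j, F.pot r (z r j) * m (r + 1) (z r j) x :=
  Finset.sum_pos (fun _ _ => mul_pos (h.pot_pos _ _) (h.dens_pos _ _ _)) Finset.univ_nonempty

lemma beta_nonneg (z : Cloud X N) (r : ℕ) (x : X) (i : Fin N) : 0 ≤ F.beta m z r x i :=
  div_nonneg (mul_nonneg (F.pot_nonneg _ _) (h.dens_pos _ _ _).le)
    (Finset.sum_nonneg fun _ _ => mul_nonneg (F.pot_nonneg _ _) (h.dens_pos _ _ _).le)

lemma sum_beta [NeZero N] (z : Cloud X N) (r : ℕ) (x : X) : ∑ i, F.beta m z r x i = 1 := by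
  unfold beta
  rw [← Finset.sum_div]
  exact div_self (h.beta_denom_pos z r x).ne'

lemma beta_le_one [NeZero N] (z : Cloud X N) (r : ℕ) (x : X) (i : Fin N) :
    F.beta m z r x i ≤ 1 := by
  rw [← h.sum_beta z r x]
  exact Finset.single_le_sum (fun j _ => h.beta_nonneg z r x j) (Finset.mem_univ i)

lemma weight_le_one [NeZero N] (z : Cloud X N) (r : ℕ) (i : Fin N) : F.weight z r i ≤ 1 := by
  rw [← F.sum_weight h.pot_pos z r]
  exact Finset.single_le_sum (fun j _ => F.weight_nonneg z r j) (Finset.mem_univ i)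

lemma bddMeasurable_weight [NeZero N] (r : ℕ) (i : Fin N) :
    BddMeasurable fun z : Cloud X N => F.weight z r i :=
  ⟨F.measurable_weight r i, 1, fun z => by
    rw [abs_of_nonneg (F.weight_nonneg z r i)]; exact h.weight_le_one z r i⟩

lemma bddMeasurable_dens (r : ℕ) : BddMeasurable (Function.uncurry (m (r + 1))) :=
  ⟨h.measurable_dens r, σ, fun p => by
    rw [Function.uncurry, abs_of_nonneg (h.dens_pos r p.1 p.2).le]; exact h.dens_le r p.1 p.2⟩

lemma measurable_dens_right (r : ℕ) (x : X) : Measurable fun y => m (r + 1) x y :=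
  (h.measurable_dens r).comp measurable_prodMk_left

lemma measurable_pot_mul_dens (r : ℕ) (i : Fin N) :
    Measurable fun p : Cloud X N × X => F.pot r (p.1 r i) * m (r + 1) (p.1 r i) p.2 := by
  have h1 : Measurable fun p : Cloud X N × X => p.1 r i :=
    (measurable_pi_apply i).comp ((measurable_pi_apply r).comp measurable_fst)
  exact ((F.pot_measurable r).comp h1).mul ((h.measurable_dens r).comp (h1.prodMk measurable_snd))

lemma bddMeasurable_beta [NeZero N] (r : ℕ) (i : Fin N) :
    BddMeasurable fun p : Cloud X N × X => F.beta m p.1 r p.2 i :=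
  ⟨(h.measurable_pot_mul_dens r i).div
    (Finset.measurable_sum _ fun j _ => h.measurable_pot_mul_dens r j), 1, fun p => by
    rw [abs_of_nonneg (h.beta_nonneg _ r _ i)]; exact h.beta_le_one _ r _ i⟩

omit h in
lemma beta_congr {z z' : Cloud X N} {r : ℕ} (hz : z r = z' r) (x : X) (i : Fin N) :
    F.beta m z r x i = F.beta m z' r x i := by
  simp only [beta, hz]

/-- The density of `mix`. -/
lemma mix_eq_withDensity (z : Cloud X N) (r : ℕ) :
    F.mix z r = ν.withDensity fun y =>
      ENNReal.ofReal (∑ i, F.weight z r i * m (r + 1) (z r i) y) := by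
  have hm (i : Fin N) := h.measurable_dens_right r (z r i)
  have h1 : (fun y => ENNReal.ofReal (∑ i, F.weight z r i * m (r + 1) (z r i) y)) =
      fun y => ∑ i, ENNReal.ofReal (F.weight z r i * m (r + 1) (z r i) y) := by
    funext y
    exact ENNReal.ofReal_sum_of_nonneg fun i _ =>
      mul_nonneg (F.weight_nonneg _ _ _) (h.dens_pos _ _ _).le
  refine Measure.ext fun s hs => ?_
  rw [mix, withDensity_apply _ hs, h1, lintegral_finsetSum _ fun i _ =>
    Measurable.ennreal_ofReal ((hm i).const_mul _), Measure.coe_finsetSum, Finset.sum_apply]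
  refine Finset.sum_congr rfl fun i _ => ?_
  rw [Measure.smul_apply, h.trans_eq, withDensity_apply _ hs, smul_eq_mul,
    ← lintegral_const_mul _ (hm i).ennreal_ofReal]
  simp_rw [ENNReal.ofReal_mul (F.weight_nonneg z r i)]

lemma integral_trans (r : ℕ) (x : X) (f : X → ℝ) :
    ∫ y, f y ∂F.trans (r + 1) x = ∫ y, m (r + 1) x y * f y ∂ν := by
  rw [h.trans_eq, integral_withDensity_eq_integral_toReal_smul
    (h.measurable_dens_right r x).ennreal_ofReal
    (ae_of_all _ fun _ => ENNReal.ofReal_lt_top)]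
  simp_rw [ENNReal.toReal_ofReal (h.dens_pos r x _).le, smul_eq_mul]

lemma integral_mix_eq (z : Cloud X N) (r : ℕ) (f : X → ℝ) :
    ∫ y, f y ∂F.mix z r = ∫ y, (∑ i, F.weight z r i * m (r + 1) (z r i) y) * f y ∂ν := by
  rw [h.mix_eq_withDensity, integral_withDensity_eq_integral_toReal_smul
    (Measurable.ennreal_ofReal (Finset.measurable_sum _ fun i _ =>
      (h.measurable_dens_right r (z r i)).const_mul _))
    (ae_of_all _ fun _ => ENNReal.ofReal_lt_top)]
  simp_rw [ENNReal.toReal_ofReal (Finset.sum_nonneg fun i (_ : i ∈ Finset.univ) =>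
    mul_nonneg (F.weight_nonneg z r i) (h.dens_pos r (z r i) _).le), smul_eq_mul]

/-- Bayes' formula: `beta` is the posterior law of the parent given the child `y` when parents have
prior `weight`, and the sum is the marginal density of the child. -/
lemma sum_weight_mul_dens_mul_beta [NeZero N] (z : Cloud X N) (r : ℕ) (y : X) (i : Fin N) :
    (∑ j, F.weight z r j * m (r + 1) (z r j) y) * F.beta m z r y i =
      F.weight z r i * m (r + 1) (z r i) y := by
  have h1 := h.beta_denom_pos z r y
  have h2 := F.totalWeight_pos h.pot_pos z r
  have h3 : ∑ j, F.weight z r j * m (r + 1) (z r j) y =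
      (∑ j, F.pot r (z r j) * m (r + 1) (z r j) y) / F.totalWeight z r := by
    rw [Finset.sum_div]
    exact Finset.sum_congr rfl fun j _ => by unfold weight; ring
  rw [h3, beta, weight]
  field_simp

/-- The backward weights reverse the forward move. -/
lemma integral_beta_mul [NeZero N] (z : Cloud X N) (r : ℕ) (i : Fin N) (f : X → ℝ) :
    ∫ y, F.beta m z r y i * f y ∂F.mix z r =
      F.weight z r i * ∫ y, f y ∂F.trans (r + 1) (z r i) := by
  rw [h.integral_mix_eq, h.integral_trans, ← integral_const_mul]
  refine integral_congr_ae (ae_of_all _ fun y => ?_)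
  simp only
  rw [← mul_assoc, h.sum_weight_mul_dens_mul_beta, mul_assoc]

end IsDominated

end Deterministic

/-! ### L² law of large numbers for the unnormalized marginals -/

section LawOfLargeNumbers

/-- The particle estimate `γ_r^N(f)`. -/
noncomputable def margN (F : FeynmanKac X) {N : ℕ} (z : Cloud X N) (r : ℕ) (f : X → ℝ) : ℝ :=
  F.massN z r * ((N : ℝ)⁻¹ * ∑ i, f (z r i))

lemma _root_.FFBS.BddMeasurable.eval_cloud {N : ℕ} {f : X → ℝ} (hf : BddMeasurable f) (r : ℕ)
    (i : Fin N) : BddMeasurable fun z : Cloud X N => f (z r i) :=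
  hf.comp ((measurable_pi_apply i).comp (measurable_pi_apply r))

namespace IsDominated

variable (h : F.IsDominated ν m G σ)

include h

lemma bddMeasurable_margN {N : ℕ} {f : X → ℝ} (hf : BddMeasurable f) (r : ℕ) :
    BddMeasurable fun z : Cloud X N => F.margN z r f :=
  (h.bddMeasurable_massN r).mul ((BddMeasurable.const _).mul
    (BddMeasurable.sum _ fun i _ => hf.eval_cloud r i))

/-- The extra factor of the mass at time `r + 1` cancels the normalization of the weights, so the
conditional mean of the next estimate is linear in the current particles. -/
lemma margN_pushFun {N : ℕ} [NeZero N] (z : Cloud X N) (r : ℕ) {f : X → ℝ}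
    (hf : BddMeasurable f) :
    F.massN z (r + 1) * ∫ x, f x ∂F.mix z r = F.margN z r (F.pushFun r f) := by
  have hW := (F.totalWeight_pos h.pot_pos z r).ne'
  rw [F.integral_mix z r f fun i => hf.integrable _, massN_succ, margN, Finset.mul_sum,
    Finset.mul_sum, Finset.mul_sum]
  refine Finset.sum_congr rfl fun i _ => ?_
  simp only [weight, pushFun]
  field_simp

end IsDominated

lemma IsParticleLaw.integral_zero {N : ℕ} {L : Measure (Cloud X N)} (hL : F.IsParticleLaw L)
    {f : (Fin N → X) → ℝ} (hf : BddMeasurable f) :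
    ∫ z, f (z 0) ∂L = ∫ y, f y ∂Measure.pi fun _ : Fin N => F.init := by
  rw [← hL.init, integral_map (measurable_pi_apply 0).aemeasurable hf.1.aestronglyMeasurable]

namespace IsDominated

variable (h : F.IsDominated ν m G σ)

include h

lemma step_margN {N : ℕ} [NeZero N] {L : Measure (Cloud X N)} (hL : F.IsParticleLaw L)
    (r : ℕ) {f : X → ℝ} (hf : BddMeasurable f) :
    ∫ z, F.margN z (r + 1) f ∂L = ∫ z, F.margN z r (F.pushFun r f) ∂L := by
  have hpr (z : Cloud X N) := F.isProbabilityMeasure_mix h.pot_pos z r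
  have h1 := hL.step r (fun z y => F.massN z (r + 1) * ((N : ℝ)⁻¹ * ∑ i, f (y i)))
    (((h.bddMeasurable_massN (r + 1)).comp measurable_fst).mul ((BddMeasurable.const _).mul
      (BddMeasurable.sum _ fun i _ => hf.comp ((measurable_pi_apply i).comp measurable_snd))))
    -- The mass at time `r + 1` is a product over times at most `r`, so it is known before the new
    -- particles are drawn.
    (fun z z' y hz => by rw [massN_congr fun u hu => hz u (Nat.lt_succ_iff.1 hu)])
  refine h1.trans (integral_congr_ae (ae_of_all _ fun z => ?_))
  have hN : (N : ℝ) ≠ 0 := NeZero.ne _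
  simp only
  rw [integral_const_mul, integral_const_mul, integral_sum_eval_pi _ hf,
    ← h.margN_pushFun z r hf, inv_mul_cancel_left₀ hN]

/-- The particle estimates of the unnormalized marginals are unbiased. -/
lemma integral_margN {N : ℕ} [NeZero N] {L : Measure (Cloud X N)} (hL : F.IsParticleLaw L)
    (r : ℕ) {f : X → ℝ} (hf : BddMeasurable f) :
    ∫ z, F.margN z r f ∂L = ∫ x, f x ∂F.marg r := by
  induction r generalizing f with
  | zero =>
    have hN : (N : ℝ) ≠ 0 := NeZero.ne _
    simp only [margN, massN_zero, one_mul]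
    rw [integral_const_mul, hL.integral_zero (f := fun y => ∑ i, f (y i))
      (BddMeasurable.sum _ fun i _ => hf.comp (measurable_pi_apply i)),
      integral_sum_eval_pi _ hf, F.integral_marg_zero h.pot_le hf, inv_mul_cancel_left₀ hN]
  | succ r ih =>
    rw [h.step_margN hL r hf, ih (F.bddMeasurable_pushFun h.pot_le r hf),
      F.integral_marg_succ h.pot_le r hf]

/-- The particle estimates of the unnormalized marginals converge in `L²`. -/
lemma exists_integral_margN_sub_sq_le (r : ℕ) {f : X → ℝ} (hf : BddMeasurable f) :
    ∃ C : ℝ, ∀ (N : ℕ) [NeZero N] (L : Measure (Cloud X N)), F.IsParticleLaw L →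
      ∫ z, (F.margN z r f - ∫ x, f x ∂F.marg r) ^ 2 ∂L ≤ C / N := by
  induction r generalizing f with
  | zero =>
    refine ⟨∫ x, f x ^ 2 ∂F.init, fun N _ L hL => ?_⟩
    have hN : (N : ℝ) ≠ 0 := NeZero.ne _
    have hN' : (0 : ℝ) < N := by have := NeZero.pos N; positivity
    have hp := hL.prob
    rw [F.integral_marg_zero h.pot_le hf]
    simp only [margN, massN_zero, one_mul]
    have hsum : BddMeasurable fun y : Fin N → X => ∑ i, f (y i) :=
      BddMeasurable.sum _ fun i _ => hf.comp (measurable_pi_apply i)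
    rw [hL.integral_zero (f := fun y => ((N : ℝ)⁻¹ * ∑ i, f (y i) - ∫ x, f x ∂F.init) ^ 2)
      ((((BddMeasurable.const _).mul hsum).sub (BddMeasurable.const _)).pow 2)]
    have e (y : Fin N → X) : ((N : ℝ)⁻¹ * ∑ i, f (y i) - ∫ x, f x ∂F.init) ^ 2 =
        ((N : ℝ)⁻¹) ^ 2 * (∑ i, f (y i) - N * ∫ x, f x ∂F.init) ^ 2 := by
      field_simp
    simp_rw [e]
    rw [integral_const_mul]
    refine (mul_le_mul_of_nonneg_left (integral_sum_eval_pi_sub_sq_le _ hf) (by positivity)).trans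
      (le_of_eq ?_)
    field_simp
  | succ r ih =>
    obtain ⟨C, hC⟩ := ih (F.bddMeasurable_pushFun h.pot_le r hf)
    obtain ⟨K, hK⟩ := hf.2
    -- The first term bounds the sampling noise of the new generation, the second is the error
    -- inherited from time `r` on `pushFun`. The factors 2 come from (a + b)² ≤ 2a² + 2b².
    refine ⟨2 * ((G ^ (r + 1)) ^ 2 * K ^ 2) + 2 * C, fun N _ L hL => ?_⟩
    have hN : (N : ℝ) ≠ 0 := NeZero.ne _
    have hN' : (0 : ℝ) < N := by have := NeZero.pos N; positivity
    have hp := hL.prob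
    have hpr (z : Cloud X N) := F.isProbabilityMeasure_mix h.pot_pos z r
    have hpush := F.bddMeasurable_pushFun h.pot_le r hf
    rw [F.integral_marg_succ h.pot_le r hf]
    set θ := ∫ x, F.pushFun r f x ∂F.marg r
    have b1 : BddMeasurable fun z : Cloud X N => (F.margN z (r + 1) f - F.margN z r (F.pushFun r f)) ^ 2 :=
      ((h.bddMeasurable_margN hf (r + 1)).sub (h.bddMeasurable_margN hpush r)).pow 2
    have b2 : BddMeasurable fun z : Cloud X N => (F.margN z r (F.pushFun r f) - θ) ^ 2 :=
      ((h.bddMeasurable_margN hpush r).sub (BddMeasurable.const _)).pow 2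
    have b3 : BddMeasurable fun z : Cloud X N => (F.margN z (r + 1) f - θ) ^ 2 :=
      ((h.bddMeasurable_margN hf (r + 1)).sub (BddMeasurable.const _)).pow 2
    have key : ∫ z, (F.margN z (r + 1) f - F.margN z r (F.pushFun r f)) ^ 2 ∂L ≤
        ((G ^ (r + 1)) ^ 2 * K ^ 2) / N := by
      have hsum : BddMeasurable fun p : Cloud X N × (Fin N → X) => ∑ i, f (p.2 i) :=
        BddMeasurable.sum _ fun i _ => hf.comp ((measurable_pi_apply i).comp measurable_snd)
      have h1 := hL.step r (fun z y => (F.massN z (r + 1) * ((N : ℝ)⁻¹ * ∑ i, f (y i)) -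
          F.margN z r (F.pushFun r f)) ^ 2)
        (((((h.bddMeasurable_massN (r + 1)).comp measurable_fst).mul ((BddMeasurable.const _).mul
          hsum)).sub ((h.bddMeasurable_margN hpush r).comp measurable_fst)).pow 2)
        (fun z z' y hz => by
          rw [massN_congr fun u hu => hz u (Nat.lt_succ_iff.1 hu), margN, margN,
            massN_congr fun u hu => hz u hu.le, hz r le_rfl])
      refine h1.trans_le ?_
      have hbound (z : Cloud X N) : ∫ y : Fin N → X, (F.massN z (r + 1) * ((N : ℝ)⁻¹ * ∑ i, f (y i)) -
          F.margN z r (F.pushFun r f)) ^ 2 ∂Measure.pi (fun _ => F.mix z r) ≤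
          ((G ^ (r + 1)) ^ 2 * K ^ 2) / N := by
        have e (y : Fin N → X) : (F.massN z (r + 1) * ((N : ℝ)⁻¹ * ∑ i, f (y i)) -
          F.margN z r (F.pushFun r f)) ^ 2 = (F.massN z (r + 1) * (N : ℝ)⁻¹) ^ 2 *
            (∑ i, f (y i) - N * ∫ x, f x ∂F.mix z r) ^ 2 := by
          rw [← h.margN_pushFun z r hf]; field_simp
        simp_rw [e]
        rw [integral_const_mul]
        have h2 : ∫ x, f x ^ 2 ∂F.mix z r ≤ K ^ 2 := by
          calc ∫ x, f x ^ 2 ∂F.mix z r ≤ ∫ _x, K ^ 2 ∂F.mix z r :=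
                integral_mono ((hf.pow 2).integrable _) (integrable_const _) fun x => by
                  have := hK x
                  simp only
                  rw [← sq_abs]
                  gcongr
            _ = K ^ 2 := by simp
        have h3 := (integral_sum_eval_pi_sub_sq_le (N := N) (F.mix z r) hf).trans
          (mul_le_mul_of_nonneg_left h2 hN'.le)
        calc _ ≤ (G ^ (r + 1) * (N : ℝ)⁻¹) ^ 2 * (N * K ^ 2) := by
              gcongr
              · exact mul_nonneg (massN_nonneg z _) (by positivity)
              · exact h.massN_le z (r + 1)
          _ = _ := by field_simp
      have hint : Integrable (fun z : Cloud X N => ∫ y : Fin N → X, (F.massN z (r + 1) * ((N : ℝ)⁻¹ * ∑ i, f (y i)) -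
          F.margN z r (F.pushFun r f)) ^ 2 ∂Measure.pi (fun _ : Fin N => F.mix z r)) L := by
        refine (BddMeasurable.integral_kernel (κ := F.moveKer h.pot_pos r)
          (f := fun z y => (F.massN z (r + 1) * ((N : ℝ)⁻¹ * ∑ i, f (y i)) -
          F.margN z r (F.pushFun r f)) ^ 2) ?_).integrable L
        exact (((((h.bddMeasurable_massN (r + 1)).comp measurable_fst).mul
          ((BddMeasurable.const _).mul hsum)).sub
            ((h.bddMeasurable_margN hpush r).comp measurable_fst)).pow 2)
      calc _ ≤ ∫ _z, ((G ^ (r + 1)) ^ 2 * K ^ 2) / N ∂L :=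
            integral_mono hint (integrable_const _) hbound
        _ = _ := by simp
    calc ∫ z, (F.margN z (r + 1) f - θ) ^ 2 ∂L
        ≤ ∫ z, (2 * (F.margN z (r + 1) f - F.margN z r (F.pushFun r f)) ^ 2 +
            2 * (F.margN z r (F.pushFun r f) - θ) ^ 2) ∂L := by
          refine integral_mono (b3.integrable _) ((((BddMeasurable.const 2).mul b1).add
            ((BddMeasurable.const 2).mul b2)).integrable _) fun z => ?_
          simp only
          nlinarith [sq_nonneg ((F.margN z (r + 1) f - F.margN z r (F.pushFun r f)) -
            (F.margN z r (F.pushFun r f) - θ))]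
      _ ≤ 2 * (((G ^ (r + 1)) ^ 2 * K ^ 2) / N) + 2 * (C / N) := by
          rw [integral_add (((BddMeasurable.const 2).mul b1).integrable _)
            (((BddMeasurable.const 2).mul b2).integrable _), integral_const_mul,
            integral_const_mul]
          have := hC N L hL
          gcongr
      _ = _ := by ring

end IsDominated

end LawOfLargeNumbers

end FeynmanKac

end FFBS

/-! ### The estimator μ^BS as a recursion on its terminal indices -/

namespace FFBS

namespace FeynmanKac

variable {X : Type*} [MeasurableSpace X] (F : FeynmanKac X) (m : ℕ → X → X → ℝ) {N : ℕ}

/-- The factor `N^{c} (N / (N - 1))^{1 - c}`. -/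
noncomputable def coalFactor (N : ℕ) (c : Bool) : ℝ := if c then (N : ℝ) else (N : ℝ) / ((N : ℝ) - 1)

lemma coalFactor_nonneg (hN : 2 ≤ N) (c : Bool) : 0 ≤ coalFactor N c := by
  have : (2 : ℝ) ≤ N := by exact_mod_cast hN
  unfold coalFactor
  split_ifs
  · positivity
  · exact div_nonneg (by positivity) (by linarith)

/-- The contribution to `μ^BS_{b,t}(h)` of the paths of indices that end at `k` and `l`. -/
noncomputable def pairSum (b : ℕ → Bool) (z : Cloud X N) :
    (t : ℕ) → Fin N → Fin N → (Path X t → Path X t → ℝ) → ℝ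
  | 0, k, l, h => coalFactor N (b 0) * (if (k = l ↔ b 0 = true) then 1 else 0) * (N : ℝ)⁻¹ ^ 2 *
      h (fun _ => z 0 k) (fun _ => z 0 l)
  | t + 1, k, l, h => coalFactor N (b (t + 1)) * (if (k = l ↔ b (t + 1) = true) then 1 else 0) *
      ((N : ℝ)⁻¹ * F.totalWeight z t) ^ 2 *
      ∑ i, ∑ j, F.beta m z t (z (t + 1) k) i *
        (if l = k then F.weight z t j else F.beta m z t (z (t + 1) l) j) *
        pairSum b z t i j fun p q => h (snoc p (z (t + 1) k)) (snoc q (z (t + 1) l))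

section Algebra

variable {F m} {b : ℕ → Bool} {z z' : Cloud X N}

lemma pairSum_const_mul (t : ℕ) (k l : Fin N) (a : ℝ) (h : Path X t → Path X t → ℝ) :
    F.pairSum m b z t k l (fun p q => a * h p q) = a * F.pairSum m b z t k l h := by
  induction t generalizing k l with
  | zero => simp only [pairSum]; ring
  | succ t ih =>
    simp only [pairSum, Finset.mul_sum]
    refine Finset.sum_congr rfl fun i _ => Finset.sum_congr rfl fun j _ => ?_
    rw [ih i j fun p q => h (snoc p (z (t + 1) k)) (snoc q (z (t + 1) l))]
    ring

lemma pairSum_add (t : ℕ) (k l : Fin N) (h h' : Path X t → Path X t → ℝ) :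
    F.pairSum m b z t k l (fun p q => h p q + h' p q) =
      F.pairSum m b z t k l h + F.pairSum m b z t k l h' := by
  induction t generalizing k l with
  | zero => simp only [pairSum]; ring
  | succ t ih =>
    simp only [pairSum, Finset.mul_sum, ← Finset.sum_add_distrib]
    refine Finset.sum_congr rfl fun i _ => Finset.sum_congr rfl fun j _ => ?_
    rw [ih i j (fun p q => h (snoc p (z (t + 1) k)) (snoc q (z (t + 1) l)))
      (fun p q => h' (snoc p (z (t + 1) k)) (snoc q (z (t + 1) l)))]
    ring

/-- All paths entering the sum end at the particles `k` and `l`. This lets `pairPush`, whose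
transitions start from the last points of its arguments, be compared with transitions from given
particles. -/
lemma pairSum_congr_last (t : ℕ) (k l : Fin N) {h h' : Path X t → Path X t → ℝ}
    (hh : ∀ p q, last p = z t k → last q = z t l → h p q = h' p q) :
    F.pairSum m b z t k l h = F.pairSum m b z t k l h' := by
  cases t with
  | zero => simp only [pairSum]; rw [hh _ _ rfl rfl]
  | succ t =>
    simp only [pairSum]
    congr 1
    refine Finset.sum_congr rfl fun i _ => Finset.sum_congr rfl fun j _ => ?_
    congr 2
    funext p q
    exact hh _ _ (last_snoc _ _) (last_snoc _ _)

lemma pairSum_congr_cloud (t : ℕ) (k l : Fin N) (h : Path X t → Path X t → ℝ)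
    (hz : ∀ u ≤ t, z u = z' u) : F.pairSum m b z t k l h = F.pairSum m b z' t k l h := by
  induction t generalizing k l with
  | zero => simp only [pairSum, hz 0 le_rfl]
  | succ t ih =>
    have h1 := hz t (Nat.le_succ t)
    simp only [pairSum, hz (t + 1) le_rfl, totalWeight, weight, beta, h1,
      ih _ _ _ fun u hu => hz u (hu.trans (Nat.le_succ t))]

/-- The two lineages are treated differently only when their indices coincide, and then the exchange
is trivial. For distinct indices both carry `beta` and the symmetry passes through the induction. -/
lemma pairSum_one_symm (t : ℕ) (k l : Fin N) :
    F.pairSum m b z t k l (fun _ _ => 1) = F.pairSum m b z t l k fun _ _ => 1 := by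
  induction t generalizing k l with
  | zero => simp only [pairSum, eq_comm (a := k)]
  | succ t ih =>
    rcases eq_or_ne k l with rfl | hkl
    · rfl
    simp only [pairSum, hkl, hkl.symm, if_false]
    congr 1
    rw [Finset.sum_comm]
    refine Finset.sum_congr rfl fun i _ => Finset.sum_congr rfl fun j _ => ?_
    rw [ih]; ring

/-- For a fixed cloud `pairSum` is a finite linear combination of values of its test function, so it
commutes with integration in a parameter. -/
lemma integrable_and_integral_pairSum {Θ : Type*} [MeasurableSpace Θ] (μ : Measure Θ) (t : ℕ)
    (k l : Fin N) (h : Θ → Path X t → Path X t → ℝ) (hh : ∀ p q, Integrable (fun θ => h θ p q) μ) :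
    Integrable (fun θ => F.pairSum m b z t k l (h θ)) μ ∧
      ∫ θ, F.pairSum m b z t k l (h θ) ∂μ =
        F.pairSum m b z t k l fun p q => ∫ θ, h θ p q ∂μ := by
  induction t generalizing k l with
  | zero =>
    simp only [pairSum]
    exact ⟨(hh _ _).const_mul _, integral_const_mul _ _⟩
  | succ t ih =>
    have h1 (i j : Fin N) := ih i j
      (fun θ p q => h θ (snoc p (z (t + 1) k)) (snoc q (z (t + 1) l))) fun p q => hh _ _
    simp only [pairSum]
    refine ⟨(integrable_finsetSum _ fun i _ => integrable_finsetSum _ fun j _ =>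
      (h1 i j).1.const_mul _).const_mul _, ?_⟩
    rw [integral_const_mul, integral_finsetSum _ fun i _ => integrable_finsetSum _ fun j _ =>
      (h1 i j).1.const_mul _]
    congr 1
    refine Finset.sum_congr rfl fun i _ => ?_
    rw [integral_finsetSum _ fun j _ => (h1 i j).1.const_mul _]
    refine Finset.sum_congr rfl fun j _ => ?_
    rw [integral_const_mul, (h1 i j).2]

omit [MeasurableSpace X] in
lemma cloudPath_snoc {t : ℕ} (k : Fin (t + 1) → Fin N) (a : Fin N) :
    (cloudPath z (Fin.snoc (α := fun _ => Fin N) k a) : Path X (t + 1)) =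
      snoc (cloudPath z k) (z (t + 1) a) := by
  funext i
  have hi := Finset.mem_Iic.1 i.2
  by_cases h : (i : ℕ) ≤ t
  · simp only [cloudPath, snoc, h, dif_pos, point]
    congr 1
    have : (⟨i, Nat.lt_succ_of_le hi⟩ : Fin (t + 2)) =
      Fin.castSucc ⟨i, Nat.lt_succ_of_le h⟩ := rfl
    rw [this, Fin.snoc_castSucc (α := fun _ => Fin N)]
  · have h' : (i : ℕ) = t + 1 := by omega
    simp only [cloudPath, snoc, h, dif_neg, not_false_eq_true]
    have : (⟨i, Nat.lt_succ_of_le hi⟩ : Fin (t + 2)) = Fin.last (t + 1) := Fin.ext h'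
    rw [this, Fin.snoc_last, h']

lemma lambda1_snoc (t : ℕ) (k : Fin (t + 1) → Fin N) (a : Fin N) :
    F.lambda1 m z (t + 1) (Fin.snoc (α := fun _ => Fin N) k a) =
      F.lambda1 m z t k * F.betaBS m z t a (k (Fin.last t)) := by
  simp only [lambda1, Fin.prod_univ_castSucc (n := t), Fin.succ_castSucc, Fin.succ_last,
    Fin.snoc_castSucc (α := fun _ => Fin N), Fin.snoc_last (α := fun _ => Fin N), Fin.val_castSucc,
    Fin.val_last, mul_assoc]

lemma lambda2_snoc (t : ℕ) (k l : Fin (t + 1) → Fin N) (a c : Fin N) :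
    F.lambda2 m z (t + 1) (Fin.snoc (α := fun _ => Fin N) k a)
        (Fin.snoc (α := fun _ => Fin N) l c) =
      F.lambda2 m z t k l * if c = a then F.weight z t (l (Fin.last t))
        else F.betaBS m z t c (l (Fin.last t)) := by
  simp only [lambda2, Fin.prod_univ_castSucc (n := t), Fin.succ_castSucc, Fin.succ_last,
    Fin.snoc_castSucc (α := fun _ => Fin N), Fin.snoc_last (α := fun _ => Fin N), Fin.val_castSucc,
    Fin.val_last, mul_assoc]

lemma coal_snoc (t : ℕ) (k l : Fin (t + 1) → Fin N) (a c : Fin N) :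
    coal b (t + 1) (Fin.snoc (α := fun _ => Fin N) k a) (Fin.snoc (α := fun _ => Fin N) l c) =
      coal b t k l * if (a = c ↔ b (t + 1) = true) then 1 else 0 := by
  simp only [coal, Fin.prod_univ_castSucc (n := t + 1),
    Fin.snoc_castSucc (α := fun _ => Fin N), Fin.snoc_last (α := fun _ => Fin N), Fin.val_castSucc,
    Fin.val_last]

lemma sum_snoc (t : ℕ) (f : (Fin (t + 2) → Fin N) → ℝ) :
    ∑ k, f k = ∑ a : Fin N, ∑ k : Fin (t + 1) → Fin N, f (Fin.snoc (α := fun _ => Fin N) k a) := by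
  rw [← Fintype.sum_prod_type']
  exact (Fintype.sum_equiv (Fin.snocEquiv fun _ : Fin (t + 2) => Fin N) _ _ fun p => rfl).symm

/-- The test function is allowed to depend on the terminal indices so that the induction closes: the
weights attached to the last step are absorbed into the test function of the previous time. -/
lemma sum_pairSum_eq (t : ℕ) (H : Fin N → Fin N → Path X t → Path X t → ℝ) :
    ∑ k, ∑ l, F.pairSum m b z t k l (H k l) =
      (∏ s ∈ Finset.range (t + 1), coalFactor N (b s)) * F.massN z t ^ 2 *
        ∑ k : Fin (t + 1) → Fin N, ∑ l : Fin (t + 1) → Fin N,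
          F.lambda1 m z t k * F.lambda2 m z t k l *
            (coal b t k l * H (k (Fin.last t)) (l (Fin.last t)) (cloudPath z k) (cloudPath z l)) := by
  induction t with
  | zero =>
    have hs (f : (Fin 1 → Fin N) → ℝ) : ∑ k, f k = ∑ a : Fin N, f fun _ => a :=
      Fintype.sum_equiv (Equiv.funUnique (Fin 1) (Fin N)) _ _ fun k => by
        congr 1; funext i; simp [Subsingleton.elim i default]
    have hp (k : Fin 1 → Fin N) (a : Fin N) (hk : k = fun _ => a) :
        (cloudPath z k : Path X 0) = fun _ => z 0 a := by
      funext i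
      have hi : (i : ℕ) = 0 := Nat.le_zero.1 (Finset.mem_Iic.1 i.2)
      simp only [cloudPath, hk, hi]
    simp only [hs, hp _ _ rfl, pairSum, lambda1, lambda2, coal, massN_zero, Finset.mul_sum]
    refine Finset.sum_congr rfl fun k _ => Finset.sum_congr rfl fun l _ => ?_
    simp
    ring_nf
  | succ t ih =>
    simp only [sum_snoc]
    have h1 (k l : Fin N) : F.pairSum m b z (t + 1) k l (H k l) = ∑ i, ∑ j,
        F.pairSum m b z t i j fun p q =>
          coalFactor N (b (t + 1)) * (if (k = l ↔ b (t + 1) = true) then 1 else 0) *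
            ((N : ℝ)⁻¹ * F.totalWeight z t) ^ 2 * (F.beta m z t (z (t + 1) k) i *
            (if l = k then F.weight z t j else F.beta m z t (z (t + 1) l) j)) *
            H k l (snoc p (z (t + 1) k)) (snoc q (z (t + 1) l)) := by
      simp only [pairSum, Finset.mul_sum]
      refine Finset.sum_congr rfl fun i _ => Finset.sum_congr rfl fun j _ => ?_
      rw [pairSum_const_mul t i j _ fun p q => H k l (snoc p (z (t + 1) k)) (snoc q (z (t + 1) l))]
      ring
    have h2 (k l : Fin N) := ih fun i j p q =>
      coalFactor N (b (t + 1)) * (if (k = l ↔ b (t + 1) = true) then 1 else 0) *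
            ((N : ℝ)⁻¹ * F.totalWeight z t) ^ 2 * (F.beta m z t (z (t + 1) k) i *
            (if l = k then F.weight z t j else F.beta m z t (z (t + 1) l) j)) *
            H k l (snoc p (z (t + 1) k)) (snoc q (z (t + 1) l))
    simp only [h1, h2, Finset.mul_sum]
    refine Finset.sum_congr rfl fun k _ => ?_
    rw [Finset.sum_comm]
    refine Finset.sum_congr rfl fun k' _ => ?_
    refine Finset.sum_congr rfl fun l _ => Finset.sum_congr rfl fun l' _ => ?_
    rw [lambda1_snoc, lambda2_snoc, coal_snoc, cloudPath_snoc, cloudPath_snoc,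
      Fin.snoc_last, Fin.snoc_last, Finset.prod_range_succ _ (t + 1), massN_succ]
    simp only [betaBS]
    ring

lemma muBS_eq_sum_pairSum (t : ℕ) (h : Path X t → Path X t → ℝ) :
    F.muBS m z b t h = ∑ k, ∑ l, F.pairSum m b z t k l h :=
  (sum_pairSum_eq (F := F) (m := m) t fun _ _ => h).symm

end Algebra

section Order

variable {F m} {ν : Measure X} {G σ : ℝ} {b : ℕ → Bool}

namespace IsDominated

variable (h : F.IsDominated ν m G σ)

include h

lemma pairSum_mono (hN : 2 ≤ N) (z : Cloud X N) (t : ℕ) (k l : Fin N)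
    {f g : Path X t → Path X t → ℝ} (hfg : ∀ p q, f p q ≤ g p q) :
    F.pairSum m b z t k l f ≤ F.pairSum m b z t k l g := by
  induction t generalizing k l with
  | zero =>
    refine mul_le_mul_of_nonneg_left (hfg _ _) (mul_nonneg (mul_nonneg (coalFactor_nonneg hN _) ?_)
      (by positivity))
    split_ifs <;> norm_num
  | succ t ih =>
    refine mul_le_mul_of_nonneg_left (Finset.sum_le_sum fun i _ => Finset.sum_le_sum fun j _ =>
      mul_le_mul_of_nonneg_left (ih i j fun p q => hfg _ _) ?_)
      (mul_nonneg (mul_nonneg (coalFactor_nonneg hN _) ?_) (by positivity))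
    · refine mul_nonneg (h.beta_nonneg _ _ _ _) ?_
      split_ifs
      exacts [F.weight_nonneg _ _ _, h.beta_nonneg _ _ _ _]
    · split_ifs <;> norm_num

lemma pairSum_nonneg (hN : 2 ≤ N) (z : Cloud X N) (t : ℕ) (k l : Fin N)
    {f : Path X t → Path X t → ℝ} (hf : ∀ p q, 0 ≤ f p q) : 0 ≤ F.pairSum m b z t k l f := by
  -- Zero is written as a product so that the homogeneity of `pairSum` evaluates the left-hand side.
  have h1 := h.pairSum_mono (b := b) hN z t k l (f := fun _ _ => 0 * 0)
    (g := f) fun p q => by simpa using hf p q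
  rw [pairSum_const_mul t k l 0 fun _ _ => 0] at h1
  simpa using h1

lemma abs_pairSum_le (hN : 2 ≤ N) (z : Cloud X N) (t : ℕ) (k l : Fin N)
    {f g : Path X t → Path X t → ℝ} (hfg : ∀ p q, |f p q| ≤ g p q) :
    |F.pairSum m b z t k l f| ≤ F.pairSum m b z t k l g := by
  have h1 := h.pairSum_mono (b := b) hN z t k l (f := fun p q => (-1) * g p q) (g := f)
    fun p q => by linarith [neg_le_of_abs_le (hfg p q)]
  rw [pairSum_const_mul] at h1
  refine abs_le.2 ⟨by linarith, h.pairSum_mono hN z t k l fun p q => le_of_abs_le (hfg p q)⟩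

lemma abs_pairSum_le_mul (hN : 2 ≤ N) (z : Cloud X N) (t : ℕ) (k l : Fin N)
    {f : Path X t → Path X t → ℝ} {K : ℝ} (hf : ∀ p q, |f p q| ≤ K) :
    |F.pairSum m b z t k l f| ≤ K * F.pairSum m b z t k l fun _ _ => 1 := by
  rw [← pairSum_const_mul]
  exact h.abs_pairSum_le hN z t k l fun p q => by simpa using hf p q

/-- Joint measurability of `pairSum` in the cloud and in a parameter. -/
lemma bddMeasurable_pairSum [NeZero N] {Θ : Type*} [MeasurableSpace Θ] {ζ : Θ → Cloud X N}
    (hζ : Measurable ζ) (t : ℕ) (k l : Fin N) {f : Θ → Path X t → Path X t → ℝ}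
    (hf : BddMeasurable fun q : Θ × Path X t × Path X t => f q.1 q.2.1 q.2.2) :
    BddMeasurable fun θ => F.pairSum m b (ζ θ) t k l (f θ) := by
  have hev (u : ℕ) (i : Fin N) : Measurable fun θ => ζ θ u i :=
    (measurable_pi_apply i).comp ((measurable_pi_apply u).comp hζ)
  induction t generalizing k l with
  | zero =>
    refine (BddMeasurable.const _).mul (hf.comp
      (φ := fun θ => (θ, (fun _ => ζ θ 0 k : Path X 0), (fun _ => ζ θ 0 l : Path X 0))) ?_)
    exact measurable_id.prodMk ((measurable_pi_lambda _ fun _ => hev 0 k).prodMk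
      (measurable_pi_lambda _ fun _ => hev 0 l))
  | succ t ih =>
    have hb (k i : Fin N) : BddMeasurable fun θ => F.beta m (ζ θ) t (ζ θ (t + 1) k) i :=
      (h.bddMeasurable_beta t i).comp (hζ.prodMk (hev (t + 1) k))
    have hT : BddMeasurable fun θ => (N : ℝ)⁻¹ * F.totalWeight (ζ θ) t :=
      ⟨measurable_const.mul ((F.measurable_totalWeight t).comp hζ), G, fun θ => by
        rw [abs_of_nonneg (mul_nonneg (by positivity) (F.totalWeight_nonneg _ _))]
        exact h.mean_totalWeight_le _ _⟩
    refine ((BddMeasurable.const _).mul (hT.pow 2)).mul (BddMeasurable.sum _ fun i _ =>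
      BddMeasurable.sum _ fun j _ => ((hb k i).mul (BddMeasurable.ite
        ((h.bddMeasurable_weight t j).comp hζ) (hb l j))).mul (ih i j ?_))
    refine hf.comp (φ := fun q : Θ × Path X t × Path X t =>
      (q.1, snoc q.2.1 (ζ q.1 (t + 1) k), snoc q.2.2 (ζ q.1 (t + 1) l))) ?_
    exact measurable_fst.prodMk ((measurable_snoc.comp
        ((measurable_fst.comp measurable_snd).prodMk ((hev _ k).comp measurable_fst))).prodMk
      (measurable_snoc.comp
        ((measurable_snd.comp measurable_snd).prodMk ((hev _ l).comp measurable_fst))))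

end IsDominated

end Order

end FeynmanKac

end FFBS

/-! ### One generation of μ^BS given the past -/

namespace FFBS

namespace FeynmanKac

variable {X : Type*} [MeasurableSpace X] (F : FeynmanKac X) (m : ℕ → X → X → ℝ) {N : ℕ}

/-- The contribution to `μ^BS_{b,t+1}(h)` of two distinct particles `x` and `y` at time `t + 1`. -/
noncomputable def stepPair (b : ℕ → Bool) (z : Cloud X N) (t : ℕ)
    (h : Path X (t + 1) → Path X (t + 1) → ℝ) (x y : X) : ℝ :=
  ((N : ℝ)⁻¹ * F.totalWeight z t) ^ 2 * ∑ i, ∑ j, F.beta m z t x i * F.beta m z t y j *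
    F.pairSum m b z t i j fun p q => h (snoc p x) (snoc q y)

/-- The contribution to `μ^BS_{b,t+1}(h)` of a coalescence at the particle `x` at time `t + 1`. -/
noncomputable def stepDiag (b : ℕ → Bool) (z : Cloud X N) (t : ℕ)
    (h : Path X (t + 1) → Path X (t + 1) → ℝ) (x : X) : ℝ :=
  ((N : ℝ)⁻¹ * F.totalWeight z t) ^ 2 * ∑ i, ∑ j, F.beta m z t x i * F.weight z t j *
    F.pairSum m b z t i j fun p q => h (snoc p x) (snoc q x)

/-- `μ^BS_{b,t+1}(h)` as a function of the cloud up to time `t` and the particles `y` at time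
`t + 1`. -/
noncomputable def stepBS (b : ℕ → Bool) (z : Cloud X N) (t : ℕ)
    (h : Path X (t + 1) → Path X (t + 1) → ℝ) (y : Fin N → X) : ℝ :=
  if b (t + 1) then (N : ℝ) * ∑ k, F.stepDiag m b z t h (y k)
  else (N : ℝ) / ((N : ℝ) - 1) * offSum (F.stepPair m b z t h) y

/-- The sum of the squared row sums of the weights of `μ^BS_{b,t}`. -/
noncomputable def energy (b : ℕ → Bool) (z : Cloud X N) (t : ℕ) : ℝ :=
  ∑ k, (∑ l, F.pairSum m b z t k l fun _ _ => 1) ^ 2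

/-- `energy` at time `t + 1` as a function of the cloud up to time `t` and the particles `y` at
time `t + 1`. -/
noncomputable def energyStep (b : ℕ → Bool) (z : Cloud X N) (t : ℕ) (y : Fin N → X) : ℝ :=
  if b (t + 1) then (N : ℝ) ^ 2 * ∑ k, F.stepDiag m b z t (fun _ _ => 1) (y k) ^ 2
  else ((N : ℝ) / ((N : ℝ) - 1)) ^ 2 * ∑ k, rowSum (F.stepPair m b z t fun _ _ => 1) y k ^ 2

variable {F m} {b : ℕ → Bool}

lemma pairSum_succ_of_true {t : ℕ} (hb : b (t + 1) = true) (z : Cloud X N) (k l : Fin N)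
    (h : Path X (t + 1) → Path X (t + 1) → ℝ) :
    F.pairSum m b z (t + 1) k l h =
      if k = l then (N : ℝ) * F.stepDiag m b z t h (z (t + 1) k) else 0 := by
  split_ifs with hkl
  · subst hkl
    simp [pairSum, stepDiag, coalFactor, hb, mul_assoc]
  · simp [pairSum, hb, hkl]

lemma pairSum_succ_of_false {t : ℕ} (hb : b (t + 1) = false) (z : Cloud X N) (k l : Fin N)
    (h : Path X (t + 1) → Path X (t + 1) → ℝ) :
    F.pairSum m b z (t + 1) k l h = (N : ℝ) / ((N : ℝ) - 1) *
      if k = l then 0 else F.stepPair m b z t h (z (t + 1) k) (z (t + 1) l) := by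
  split_ifs with hkl
  · simp [pairSum, hb, hkl]
  · simp [pairSum, stepPair, coalFactor, hb, hkl, Ne.symm hkl, mul_assoc]

/-- This isolates the last generation. According to the flag, μ^BS is a sum over single new
particles or over ordered pairs of distinct ones, and the i.i.d. moment formulas apply
conditionally. -/
lemma muBS_succ (z : Cloud X N) (t : ℕ) (h : Path X (t + 1) → Path X (t + 1) → ℝ) :
    F.muBS m z b (t + 1) h = F.stepBS m b z t h (z (t + 1)) := by
  rw [muBS_eq_sum_pairSum, stepBS]
  split_ifs with hb
  · simp [pairSum_succ_of_true hb, Finset.mul_sum]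
  · simp only [pairSum_succ_of_false (Bool.not_eq_true _ ▸ hb), offSum, Finset.mul_sum]

lemma energy_succ (z : Cloud X N) (t : ℕ) :
    F.energy m b z (t + 1) = F.energyStep m b z t (z (t + 1)) := by
  rw [energy, energyStep]
  split_ifs with hb
  · simp [pairSum_succ_of_true hb, Finset.mul_sum, mul_pow]
  · simp only [pairSum_succ_of_false (Bool.not_eq_true _ ▸ hb), rowSum, Finset.mul_sum,
      ← mul_pow]

lemma stepPair_congr {z z' : Cloud X N} {t : ℕ} (hz : ∀ u ≤ t, z u = z' u)
    (h : Path X (t + 1) → Path X (t + 1) → ℝ) (x y : X) :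
    F.stepPair m b z t h x y = F.stepPair m b z' t h x y := by
  simp only [stepPair, totalWeight, beta, hz t le_rfl, fun i j h => pairSum_congr_cloud (F := F)
    (m := m) (b := b) t i j h hz]

lemma stepDiag_congr {z z' : Cloud X N} {t : ℕ} (hz : ∀ u ≤ t, z u = z' u)
    (h : Path X (t + 1) → Path X (t + 1) → ℝ) (x : X) :
    F.stepDiag m b z t h x = F.stepDiag m b z' t h x := by
  simp only [stepDiag, totalWeight, weight, beta, hz t le_rfl, fun i j h =>
    pairSum_congr_cloud (F := F) (m := m) (b := b) t i j h hz]

lemma stepBS_congr {z z' : Cloud X N} {t : ℕ} (hz : ∀ u ≤ t, z u = z' u)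
    (h : Path X (t + 1) → Path X (t + 1) → ℝ) (y : Fin N → X) :
    F.stepBS m b z t h y = F.stepBS m b z' t h y := by
  simp only [stepBS, offSum, stepDiag_congr hz, stepPair_congr hz]

lemma energyStep_congr {z z' : Cloud X N} {t : ℕ} (hz : ∀ u ≤ t, z u = z' u) (y : Fin N → X) :
    F.energyStep m b z t y = F.energyStep m b z' t y := by
  simp only [energyStep, rowSum, stepDiag_congr hz, stepPair_congr hz]

lemma muBS_congr_cloud {z z' : Cloud X N} {t : ℕ} (hz : ∀ u ≤ t, z u = z' u)
    (h : Path X t → Path X t → ℝ) : F.muBS m z b t h = F.muBS m z' b t h := by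
  simp only [muBS_eq_sum_pairSum, fun i j h => pairSum_congr_cloud (F := F)
    (m := m) (b := b) t i j h hz]

namespace IsDominated

variable {ν : Measure X} {G σ : ℝ} (h : F.IsDominated ν m G σ)

include h

lemma bddMeasurable_mean_totalWeight (t : ℕ) :
    BddMeasurable fun z : Cloud X N => (N : ℝ)⁻¹ * F.totalWeight z t :=
  ⟨measurable_const.mul (F.measurable_totalWeight t), G, fun z => by
    rw [abs_of_nonneg (mul_nonneg (by positivity) (F.totalWeight_nonneg _ _))]
    exact h.mean_totalWeight_le _ _⟩

/-- The test function may vary with the cloud, as it does for the plug-in functions built from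
`bwN`. -/
lemma bddMeasurable_stepPair [NeZero N] {t : ℕ}
    {f : Cloud X N → Path X (t + 1) → Path X (t + 1) → ℝ}
    (hf : BddMeasurable fun q : Cloud X N × Path X (t + 1) × Path X (t + 1) => f q.1 q.2.1 q.2.2) :
    BddMeasurable fun q : Cloud X N × X × X => F.stepPair m b q.1 t (f q.1) q.2.1 q.2.2 := by
  refine (((h.bddMeasurable_mean_totalWeight t).comp measurable_fst).pow 2).mul
    (BddMeasurable.sum _ fun i _ => BddMeasurable.sum _ fun j _ => BddMeasurable.mul
      (BddMeasurable.mul ?_ ?_) (h.bddMeasurable_pairSum measurable_fst t i j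
        (f := fun (θ : Cloud X N × X × X) p q => f θ.1 (snoc p θ.2.1) (snoc q θ.2.2)) ?_))
  · exact (h.bddMeasurable_beta t i).comp
      (measurable_fst.prodMk (measurable_fst.comp measurable_snd))
  · exact (h.bddMeasurable_beta t j).comp
      (measurable_fst.prodMk (measurable_snd.comp measurable_snd))
  · refine hf.comp (φ := fun q : (Cloud X N × X × X) × Path X t × Path X t =>
      (q.1.1, snoc q.2.1 q.1.2.1, snoc q.2.2 q.1.2.2)) ?_
    exact (measurable_fst.comp measurable_fst).prodMk
      ((measurable_snoc.comp (f := fun q : (Cloud X N × X × X) × Path X t × Path X t =>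
        (q.2.1, q.1.2.1)) (by fun_prop)).prodMk
      (measurable_snoc.comp (f := fun q : (Cloud X N × X × X) × Path X t × Path X t =>
        (q.2.2, q.1.2.2)) (by fun_prop)))

lemma bddMeasurable_stepDiag [NeZero N] {t : ℕ}
    {f : Cloud X N → Path X (t + 1) → Path X (t + 1) → ℝ}
    (hf : BddMeasurable fun q : Cloud X N × Path X (t + 1) × Path X (t + 1) => f q.1 q.2.1 q.2.2) :
    BddMeasurable fun q : Cloud X N × X => F.stepDiag m b q.1 t (f q.1) q.2 := by
  refine (((h.bddMeasurable_mean_totalWeight t).comp measurable_fst).pow 2).mul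
    (BddMeasurable.sum _ fun i _ => BddMeasurable.sum _ fun j _ => BddMeasurable.mul
      (BddMeasurable.mul ?_ ?_) (h.bddMeasurable_pairSum measurable_fst t i j
        (f := fun (θ : Cloud X N × X) p q => f θ.1 (snoc p θ.2) (snoc q θ.2)) ?_))
  · exact h.bddMeasurable_beta t i
  · exact (h.bddMeasurable_weight t j).comp measurable_fst
  · refine hf.comp (φ := fun q : (Cloud X N × X) × Path X t × Path X t =>
      (q.1.1, snoc q.2.1 q.1.2, snoc q.2.2 q.1.2)) ?_
    exact (measurable_fst.comp measurable_fst).prodMk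
      ((measurable_snoc.comp (f := fun q : (Cloud X N × X) × Path X t × Path X t =>
        (q.2.1, q.1.2)) (by fun_prop)).prodMk
      (measurable_snoc.comp (f := fun q : (Cloud X N × X) × Path X t × Path X t =>
        (q.2.2, q.1.2)) (by fun_prop)))

lemma bddMeasurable_stepBS [NeZero N] {t : ℕ}
    {f : Cloud X N → Path X (t + 1) → Path X (t + 1) → ℝ}
    (hf : BddMeasurable fun q : Cloud X N × Path X (t + 1) × Path X (t + 1) => f q.1 q.2.1 q.2.2) :
    BddMeasurable (Function.uncurry fun (z : Cloud X N) y => F.stepBS m b z t (f z) y) := by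
  have hev (k : Fin N) : Measurable fun p : Cloud X N × (Fin N → X) => p.2 k :=
    (measurable_pi_apply k).comp measurable_snd
  refine BddMeasurable.ite ((BddMeasurable.const _).mul (BddMeasurable.sum _ fun k _ => ?_))
    ((BddMeasurable.const _).mul (BddMeasurable.sum _ fun k _ => BddMeasurable.sum _ fun l _ =>
      BddMeasurable.ite (BddMeasurable.const _) ?_))
  · exact (h.bddMeasurable_stepDiag (f := f) hf).comp
      (φ := fun p : Cloud X N × (Fin N → X) => (p.1, p.2 k)) (measurable_fst.prodMk (hev k))
  · exact (h.bddMeasurable_stepPair (f := f) hf).comp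
      (φ := fun p : Cloud X N × (Fin N → X) => (p.1, p.2 k, p.2 l)) (measurable_fst.prodMk ((hev k).prodMk (hev l)))

lemma bddMeasurable_energyStep [NeZero N] (t : ℕ) :
    BddMeasurable (Function.uncurry fun (z : Cloud X N) y => F.energyStep m b z t y) := by
  have hev (k : Fin N) : Measurable fun p : Cloud X N × (Fin N → X) => p.2 k :=
    (measurable_pi_apply k).comp measurable_snd
  have hf : BddMeasurable fun _ : Cloud X N × Path X (t + 1) × Path X (t + 1) => (1 : ℝ) :=
    BddMeasurable.const 1
  refine BddMeasurable.ite ((BddMeasurable.const _).mul (BddMeasurable.sum _ fun k _ =>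
    BddMeasurable.pow ?_ 2)) ((BddMeasurable.const _).mul (BddMeasurable.sum _ fun k _ =>
      BddMeasurable.pow (BddMeasurable.sum _ fun l _ =>
      BddMeasurable.ite (BddMeasurable.const _) ?_) 2))
  · exact (h.bddMeasurable_stepDiag (f := fun _ _ _ => 1) hf).comp
      (φ := fun p : Cloud X N × (Fin N → X) => (p.1, p.2 k)) (measurable_fst.prodMk (hev k))
  · exact (h.bddMeasurable_stepPair (f := fun _ _ _ => 1) hf).comp
      (φ := fun p : Cloud X N × (Fin N → X) => (p.1, p.2 k, p.2 l)) (measurable_fst.prodMk ((hev k).prodMk (hev l)))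

lemma bddMeasurable_muBS [NeZero N] (t : ℕ) {f : Cloud X N → Path X t → Path X t → ℝ}
    (hf : BddMeasurable fun q : Cloud X N × Path X t × Path X t => f q.1 q.2.1 q.2.2) :
    BddMeasurable fun z : Cloud X N => F.muBS m z b t (f z) := by
  simp only [muBS_eq_sum_pairSum]
  exact BddMeasurable.sum _ fun k _ => BddMeasurable.sum _ fun l _ =>
    h.bddMeasurable_pairSum measurable_id t k l hf

lemma bddMeasurable_energy [NeZero N] (t : ℕ) :
    BddMeasurable fun z : Cloud X N => F.energy m b z t :=
  BddMeasurable.sum _ fun k _ => (BddMeasurable.sum _ fun l _ =>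
    h.bddMeasurable_pairSum measurable_id t k l (f := fun _ _ _ => 1) (BddMeasurable.const 1)).pow 2

omit h in
lemma _root_.FFBS.BddMeasurable.of_const_cloud {t : ℕ} {f : Path X t → Path X t → ℝ}
    (hf : BddMeasurable (Function.uncurry f)) :
    BddMeasurable fun q : Cloud X N × Path X t × Path X t => f q.2.1 q.2.2 :=
  hf.comp measurable_snd

section OneStep

variable [NeZero N] (z : Cloud X N) (t : ℕ) {f : Path X (t + 1) → Path X (t + 1) → ℝ}

lemma bddMeasurable_stepPair_fixed (hf : BddMeasurable (Function.uncurry f)) :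
    BddMeasurable (Function.uncurry (F.stepPair m b z t f)) :=
  (h.bddMeasurable_stepPair (f := fun _ => f) hf.of_const_cloud).comp
    (φ := fun w : X × X => (z, w)) measurable_prodMk_left

lemma bddMeasurable_stepDiag_fixed (hf : BddMeasurable (Function.uncurry f)) :
    BddMeasurable (F.stepDiag m b z t f) :=
  (h.bddMeasurable_stepDiag (f := fun _ => f) hf.of_const_cloud).comp
    (φ := fun w : X => (z, w)) measurable_prodMk_left

lemma bddMeasurable_beta_fixed (i : Fin N) : BddMeasurable fun x => F.beta m z t x i :=
  (h.bddMeasurable_beta t i).comp measurable_prodMk_left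

lemma bddMeasurable_pairSum_snoc (i j : Fin N) (hf : BddMeasurable (Function.uncurry f)) :
    BddMeasurable fun w : X × X =>
      F.pairSum m b z t i j fun p q => f (snoc p w.1) (snoc q w.2) := by
  refine h.bddMeasurable_pairSum (ζ := fun _ => z) measurable_const t i j
    (f := fun (w : X × X) p q => f (snoc p w.1) (snoc q w.2)) ?_
  refine hf.comp (φ := fun q : (X × X) × Path X t × Path X t =>
      (snoc q.2.1 q.1.1, snoc q.2.2 q.1.2)) ?_
  exact (measurable_snoc.comp (f := fun q : (X × X) × Path X t × Path X t =>
        (q.2.1, q.1.1)) (by fun_prop)).prodMk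
      (measurable_snoc.comp (f := fun q : (X × X) × Path X t × Path X t =>
        (q.2.2, q.1.2)) (by fun_prop))

/-- A sum over the backward weights, integrated against the law of the next particle. -/
lemma integral_sum_beta_mul {a : Fin N → X → ℝ} (ha : ∀ i, BddMeasurable (a i)) :
    ∫ x, ∑ i, F.beta m z t x i * a i x ∂F.mix z t =
      ∑ i, F.weight z t i * ∫ x, a i x ∂F.trans (t + 1) (z t i) := by
  rw [integral_finsetSum _ fun i _ =>
    ((h.bddMeasurable_beta_fixed z t i).mul (ha i)).integrable _]
  exact Finset.sum_congr rfl fun i _ => h.integral_beta_mul z t i (a i)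

/-- Only the first lineage carries backward weights. Reversal turns them into forward weights and a
move from particle `i`, while the second lineage already has forward weights and is placed on the
same point. -/
lemma integral_stepDiag (hf : BddMeasurable (Function.uncurry f)) :
    ∫ x, F.stepDiag m b z t f x ∂F.mix z t = ((N : ℝ)⁻¹ * F.totalWeight z t) ^ 2 *
      ∑ i, ∑ j, F.weight z t i * F.weight z t j *
        ∫ x, F.pairSum m b z t i j (fun p q => f (snoc p x) (snoc q x))
          ∂F.trans (t + 1) (z t i) := by
  have hP (i j : Fin N) : BddMeasurable fun x =>
      F.pairSum m b z t i j fun p q => f (snoc p x) (snoc q x) :=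
    (h.bddMeasurable_pairSum_snoc z t i j hf).comp (measurable_id.prodMk measurable_id)
  unfold stepDiag
  rw [integral_const_mul]
  congr 1
  have e (x : X) : ∑ i, ∑ j, F.beta m z t x i * F.weight z t j *
      F.pairSum m b z t i j (fun p q => f (snoc p x) (snoc q x)) =
      ∑ i, F.beta m z t x i * ∑ j, F.weight z t j *
      F.pairSum m b z t i j (fun p q => f (snoc p x) (snoc q x)) := by
    simp only [Finset.mul_sum, mul_assoc]
  simp_rw [e]
  rw [h.integral_sum_beta_mul z t fun i => BddMeasurable.sum _ fun j _ =>
    (BddMeasurable.const _).mul (hP i j)]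
  refine Finset.sum_congr rfl fun i _ => ?_
  rw [integral_finsetSum _ fun j _ => ((BddMeasurable.const _).mul (hP i j)).integrable _,
    Finset.mul_sum]
  refine Finset.sum_congr rfl fun j _ => ?_
  rw [integral_const_mul, mul_assoc]

/-- Two distinct new particles are independent, so the reversal applies to each of them separately,
first to the second particle with the first one fixed, then to the first. -/
lemma integral_stepPair (hf : BddMeasurable (Function.uncurry f)) :
    ∫ p, Function.uncurry (F.stepPair m b z t f) p ∂(F.mix z t).prod (F.mix z t) =
      ((N : ℝ)⁻¹ * F.totalWeight z t) ^ 2 * ∑ i, ∑ j, F.weight z t i * F.weight z t j *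
        ∫ x, ∫ y, F.pairSum m b z t i j (fun p q => f (snoc p x) (snoc q y))
          ∂F.trans (t + 1) (z t j) ∂F.trans (t + 1) (z t i) := by
  have hP (i j : Fin N) := h.bddMeasurable_pairSum_snoc (b := b) z t i j hf
  have hP1 (i j : Fin N) (x : X) : BddMeasurable fun y =>
      F.pairSum m b z t i j fun p q => f (snoc p x) (snoc q y) :=
    (hP i j).comp measurable_prodMk_left
  have hP2 (i j : Fin N) : BddMeasurable fun x => ∫ y,
      F.pairSum m b z t i j (fun p q => f (snoc p x) (snoc q y)) ∂F.trans (t + 1) (z t j) :=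
    BddMeasurable.integral_kernel (κ := Kernel.const X (F.trans (t + 1) (z t j)))
      (f := fun x y => F.pairSum m b z t i j (fun p q => f (snoc p x) (snoc q y))) (hP i j)
  rw [integral_prod _ ((h.bddMeasurable_stepPair_fixed z t hf).integrable _)]
  simp only [Function.uncurry_apply_pair, stepPair]
  simp_rw [integral_const_mul]
  congr 1
  have e1 (x y : X) : ∑ i, ∑ j, F.beta m z t x i * F.beta m z t y j *
      F.pairSum m b z t i j (fun p q => f (snoc p x) (snoc q y)) =
      ∑ j, F.beta m z t y j * ∑ i, F.beta m z t x i *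
      F.pairSum m b z t i j (fun p q => f (snoc p x) (snoc q y)) := by
    rw [Finset.sum_comm]
    simp only [Finset.mul_sum]
    exact Finset.sum_congr rfl fun i _ => Finset.sum_congr rfl fun j _ => by ring
  have e2 (x : X) : ∫ y, ∑ i, ∑ j, F.beta m z t x i * F.beta m z t y j *
      F.pairSum m b z t i j (fun p q => f (snoc p x) (snoc q y)) ∂F.mix z t =
      ∑ i, F.beta m z t x i * ∑ j, F.weight z t j * ∫ y,
        F.pairSum m b z t i j (fun p q => f (snoc p x) (snoc q y)) ∂F.trans (t + 1) (z t j) := by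
    simp_rw [e1]
    rw [h.integral_sum_beta_mul z t fun j => BddMeasurable.sum _ fun i _ =>
      (BddMeasurable.const _).mul (hP1 i j x)]
    simp only [Finset.mul_sum]
    rw [Finset.sum_comm]
    refine Finset.sum_congr rfl fun j _ => ?_
    rw [integral_finsetSum _ fun i _ => ((BddMeasurable.const _).mul (hP1 i j x)).integrable _,
      Finset.mul_sum]
    refine Finset.sum_congr rfl fun i _ => ?_
    rw [integral_const_mul]; ring
  simp_rw [e2]
  rw [h.integral_sum_beta_mul z t fun i => BddMeasurable.sum _ fun j _ =>
    (BddMeasurable.const _).mul (hP2 i j)]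
  refine Finset.sum_congr rfl fun i _ => ?_
  rw [integral_finsetSum _ fun j _ => ((BddMeasurable.const _).mul (hP2 i j)).integrable _,
    Finset.mul_sum]
  refine Finset.sum_congr rfl fun j _ => ?_
  rw [integral_const_mul, mul_assoc]

lemma mean_totalWeight_mul_weight (i : Fin N) :
    F.totalWeight z t * F.weight z t i = F.pot t (z t i) := by
  have := (F.totalWeight_pos h.pot_pos z t).ne'
  unfold weight; field_simp

/-- The conditional mean of `μ^BS_{b,t+1}(f)`. -/
lemma integral_stepBS (hN : 2 ≤ N) (hf : BddMeasurable (Function.uncurry f)) :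
    ∫ y, F.stepBS m b z t f y ∂Measure.pi (fun _ : Fin N => F.mix z t) =
      F.muBS m z b t (F.pairPush (b (t + 1)) f) := by
  have hpr := F.isProbabilityMeasure_mix h.pot_pos z t
  have hN0 : (N : ℝ) ≠ 0 := NeZero.ne _
  have hN1 : (N : ℝ) - 1 ≠ 0 := by
    have : (2 : ℝ) ≤ N := by exact_mod_cast hN
    linarith
  -- The `N ^ 2` produced by summing over the new generation cancels the mean weights' denominators,
  -- and each total weight cancels a normalization; only the potentials remain.
  have hw (i j : Fin N) (a : ℝ) : (N : ℝ) ^ 2 * (((N : ℝ)⁻¹ * F.totalWeight z t) ^ 2 *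
      (F.weight z t i * F.weight z t j * a)) = F.pot t (z t i) * F.pot t (z t j) * a := by
    rw [← h.mean_totalWeight_mul_weight z t i, ← h.mean_totalWeight_mul_weight z t j]
    field_simp
  have hsn (i j : Fin N) (p q : Path X t) : BddMeasurable fun w : X × X => f (snoc p w.1) (snoc q w.2) :=
    hf.comp (φ := fun w : X × X => (snoc p w.1, snoc q w.2)) ((measurable_snoc.comp
      (f := fun w : X × X => (p, w.1)) (by fun_prop)).prodMk (measurable_snoc.comp
      (f := fun w : X × X => (q, w.2)) (by fun_prop)))
  unfold stepBS
  cases hb : b (t + 1)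
  · simp only [Bool.false_eq_true, if_false]
    rw [integral_const_mul, integral_offSum _ (h.bddMeasurable_stepPair_fixed z t hf),
      h.integral_stepPair z t hf, muBS_eq_sum_pairSum, ← mul_assoc]
    -- The correction `N / (N - 1)` compensates for the number of ordered pairs of distinct indices.
    have e1 : (N : ℝ) / (N - 1) * (N * (N - 1)) = N ^ 2 := by field_simp
    rw [e1]
    simp only [Finset.mul_sum, hw]
    refine Finset.sum_congr rfl fun i _ => Finset.sum_congr rfl fun j _ => ?_
    have i1 (x : X) := integrable_and_integral_pairSum (F := F) (m := m) (b := b) (z := z)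
      (F.trans (t + 1) (z t j)) t i j (fun y p q => f (snoc p x) (snoc q y)) fun p q =>
        ((hsn i j p q).comp measurable_prodMk_left).integrable _
    simp_rw [fun x => (i1 x).2]
    have i2 := integrable_and_integral_pairSum (F := F) (m := m) (b := b) (z := z)
      (F.trans (t + 1) (z t i)) t i j
      (fun x p q => ∫ y, f (snoc p x) (snoc q y) ∂F.trans (t + 1) (z t j)) fun p q =>
        (BddMeasurable.integral_kernel (κ := Kernel.const X (F.trans (t + 1) (z t j)))
          (f := fun x y => f (snoc p x) (snoc q y)) (hsn i j p q)).integrable _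
    rw [i2.2, ← pairSum_const_mul]
    -- The transitions start from the particles `i` and `j`, which are the end points of the paths
    -- being summed.
    refine pairSum_congr_last t i j fun p q hp hq => ?_
    simp [pairPush, hp, hq]
  · simp only [if_true]
    rw [integral_const_mul, integral_sum_eval_pi _ (h.bddMeasurable_stepDiag_fixed z t hf),
      h.integral_stepDiag z t hf, muBS_eq_sum_pairSum, ← mul_assoc, ← pow_two]
    simp only [Finset.mul_sum, hw]
    refine Finset.sum_congr rfl fun i _ => Finset.sum_congr rfl fun j _ => ?_
    have i1 := integrable_and_integral_pairSum (F := F) (m := m) (b := b) (z := z)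
      (F.trans (t + 1) (z t i)) t i j (fun x p q => f (snoc p x) (snoc q x)) fun p q =>
        ((hsn i j p q).comp (measurable_id.prodMk measurable_id)).integrable _
    rw [i1.2, ← pairSum_const_mul]
    refine pairSum_congr_last t i j fun p q hp hq => ?_
    simp [pairPush, hp, hq]

end OneStep

end IsDominated

end FeynmanKac

end FFBS

/-! ### Conditional variances and the rate for fixed test functions -/

namespace FFBS

/-- Jensen's inequality for a finite probability vector, derived from Cauchy-Schwarz. -/
lemma sq_sum_mul_le {ι : Type*} (s : Finset ι) {w a : ι → ℝ} (hw : ∀ i ∈ s, 0 ≤ w i)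
    (hw1 : ∑ i ∈ s, w i = 1) : (∑ i ∈ s, w i * a i) ^ 2 ≤ ∑ i ∈ s, w i * a i ^ 2 := by
  have := Finset.sum_sq_le_sum_mul_sum_of_sq_le_mul s (r := fun i => w i * a i) (f := w)
    (g := fun i => w i * a i ^ 2) hw (fun i hi => mul_nonneg (hw i hi) (sq_nonneg _))
    fun i _ => le_of_eq (by ring)
  rwa [hw1, one_mul] at this

lemma div_sub_one_le_two {N : ℕ} (hN : 2 ≤ N) : (N : ℝ) / ((N : ℝ) - 1) ≤ 2 := by
  have : (2 : ℝ) ≤ N := by exact_mod_cast hN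
  rw [div_le_iff₀ (by linarith)]
  linarith

lemma rowSum_const_mul {X : Type*} {N : ℕ} (c : ℝ) (F : X → X → ℝ) (y : Fin N → X) (k : Fin N) :
    rowSum (fun x x' => c * F x x') y k = c * rowSum F y k := by
  simp only [rowSum, Finset.mul_sum]
  refine Finset.sum_congr rfl fun l _ => ?_
  split_ifs <;> simp

namespace FeynmanKac

variable {X : Type*} [MeasurableSpace X] {F : FeynmanKac X} {m : ℕ → X → X → ℝ} {N : ℕ}
  {b : ℕ → Bool}

namespace IsDominated

variable {ν : Measure X} {G σ : ℝ} (h : F.IsDominated ν m G σ)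

include h

section OneStep

variable [NeZero N] (z : Cloud X N) (t : ℕ)

omit h [NeZero N] in
lemma stepPair_one_symm (x y : X) :
    F.stepPair m b z t (fun _ _ => 1) x y = F.stepPair m b z t (fun _ _ => 1) y x := by
  simp only [stepPair]
  rw [Finset.sum_comm]
  congr 1
  refine Finset.sum_congr rfl fun i _ => Finset.sum_congr rfl fun j _ => ?_
  rw [pairSum_one_symm]; ring

omit [NeZero N] in
lemma abs_stepPair_le (hN : 2 ≤ N) {f : Path X (t + 1) → Path X (t + 1) → ℝ} {K : ℝ}
    (hf : ∀ p q, |f p q| ≤ K) (x y : X) :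
    |F.stepPair m b z t f x y| ≤ K * F.stepPair m b z t (fun _ _ => 1) x y := by
  rw [stepPair, abs_mul, abs_of_nonneg (sq_nonneg _), stepPair, mul_left_comm]
  refine mul_le_mul_of_nonneg_left ?_ (sq_nonneg _)
  simp only [Finset.mul_sum]
  refine (Finset.abs_sum_le_sum_abs _ _).trans (Finset.sum_le_sum fun i _ =>
    (Finset.abs_sum_le_sum_abs _ _).trans (Finset.sum_le_sum fun j _ => ?_))
  rw [abs_mul, abs_of_nonneg (mul_nonneg (h.beta_nonneg _ _ _ _) (h.beta_nonneg _ _ _ _)),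
    mul_left_comm]
  exact mul_le_mul_of_nonneg_left (h.abs_pairSum_le_mul hN z t i j fun p q => hf _ _)
    (mul_nonneg (h.beta_nonneg _ _ _ _) (h.beta_nonneg _ _ _ _))

omit [NeZero N] in
lemma abs_stepDiag_le (hN : 2 ≤ N) {f : Path X (t + 1) → Path X (t + 1) → ℝ} {K : ℝ}
    (hf : ∀ p q, |f p q| ≤ K) (x : X) :
    |F.stepDiag m b z t f x| ≤ K * F.stepDiag m b z t (fun _ _ => 1) x := by
  rw [stepDiag, abs_mul, abs_of_nonneg (sq_nonneg _), stepDiag, mul_left_comm]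
  refine mul_le_mul_of_nonneg_left ?_ (sq_nonneg _)
  simp only [Finset.mul_sum]
  refine (Finset.abs_sum_le_sum_abs _ _).trans (Finset.sum_le_sum fun i _ =>
    (Finset.abs_sum_le_sum_abs _ _).trans (Finset.sum_le_sum fun j _ => ?_))
  rw [abs_mul, abs_of_nonneg (mul_nonneg (h.beta_nonneg _ _ _ _) (F.weight_nonneg _ _ _)),
    mul_left_comm]
  exact mul_le_mul_of_nonneg_left (h.abs_pairSum_le_mul hN z t i j fun p q => hf _ _)
    (mul_nonneg (h.beta_nonneg _ _ _ _) (F.weight_nonneg _ _ _))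

lemma integral_beta (i : Fin N) : ∫ x, F.beta m z t x i ∂F.mix z t = F.weight z t i := by
  simpa using h.integral_beta_mul z t i fun _ => 1

/-- Averaging the second particle turns its backward weights into forward ones, which are the
weights used at a coalescence. The conditional row sums for pairs are thus governed by the same
second moment as the coalescing case. -/
lemma integral_stepPair_one (x : X) :
    ∫ y, F.stepPair m b z t (fun _ _ => 1) x y ∂F.mix z t =
      F.stepDiag m b z t (fun _ _ => 1) x := by
  simp only [stepPair, stepDiag]
  rw [integral_const_mul]
  congr 1
  rw [integral_finsetSum _ fun i _ => (BddMeasurable.sum _ fun j _ => ((BddMeasurable.const _).mul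
    (h.bddMeasurable_beta_fixed z t j)).mul (BddMeasurable.const _)).integrable _]
  refine Finset.sum_congr rfl fun i _ => ?_
  rw [integral_finsetSum _ fun j _ => (((BddMeasurable.const _).mul
    (h.bddMeasurable_beta_fixed z t j)).mul (BddMeasurable.const _)).integrable _]
  refine Finset.sum_congr rfl fun j _ => ?_
  rw [integral_mul_const, integral_const_mul, h.integral_beta]

/-- Jensen removes the square over `beta` and reversal turns `beta` into `weight`. Of the four total
weights, one is bounded as a mean, one combines with the weight of `i`, and two with the squared
average `Y i`, giving a factor `G` each. -/
lemma integral_stepDiag_one_sq_le (hN : 2 ≤ N) :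
    (N : ℝ) ^ 3 * ∫ x, F.stepDiag m b z t (fun _ _ => 1) x ^ 2 ∂F.mix z t ≤
      G ^ 4 * F.energy m b z t := by
  have hN0 : (N : ℝ) ≠ 0 := NeZero.ne _
  have hpr := F.isProbabilityMeasure_mix h.pot_pos z t
  set V : Fin N → Fin N → ℝ := fun i j => F.pairSum m b z t i j fun _ _ => 1
  have hV (i j) : 0 ≤ V i j := h.pairSum_nonneg hN z t i j fun _ _ => zero_le_one
  set Y : Fin N → ℝ := fun i => ∑ j, F.weight z t j * V i j
  set Ω := F.totalWeight z t
  have hΩ : 0 ≤ Ω := F.totalWeight_nonneg z t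
  have e1 (x : X) : F.stepDiag m b z t (fun _ _ => 1) x =
      ((N : ℝ)⁻¹ * Ω) ^ 2 * ∑ i, F.beta m z t x i * Y i := by
    simp only [stepDiag, Y, Finset.mul_sum, V, Ω, mul_assoc]
  have e2 (x : X) : F.stepDiag m b z t (fun _ _ => 1) x ^ 2 ≤
      ((N : ℝ)⁻¹ * Ω) ^ 4 * ∑ i, F.beta m z t x i * Y i ^ 2 := by
    rw [e1, mul_pow, ← pow_mul]
    exact mul_le_mul_of_nonneg_left (sq_sum_mul_le _ (fun i _ => h.beta_nonneg z t x i)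
      (h.sum_beta z t x)) (by positivity)
  have b1 := (h.bddMeasurable_stepDiag_fixed (b := b) z t
    (f := fun _ _ => 1) (BddMeasurable.const 1)).pow 2
  have b2 : BddMeasurable fun x => ((N : ℝ)⁻¹ * Ω) ^ 4 * ∑ i, F.beta m z t x i * Y i ^ 2 :=
    (BddMeasurable.const _).mul (BddMeasurable.sum _ fun i _ =>
      (h.bddMeasurable_beta_fixed z t i).mul (BddMeasurable.const _))
  have e3 := integral_mono (b1.integrable (F.mix z t)) (b2.integrable _) e2
  rw [integral_const_mul, h.integral_sum_beta_mul z t fun i => BddMeasurable.const (Y i ^ 2)] at e3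
  simp only [integral_const, probReal_univ, smul_eq_mul, one_mul] at e3
  have e4 (i : Fin N) : Ω * Y i ≤ G * ∑ j, V i j := by
    simp only [Y, Finset.mul_sum, ← mul_assoc]
    exact Finset.sum_le_sum fun j _ => mul_le_mul_of_nonneg_right
      ((h.mean_totalWeight_mul_weight z t j).trans_le (h.pot_le _ _)) (hV i j)
  have e5 (i : Fin N) : 0 ≤ Y i := Finset.sum_nonneg fun j _ =>
    mul_nonneg (F.weight_nonneg _ _ _) (hV i j)
  calc (N : ℝ) ^ 3 * ∫ x, F.stepDiag m b z t (fun _ _ => 1) x ^ 2 ∂F.mix z t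
      ≤ (N : ℝ) ^ 3 * (((N : ℝ)⁻¹ * Ω) ^ 4 * ∑ i, F.weight z t i * Y i ^ 2) := by gcongr
    _ = ((N : ℝ)⁻¹ * Ω) * ∑ i, (Ω * F.weight z t i) * (Ω * Y i) ^ 2 := by
        simp only [Finset.mul_sum]
        refine Finset.sum_congr rfl fun i _ => ?_
        field_simp
    _ ≤ G * ∑ i, G * (G * ∑ j, V i j) ^ 2 := by
        have hG := h.G_nonneg
        have h1 := h.mean_totalWeight_le z t
        refine mul_le_mul h1 (Finset.sum_le_sum fun i _ => ?_) (Finset.sum_nonneg fun i _ =>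
          mul_nonneg (mul_nonneg hΩ (F.weight_nonneg _ _ _)) (sq_nonneg _)) hG
        refine mul_le_mul ((h.mean_totalWeight_mul_weight z t i).trans_le (h.pot_le _ _))
          (pow_le_pow_left₀ (mul_nonneg hΩ (e5 i)) (e4 i) 2) (sq_nonneg _) hG
    _ = G ^ 4 * F.energy m b z t := by
        simp only [energy, Finset.mul_sum, V]
        refine Finset.sum_congr rfl fun i _ => ?_
        rw [← Finset.mul_sum]
        ring

/-- Jensen is applied to both families of backward weights, then reversal. The resulting sum of
squares is at most the square of the row sum because the weights are nonnegative. -/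
lemma integral_stepPair_one_sq_le (hN : 2 ≤ N) :
    (N : ℝ) ^ 2 * ∫ p, Function.uncurry (F.stepPair m b z t fun _ _ => 1) p ^ 2
        ∂(F.mix z t).prod (F.mix z t) ≤ G ^ 4 * F.energy m b z t := by
  have hN0 : (N : ℝ) ≠ 0 := NeZero.ne _
  have hpr := F.isProbabilityMeasure_mix h.pot_pos z t
  have hG := h.G_nonneg
  set V : Fin N → Fin N → ℝ := fun i j => F.pairSum m b z t i j fun _ _ => 1
  have hV (i j) : 0 ≤ V i j := h.pairSum_nonneg hN z t i j fun _ _ => zero_le_one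
  set Ω := F.totalWeight z t
  have hΩ : 0 ≤ Ω := F.totalWeight_nonneg z t
  have e2 (p : X × X) : Function.uncurry (F.stepPair m b z t fun _ _ => 1) p ^ 2 ≤
      ((N : ℝ)⁻¹ * Ω) ^ 4 *
        ∑ i, ∑ j, (F.beta m z t p.1 i * F.beta m z t p.2 j) * V i j ^ 2 := by
    have e1 : Function.uncurry (F.stepPair m b z t fun _ _ => 1) p = ((N : ℝ)⁻¹ * Ω) ^ 2 *
        ∑ i, F.beta m z t p.1 i * ∑ j, F.beta m z t p.2 j * V i j := by
      simp only [Function.uncurry, stepPair, Finset.mul_sum, V, Ω, mul_assoc]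
    rw [e1, mul_pow, ← pow_mul]
    refine mul_le_mul_of_nonneg_left ((sq_sum_mul_le _ (fun i _ => h.beta_nonneg z t _ i)
      (h.sum_beta z t _)).trans (Finset.sum_le_sum fun i _ => ?_)) (by positivity)
    simp only [mul_assoc, ← Finset.mul_sum]
    exact mul_le_mul_of_nonneg_left (sq_sum_mul_le _ (fun i _ => h.beta_nonneg z t _ i)
      (h.sum_beta z t _)) (h.beta_nonneg z t _ i)
  have b1 := (h.bddMeasurable_stepPair_fixed (b := b) z t
    (f := fun _ _ => 1) (BddMeasurable.const 1)).pow 2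
  have b0 (i j : Fin N) : BddMeasurable fun p : X × X =>
      (F.beta m z t p.1 i * F.beta m z t p.2 j) * V i j ^ 2 :=
    (((h.bddMeasurable_beta_fixed z t i).comp measurable_fst).mul
        ((h.bddMeasurable_beta_fixed z t j).comp measurable_snd)).mul (BddMeasurable.const _)
  have b2 : BddMeasurable fun p : X × X => ((N : ℝ)⁻¹ * Ω) ^ 4 *
        ∑ i, ∑ j, (F.beta m z t p.1 i * F.beta m z t p.2 j) * V i j ^ 2 :=
    (BddMeasurable.const _).mul (BddMeasurable.sum _ fun i _ => BddMeasurable.sum _ fun j _ =>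
      b0 i j)
  have e3 := integral_mono (b1.integrable ((F.mix z t).prod (F.mix z t))) (b2.integrable _) e2
  have e4 : ∫ p, ∑ i, ∑ j, (F.beta m z t p.1 i * F.beta m z t p.2 j) * V i j ^ 2
      ∂(F.mix z t).prod (F.mix z t) = ∑ i, ∑ j, (F.weight z t i * F.weight z t j) * V i j ^ 2 := by
    rw [integral_finsetSum _ fun i _ => (BddMeasurable.sum _ fun j _ => b0 i j).integrable _]
    refine Finset.sum_congr rfl fun i _ => ?_
    rw [integral_finsetSum _ fun j _ => (b0 i j).integrable _]
    refine Finset.sum_congr rfl fun j _ => ?_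
    rw [integral_mul_const, integral_prod_mul (fun x => F.beta m z t x i)
      (fun x => F.beta m z t x j), h.integral_beta, h.integral_beta]
  rw [integral_const_mul, e4] at e3
  calc _ ≤ (N : ℝ) ^ 2 * (((N : ℝ)⁻¹ * Ω) ^ 4 *
        ∑ i, ∑ j, (F.weight z t i * F.weight z t j) * V i j ^ 2) := by gcongr
    _ = ((N : ℝ)⁻¹ * Ω) ^ 2 * ∑ i, ∑ j,
        ((Ω * F.weight z t i) * (Ω * F.weight z t j)) * V i j ^ 2 := by
        simp only [Finset.mul_sum]
        refine Finset.sum_congr rfl fun i _ => Finset.sum_congr rfl fun j _ => ?_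
        field_simp
    _ ≤ G ^ 2 * ∑ i, G ^ 2 * (∑ j, V i j) ^ 2 := by
        have h1 := h.mean_totalWeight_le z t
        have h2 (i : Fin N) : Ω * F.weight z t i ≤ G :=
          (h.mean_totalWeight_mul_weight z t i).trans_le (h.pot_le _ _)
        have h3 (i : Fin N) : 0 ≤ Ω * F.weight z t i := mul_nonneg hΩ (F.weight_nonneg _ _ _)
        refine mul_le_mul (pow_le_pow_left₀ (by positivity) h1 2)
          (Finset.sum_le_sum fun i _ => ?_) (Finset.sum_nonneg fun i _ => Finset.sum_nonneg
            fun j _ => mul_nonneg (mul_nonneg (h3 i) (h3 j)) (sq_nonneg _)) (by positivity)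
        calc _ ≤ ∑ j, G ^ 2 * V i j ^ 2 := Finset.sum_le_sum fun j _ => by
              refine mul_le_mul_of_nonneg_right ?_ (sq_nonneg _)
              rw [pow_two]
              exact mul_le_mul (h2 i) (h2 j) (h3 j) hG
          _ ≤ _ := by
              rw [← Finset.mul_sum]
              exact mul_le_mul_of_nonneg_left
                (Finset.sum_sq_le_sq_sum_of_nonneg fun j _ => hV i j) (by positivity)
    _ = _ := by
        simp only [energy, Finset.mul_sum, V]
        refine Finset.sum_congr rfl fun i _ => ?_
        ring

/-- Without coalescence `(N / (N - 1)) ^ 2 ≤ 4`, and the second moment of the row sums has two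
parts, each at most `G ^ 4` times the current energy; hence 8. The coalescing case only needs the
constant 1. -/
lemma integral_energyStep_le (hN : 2 ≤ N) :
    ∫ y, F.energyStep m b z t y ∂Measure.pi (fun _ : Fin N => F.mix z t) ≤
      8 * G ^ 4 * F.energy m b z t := by
  have hpr := F.isProbabilityMeasure_mix h.pot_pos z t
  have hE : 0 ≤ G ^ 4 * F.energy m b z t := mul_nonneg (pow_nonneg h.G_nonneg 4)
    (Finset.sum_nonneg fun _ _ => sq_nonneg _)
  have h1 := h.integral_stepDiag_one_sq_le (b := b) z t hN
  have h2 := h.integral_stepPair_one_sq_le (b := b) z t hN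
  unfold energyStep
  split_ifs
  · rw [integral_const_mul, integral_sum_eval_pi _ ((h.bddMeasurable_stepDiag_fixed z t
      (f := fun _ _ => 1) (BddMeasurable.const 1)).pow 2)]
    calc _ = (N : ℝ) ^ 3 * ∫ x, F.stepDiag m b z t (fun _ _ => 1) x ^ 2 ∂F.mix z t := by ring
      _ ≤ _ := by linarith
  · rw [integral_const_mul]
    have h3 := integral_sum_rowSum_sq_le (N := N) (F.mix z t)
      (h.bddMeasurable_stepPair_fixed (b := b) z t (f := fun _ _ => 1) (BddMeasurable.const 1))
    simp_rw [h.integral_stepPair_one z t] at h3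
    have h4 : ((N : ℝ) / ((N : ℝ) - 1)) ^ 2 ≤ 4 := by
      have := pow_le_pow_left₀ (coalFactor_nonneg hN false) (div_sub_one_le_two hN) 2
      norm_num at this ⊢
      exact this
    calc _ ≤ 4 * (2 * (G ^ 4 * F.energy m b z t)) := by
          refine mul_le_mul h4 (by linarith) (integral_nonneg fun y =>
            Finset.sum_nonneg fun _ _ => sq_nonneg _) (by norm_num)
      _ = _ := by ring

/-- After centring by the conditional mean, the i.i.d. variance bounds apply. The test function then
enters only through `K`, so the bound reduces to the weights of the constant function, that is, to
the energy. -/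
lemma integral_stepBS_sub_sq_le (hN : 2 ≤ N) {f : Path X (t + 1) → Path X (t + 1) → ℝ}
    (hf : BddMeasurable (Function.uncurry f)) {K : ℝ} (hK : ∀ p q, |f p q| ≤ K) :
    ∫ y, (F.stepBS m b z t f y - F.muBS m z b t (F.pairPush (b (t + 1)) f)) ^ 2
        ∂Measure.pi (fun _ : Fin N => F.mix z t) ≤
      4 * K ^ 2 * ∫ y, F.energyStep m b z t y ∂Measure.pi (fun _ : Fin N => F.mix z t) := by
  have hpr := F.isProbabilityMeasure_mix h.pot_pos z t
  have hN0 : (N : ℝ) ≠ 0 := NeZero.ne _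
  have hmean := h.integral_stepBS (b := b) z t hN hf
  have b1 : BddMeasurable (F.stepDiag m b z t fun _ _ => 1) :=
    h.bddMeasurable_stepDiag_fixed z t (f := fun _ _ => 1) (BddMeasurable.const 1)
  have b2 : BddMeasurable (Function.uncurry (F.stepPair m b z t fun _ _ => 1)) :=
    h.bddMeasurable_stepPair_fixed z t (f := fun _ _ => 1) (BddMeasurable.const 1)
  rw [← hmean]
  unfold stepBS energyStep
  split_ifs
  · rw [integral_const_mul, integral_sum_eval_pi _ (h.bddMeasurable_stepDiag_fixed z t hf),
      integral_const_mul, integral_sum_eval_pi _ (b1.pow 2)]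
    have e (y : Fin N → X) : ((N : ℝ) * ∑ k, F.stepDiag m b z t f (y k) -
        N * (N * ∫ x, F.stepDiag m b z t f x ∂F.mix z t)) ^ 2 = (N : ℝ) ^ 2 *
        (∑ k, F.stepDiag m b z t f (y k) - N * ∫ x, F.stepDiag m b z t f x ∂F.mix z t) ^ 2 := by
      ring
    simp_rw [e]
    rw [integral_const_mul]
    have h1 := integral_sum_eval_pi_sub_sq_le (N := N) (F.mix z t)
      (h.bddMeasurable_stepDiag_fixed (b := b) z t hf)
    have h2 : ∫ x, F.stepDiag m b z t f x ^ 2 ∂F.mix z t ≤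
        K ^ 2 * ∫ x, F.stepDiag m b z t (fun _ _ => 1) x ^ 2 ∂F.mix z t := by
      rw [← integral_const_mul]
      refine integral_mono (((h.bddMeasurable_stepDiag_fixed z t hf).pow 2).integrable _)
        (((BddMeasurable.const _).mul (b1.pow 2)).integrable _) fun x => ?_
      simp only
      rw [← mul_pow, ← sq_abs (F.stepDiag m b z t f x)]
      exact pow_le_pow_left₀ (abs_nonneg _) (h.abs_stepDiag_le z t hN hK x) 2
    have h3 : 0 ≤ ∫ x, F.stepDiag m b z t (fun _ _ => 1) x ^ 2 ∂F.mix z t :=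
      integral_nonneg fun _ => sq_nonneg _
    calc _ ≤ (N : ℝ) ^ 2 * (N * (K ^ 2 *
          ∫ x, F.stepDiag m b z t (fun _ _ => 1) x ^ 2 ∂F.mix z t)) := by gcongr; linarith [mul_le_mul_of_nonneg_left h2 (Nat.cast_nonneg (α := ℝ) N)]
      _ = 1 * (K ^ 2 * ((N : ℝ) ^ 2 * (N *
          ∫ x, F.stepDiag m b z t (fun _ _ => 1) x ^ 2 ∂F.mix z t))) := by ring
      _ ≤ 4 * (K ^ 2 * ((N : ℝ) ^ 2 * (N *
          ∫ x, F.stepDiag m b z t (fun _ _ => 1) x ^ 2 ∂F.mix z t))) :=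
          mul_le_mul_of_nonneg_right (by norm_num) (by positivity)
      _ = _ := by ring
  · rw [integral_const_mul, integral_offSum _ (h.bddMeasurable_stepPair_fixed z t hf),
      integral_const_mul]
    set θ := ∫ p, Function.uncurry (F.stepPair m b z t f) p ∂(F.mix z t).prod (F.mix z t)
    have e (y : Fin N → X) : ((N : ℝ) / (N - 1) * offSum (F.stepPair m b z t f) y -
        N / (N - 1) * (N * (N - 1) * θ)) ^ 2 = ((N : ℝ) / (N - 1)) ^ 2 *
        (offSum (F.stepPair m b z t f) y - N * (N - 1) * θ) ^ 2 := by ring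
    simp_rw [e]
    rw [integral_const_mul]
    have h1 := integral_offSum_sub_sq_le (N := N) (F.mix z t)
      (h.bddMeasurable_stepPair_fixed (b := b) z t hf)
      (H := fun x y => K * F.stepPair m b z t (fun _ _ => 1) x y)
      (BddMeasurable.mul (BddMeasurable.const K) b2)
      (h.abs_stepPair_le z t hN hK) fun x y => by rw [stepPair_one_symm]
    simp_rw [rowSum_const_mul, mul_pow, ← Finset.mul_sum] at h1
    rw [integral_const_mul] at h1
    calc _ ≤ ((N : ℝ) / (N - 1)) ^ 2 * (4 * (K ^ 2 * _)) :=
          mul_le_mul_of_nonneg_left h1 (sq_nonneg _)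
      _ = _ := by ring

end OneStep

/-- Every row of initial weights has mass at most `2 / N`, and there are `N` rows. -/
lemma energy_zero_le (hN : 2 ≤ N) (z : Cloud X N) : F.energy m b z 0 ≤ 4 / N := by
  have hN' : (0 : ℝ) < N := by positivity
  have h2 := div_sub_one_le_two hN
  have h0 := coalFactor_nonneg hN
  have hrow (k : Fin N) : ∑ l, F.pairSum m b z 0 k l (fun _ _ => 1) ≤ 2 / N := by
    simp only [pairSum, mul_one]
    cases hb : b 0
    · have hle (l : Fin N) : coalFactor N false * (if (k = l ↔ false = true) then 1 else 0) *
          (N : ℝ)⁻¹ ^ 2 ≤ 2 * 1 * (N : ℝ)⁻¹ ^ 2 := by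
        have := h0 false
        simp only [coalFactor, Bool.false_eq_true, if_false] at this ⊢
        gcongr
        split_ifs <;> norm_num
      refine (Finset.sum_le_sum fun l _ => hle l).trans (le_of_eq ?_)
      · rw [Finset.sum_const, Finset.card_univ, Fintype.card_fin, nsmul_eq_mul]
        field_simp
    · simp only [coalFactor, iff_true, if_true, mul_ite, mul_one, mul_zero, ite_mul, zero_mul,
        Finset.sum_ite_eq, Finset.mem_univ]
      rw [div_eq_mul_inv, pow_two, mul_inv_cancel_left₀ hN'.ne']
      have : 0 < (N : ℝ)⁻¹ := by positivity
      linarith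
  have hrow0 (k : Fin N) : 0 ≤ ∑ l, F.pairSum m b z 0 k l (fun _ _ => 1) :=
    Finset.sum_nonneg fun l _ => h.pairSum_nonneg hN z 0 k l fun _ _ => zero_le_one
  calc F.energy m b z 0 ≤ ∑ _k : Fin N, (2 / (N : ℝ)) ^ 2 :=
        Finset.sum_le_sum fun k _ => pow_le_pow_left₀ (hrow0 k) (hrow k) 2
    _ = 4 / N := by simp; field_simp; norm_num

/-- The energy is multiplied in mean by at most a constant at every generation, so it stays of order
1/N at each fixed time. -/
lemma integral_energy_le (hN : 2 ≤ N) {L : Measure (Cloud X N)} (hL : F.IsParticleLaw L) (t : ℕ) :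
    ∫ z, F.energy m b z t ∂L ≤ (8 * G ^ 4) ^ t * (4 / N) := by
  have : NeZero N := ⟨by omega⟩
  have hp := hL.prob
  induction t with
  | zero =>
    calc _ ≤ ∫ _z, 4 / (N : ℝ) ∂L := integral_mono ((h.bddMeasurable_energy 0).integrable _)
          (integrable_const _) fun z => h.energy_zero_le hN z
      _ = _ := by simp
  | succ t ih =>
    simp_rw [energy_succ]
    rw [hL.step t (fun z y => F.energyStep m b z t y) (h.bddMeasurable_energyStep t)
      fun z z' y hz => energyStep_congr hz y]
    calc _ ≤ ∫ z, 8 * G ^ 4 * F.energy m b z t ∂L := by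
          refine integral_mono ?_ ((h.bddMeasurable_energy t).integrable _ |>.const_mul _)
            fun z => h.integral_energyStep_le z t hN
          exact (BddMeasurable.integral_kernel (κ := F.moveKer h.pot_pos t)
            (f := fun (z : Cloud X N) y => F.energyStep m b z t y)
            (h.bddMeasurable_energyStep t)).integrable L
      _ = 8 * G ^ 4 * ∫ z, F.energy m b z t ∂L := integral_const_mul _ _
      _ ≤ 8 * G ^ 4 * ((8 * G ^ 4) ^ t * (4 / N)) := by
          have := h.G_nonneg
          gcongr
      _ = _ := by ring

lemma integral_muBS_zero_sub_sq_le (hN : 2 ≤ N) {L : Measure (Cloud X N)}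
    (hL : F.IsParticleLaw L) {f : Path X 0 → Path X 0 → ℝ} (hf : BddMeasurable (Function.uncurry f))
    {K : ℝ} (hK : ∀ p q, |f p q| ≤ K) :
    ∫ z, (F.muBS m z b 0 f - F.muInt b 0 f) ^ 2 ∂L ≤ 16 * K ^ 2 / N := by
  have hN' : (0 : ℝ) < N := by positivity
  have hN2 : (2 : ℝ) ≤ N := by exact_mod_cast hN
  have hN1 : (N : ℝ) - 1 ≠ 0 := by linarith
  -- On an empty space the bound `K` could be negative; later an actual sample rules this case out.
  have hK0 : 0 ≤ K ∨ IsEmpty X := by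
    rcases isEmpty_or_nonempty X with hX | ⟨⟨x⟩⟩
    · exact Or.inr hX
    · exact Or.inl ((abs_nonneg _).trans (hK (fun _ => x) (fun _ => x)))
  set D : X → X → ℝ := fun x y => f (fun _ => x) (fun _ => y)
  have hD : BddMeasurable (Function.uncurry D) :=
    hf.comp (φ := fun x : X × X => ((fun _ => x.1 : Path X 0), (fun _ => x.2 : Path X 0)))
      (by fun_prop)
  have hD1 : BddMeasurable fun x => D x x := hD.comp (measurable_id.prodMk measurable_id)
  rw [F.muInt_zero h.pot_le b hf]
  cases hb : b 0
  · have e (z : Cloud X N) : F.muBS m z b 0 f =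
        (N : ℝ) / (N - 1) * (N : ℝ)⁻¹ ^ 2 * offSum D (z 0) := by
      rw [muBS_eq_sum_pairSum, offSum]
      simp only [pairSum, coalFactor, hb, Finset.mul_sum]
      refine Finset.sum_congr rfl fun k _ => Finset.sum_congr rfl fun l _ => ?_
      by_cases hkl : k = l <;> simp [hkl, D]
    simp_rw [e, cond_false]
    set c := (N : ℝ) / (N - 1) * (N : ℝ)⁻¹ ^ 2
    rw [hL.integral_zero (f := fun y => (c * offSum D y -
        ∫ x, ∫ x', f (fun _ => x) (fun _ => x') ∂F.init ∂F.init) ^ 2)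
        ((((BddMeasurable.const _).mul hD.offSum).sub (BddMeasurable.const _)).pow 2)]
    have e2 : ∫ x, ∫ x', f (fun _ => x) (fun _ => x') ∂F.init ∂F.init =
        ∫ p, Function.uncurry D p ∂F.init.prod F.init :=
      (integral_prod _ (hD.integrable _)).symm
    rw [e2]
    set θ := ∫ p, Function.uncurry D p ∂F.init.prod F.init
    have hc : c * (N * (N - 1)) = 1 := by simp only [c]; field_simp
    have e3 (y : Fin N → X) : (c * offSum D y - θ) ^ 2 =
        c ^ 2 * (offSum D y - N * (N - 1) * θ) ^ 2 := by
      have : c * offSum D y - θ = c * (offSum D y - N * (N - 1) * θ) := by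
        rw [mul_sub, ← mul_assoc, hc, one_mul]
      rw [this]; ring
    simp_rw [e3]
    rw [integral_const_mul]
    have h1 := integral_offSum_sub_sq_le (N := N) F.init hD (H := fun _ _ => K)
      (BddMeasurable.const K) (fun x y => hK _ _) fun _ _ => rfl
    have h2 (y : Fin N → X) : ∑ k, rowSum (fun _ _ => K) y k ^ 2 ≤ N * (N * K) ^ 2 := by
      have hK0 : 0 ≤ K := by
        rcases hK0 with h | h
        · exact h
        · exact (h.false (y ⟨0, by omega⟩)).elim
      have : ∀ k : Fin N, rowSum (fun _ _ => K) y k ^ 2 ≤ (N * K) ^ 2 := fun k => by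
        refine pow_le_pow_left₀ (Finset.sum_nonneg fun l _ => by split_ifs <;> simp [hK0]) ?_ 2
        calc rowSum (fun _ _ => K) y k ≤ ∑ _l : Fin N, K :=
              Finset.sum_le_sum fun l _ => by split_ifs <;> simp [hK0]
          _ = N * K := by simp
      calc _ ≤ ∑ _k : Fin N, ((N : ℝ) * K) ^ 2 := Finset.sum_le_sum fun k _ => this k
        _ = _ := by simp
    have h3 : ∫ y, ∑ k, rowSum (fun _ _ => K) y k ^ 2 ∂(Measure.pi fun _ : Fin N => F.init) ≤
        N * (N * K) ^ 2 := by
      have := integral_mono (μ := Measure.pi fun _ : Fin N => F.init)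
        (f := fun y => ∑ k, rowSum (fun _ _ : X => K) y k ^ 2)
        ((BddMeasurable.sum _ fun k _ => (BddMeasurable.rowSum (F := fun _ _ : X => K)
          (BddMeasurable.const K) k).pow 2).integrable _)
        (integrable_const ((N : ℝ) * (N * K) ^ 2)) h2
      simpa using this
    have h4 : ((N : ℝ) / ((N : ℝ) - 1)) ^ 2 ≤ 4 := by
      have := pow_le_pow_left₀ (coalFactor_nonneg hN false) (div_sub_one_le_two hN) 2
      norm_num at this ⊢
      exact this
    calc _ ≤ c ^ 2 * (4 * (N * (N * K) ^ 2)) := by gcongr; linarith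
      _ = ((N : ℝ) / ((N : ℝ) - 1)) ^ 2 * (4 * K ^ 2 / N) := by simp only [c]; field_simp
      _ ≤ 4 * (4 * K ^ 2 / N) := by gcongr
      _ = _ := by ring
  · have e (z : Cloud X N) : F.muBS m z b 0 f = (N : ℝ)⁻¹ * ∑ k, D (z 0 k) (z 0 k) := by
      rw [muBS_eq_sum_pairSum]
      simp [pairSum, coalFactor, hb, Finset.mul_sum, D]
      refine Finset.sum_congr rfl fun k _ => ?_
      field_simp
    simp_rw [e, cond_true]
    rw [hL.integral_zero (f := fun y => ((N : ℝ)⁻¹ * ∑ k, D (y k) (y k) -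
        ∫ x, f (fun _ => x) (fun _ => x) ∂F.init) ^ 2)
        ((((BddMeasurable.const _).mul (BddMeasurable.sum _ fun k _ =>
          hD1.comp (measurable_pi_apply k))).sub (BddMeasurable.const _)).pow 2)]
    have e3 (y : Fin N → X) : ((N : ℝ)⁻¹ * ∑ k, D (y k) (y k) -
        ∫ x, f (fun _ => x) (fun _ => x) ∂F.init) ^ 2 =
        (N : ℝ)⁻¹ ^ 2 * (∑ k, D (y k) (y k) - N * ∫ x, D x x ∂F.init) ^ 2 := by
      simp only [D]; field_simp
    simp_rw [e3]
    rw [integral_const_mul]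
    have h2 : ∫ x, D x x ^ 2 ∂F.init ≤ K ^ 2 := by
      calc ∫ x, D x x ^ 2 ∂F.init ≤ ∫ _x, K ^ 2 ∂F.init :=
            integral_mono ((hD1.pow 2).integrable _) (integrable_const _) fun x => by
              simp only
              rw [← sq_abs]
              exact pow_le_pow_left₀ (abs_nonneg _) (hK _ _) 2
        _ = K ^ 2 := by simp
    have h3 := (integral_sum_eval_pi_sub_sq_le (N := N) F.init hD1).trans
      (mul_le_mul_of_nonneg_left h2 hN'.le)
    calc _ ≤ (N : ℝ)⁻¹ ^ 2 * (N * K ^ 2) := by gcongr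
      _ = 1 * (K ^ 2 / N) := by field_simp
      _ ≤ 16 * (K ^ 2 / N) := mul_le_mul_of_nonneg_right (by norm_num) (by positivity)
      _ = _ := by ring

/-- The estimators `μ^BS_{b,t}(f)` converge in `L²` to `μ_{b,t}(f)`. -/
theorem exists_integral_muBS_sub_sq_le (b : ℕ → Bool) (t : ℕ) {f : Path X t → Path X t → ℝ}
    (hf : BddMeasurable (Function.uncurry f)) :
    ∃ C : ℝ, ∀ (N : ℕ) (L : Measure (Cloud X N)), 2 ≤ N → F.IsParticleLaw L →
      ∫ z, (F.muBS m z b t f - F.muInt b t f) ^ 2 ∂L ≤ C / N := by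
  induction t with
  | zero =>
    obtain ⟨K, hK⟩ := hf.2
    exact ⟨16 * K ^ 2, fun N L hN hL =>
      h.integral_muBS_zero_sub_sq_le hN hL hf fun p q => hK (p, q)⟩
  | succ t ih =>
    obtain ⟨K, hK⟩ := hf.2
    have hpush := F.bddMeasurable_pairPush h.pot_le (b (t + 1)) hf
    obtain ⟨C, hC⟩ := ih hpush
    -- The first part is the conditional variance of the last generation, bounded through the mean
    -- energy at time `t + 1`; the second is the inductive error on `pairPush`.
    refine ⟨2 * (4 * K ^ 2 * ((8 * G ^ 4) ^ (t + 1) * 4)) + 2 * C, fun N L hN hL => ?_⟩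
    have : NeZero N := ⟨by omega⟩
    have hp := hL.prob
    set g := F.pairPush (b (t + 1)) f
    rw [F.muInt_succ h.pot_le b hf]
    have m1 := h.bddMeasurable_muBS (N := N) (b := b) (t + 1) (f := fun _ => f) hf.of_const_cloud
    have m2 := h.bddMeasurable_muBS (N := N) (b := b) t (f := fun _ => g) hpush.of_const_cloud
    have key : ∫ z, (F.muBS m z b (t + 1) f - F.muBS m z b t g) ^ 2 ∂L ≤
        4 * K ^ 2 * ((8 * G ^ 4) ^ (t + 1) * (4 / N)) := by
      simp_rw [muBS_succ]
      have mm : BddMeasurable (Function.uncurry fun (z : Cloud X N) y =>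
          (F.stepBS m b z t f y - F.muBS m z b t g) ^ 2) :=
        ((h.bddMeasurable_stepBS (f := fun _ => f) hf.of_const_cloud).sub
          (m2.comp measurable_fst)).pow 2
      rw [hL.step t (fun z y => (F.stepBS m b z t f y - F.muBS m z b t g) ^ 2) mm
        fun z z' y hz => by rw [stepBS_congr hz, muBS_congr_cloud hz]]
      -- The unconditional bound on the energy is rewritten as a bound on the mean of its
      -- conditional mean, the form in which it dominates the conditional variance.
      have h1 := h.integral_energy_le (b := b) hN hL (t + 1)
      simp_rw [energy_succ] at h1
      rw [hL.step t (fun z y => F.energyStep m b z t y) (h.bddMeasurable_energyStep t)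
        fun z z' y hz => energyStep_congr hz y] at h1
      calc _ ≤ ∫ z, 4 * K ^ 2 * ∫ y, F.energyStep m b z t y
            ∂Measure.pi (fun _ : Fin N => F.mix z t) ∂L := by
            refine integral_mono ?_ ?_ fun z => h.integral_stepBS_sub_sq_le z t hN hf
              fun p q => hK (p, q)
            · exact (BddMeasurable.integral_kernel (κ := F.moveKer h.pot_pos t)
                (f := fun (z : Cloud X N) y => (F.stepBS m b z t f y - F.muBS m z b t g) ^ 2)
                mm).integrable L
            · exact ((BddMeasurable.integral_kernel (κ := F.moveKer h.pot_pos t)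
                (f := fun (z : Cloud X N) y => F.energyStep m b z t y)
                (h.bddMeasurable_energyStep t)).integrable L).const_mul _
        _ = 4 * K ^ 2 * _ := integral_const_mul _ _
        _ ≤ _ := mul_le_mul_of_nonneg_left h1 (by positivity)
    have b1 : BddMeasurable fun z : Cloud X N =>
        (F.muBS m z b (t + 1) f - F.muBS m z b t g) ^ 2 := (m1.sub m2).pow 2
    have b2 : BddMeasurable fun z : Cloud X N => (F.muBS m z b t g - F.muInt b t g) ^ 2 :=
      (m2.sub (BddMeasurable.const _)).pow 2
    have b3 : BddMeasurable fun z : Cloud X N => (F.muBS m z b (t + 1) f - F.muInt b t g) ^ 2 :=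
      (m1.sub (BddMeasurable.const _)).pow 2
    calc ∫ z, (F.muBS m z b (t + 1) f - F.muInt b t g) ^ 2 ∂L
        ≤ ∫ z, (2 * (F.muBS m z b (t + 1) f - F.muBS m z b t g) ^ 2 +
            2 * (F.muBS m z b t g - F.muInt b t g) ^ 2) ∂L := by
          refine integral_mono (b3.integrable _) ((((BddMeasurable.const 2).mul b1).add
            ((BddMeasurable.const 2).mul b2)).integrable _) fun z => ?_
          simp only
          nlinarith [sq_nonneg ((F.muBS m z b (t + 1) f - F.muBS m z b t g) -
            (F.muBS m z b t g - F.muInt b t g))]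
      _ ≤ 2 * (4 * K ^ 2 * ((8 * G ^ 4) ^ (t + 1) * (4 / N))) + 2 * (C / N) := by
          rw [integral_add (((BddMeasurable.const 2).mul b1).integrable _)
            (((BddMeasurable.const 2).mul b2).integrable _), integral_const_mul,
            integral_const_mul]
          have := hC N L hN hL
          gcongr
      _ = _ := by ring

end IsDominated

end FeynmanKac

end FFBS

/-! ### Additive functionals and backward kernels -/

namespace FFBS

section Additive

variable {X : Type*}

/-- The point `x_s` of a path `x_{0:t}`, and `x_t` if `s > t`. -/
def pointOr {t : ℕ} (p : Path X t) (s : ℕ) : X := if h : s ≤ t then point p s h else last p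

lemma pointOr_of_le {t s : ℕ} (p : Path X t) (h : s ≤ t) : pointOr p s = point p s h :=
  dif_pos h

/-- With the total evaluation `pointOr` the sum no longer carries membership proofs, and the
splitting lemmas for intervals apply. -/
lemma additive_eq_sum_Ico (q : ℕ → X → X → ℝ) (s t : ℕ) (p : Path X t) :
    additive q s t p = ∑ ℓ ∈ Finset.Ico s t, q ℓ (pointOr p ℓ) (pointOr p (ℓ + 1)) := by
  rw [← Finset.sum_coe_sort]
  refine Finset.sum_congr rfl fun ℓ _ => ?_
  have := Finset.mem_Ico.1 ℓ.2
  rw [pointOr_of_le p this.2.le, pointOr_of_le p this.2]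

lemma additive_self (q : ℕ → X → X → ℝ) (s : ℕ) (p : Path X s) : additive q s s p = 0 := by
  simp [additive_eq_sum_Ico]

lemma additive_snoc (q : ℕ → X → X → ℝ) {s t : ℕ} (hst : s ≤ t) (p : Path X t) (y : X) :
    additive q s (t + 1) (snoc p y) = additive q s t p + q t (last p) y := by
  rw [additive_eq_sum_Ico, additive_eq_sum_Ico, Finset.sum_Ico_succ_top hst,
    pointOr_of_le _ (Nat.le_succ t), pointOr_of_le _ le_rfl, point_snoc p y le_rfl, point_self,
    point_self, last_snoc]
  congr 1
  refine Finset.sum_congr rfl fun ℓ hℓ => ?_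
  have := (Finset.mem_Ico.1 hℓ).2
  rw [pointOr_of_le _ (this.le.trans (Nat.le_succ t)), pointOr_of_le _ (show ℓ + 1 ≤ t + 1 by omega),
    point_snoc p y this.le, point_snoc p y this, pointOr_of_le p this.le, pointOr_of_le p this]

lemma bddMeasurable_additive [MeasurableSpace X] {q : ℕ → X → X → ℝ} {s t : ℕ}
    (hq : ∀ ℓ < t, BddMeasurable (Function.uncurry (q ℓ))) :
    BddMeasurable (additive q s t : Path X t → ℝ) := by
  refine BddMeasurable.sum _ fun ℓ _ => ?_
  have := Finset.mem_Ico.1 ℓ.2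
  exact (hq ℓ this.2).comp ((measurable_point this.2.le).prodMk (measurable_point this.2))

end Additive

lemma integral_pos_of_pos {E : Type*} [MeasurableSpace E] {μ : Measure E} [IsProbabilityMeasure μ]
    {f : E → ℝ} (hf : BddMeasurable f) (h0 : ∀ x, 0 < f x) : 0 < ∫ x, f x ∂μ := by
  rw [integral_pos_iff_support_of_nonneg (fun x => (h0 x).le) (hf.integrable μ)]
  have : Function.support f = Set.univ := Set.eq_univ_of_forall fun x => (h0 x).ne'
  simp [this]

namespace FeynmanKac

variable {X : Type*} [MeasurableSpace X] {F : FeynmanKac X} {m : ℕ → X → X → ℝ}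

namespace IsDominated

variable {ν : Measure X} {G σ : ℝ} (h : F.IsDominated ν m G σ)

include h

/-- Positivity goes backwards in time: a positive function is pushed to a positive one, and at time
0 the measure is a probability. -/
lemma integral_marg_pos (t : ℕ) {f : X → ℝ} (hf : BddMeasurable f) (h0 : ∀ x, 0 < f x) :
    0 < ∫ x, f x ∂F.marg t := by
  induction t generalizing f with
  | zero =>
    rw [F.integral_marg_zero h.pot_le hf]
    exact integral_pos_of_pos hf h0
  | succ t ih =>
    rw [F.integral_marg_succ h.pot_le t hf]
    exact ih (F.bddMeasurable_pushFun h.pot_le t hf) fun x =>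
      mul_pos (h.pot_pos t x) (integral_pos_of_pos hf h0)

lemma bddMeasurable_pot (t : ℕ) : BddMeasurable (F.pot t) := F.bddMeasurable_pot h.pot_le t

lemma integral_pred (t : ℕ) (f : X → ℝ) :
    ∫ x, f x ∂F.pred t = (∫ _, 1 ∂F.marg t)⁻¹ * ∫ x, f x ∂F.marg t := by
  have := F.isFiniteMeasure_marg h.pot_le t
  rw [pred, integral_smul_measure, integral_const, smul_eq_mul, smul_eq_mul, mul_one,
    ENNReal.toReal_inv, measureReal_def]

lemma isProbabilityMeasure_pred (t : ℕ) : IsProbabilityMeasure (F.pred t) := by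
  have := F.isFiniteMeasure_marg h.pot_le t
  have h0 : F.marg t Set.univ ≠ 0 := by
    intro h0
    have := h.integral_marg_pos t (BddMeasurable.const 1) fun _ => one_pos
    simp [measureReal_def, h0] at this
  exact ⟨by rw [pred, Measure.smul_apply, smul_eq_mul,
    ENNReal.inv_mul_cancel h0 (measure_ne_top _ _)]⟩

lemma integral_pot_pred_pos (t : ℕ) : 0 < ∫ x, F.pot t x ∂F.pred t := by
  have := h.isProbabilityMeasure_pred t
  exact integral_pos_of_pos (h.bddMeasurable_pot t) (h.pot_pos t)

lemma isProbabilityMeasure_filt (t : ℕ) : IsProbabilityMeasure (F.filt t) := by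
  have := h.isProbabilityMeasure_pred t
  have hp := h.integral_pot_pred_pos t
  refine ⟨?_⟩
  rw [filt, withDensity_apply _ MeasurableSet.univ, Measure.restrict_univ,
    ← ofReal_integral_eq_lintegral_ofReal (((h.bddMeasurable_pot t).integrable _).div_const _)
      (ae_of_all _ fun x => div_nonneg (F.pot_nonneg t x) hp.le), integral_div, div_self hp.ne',
    ENNReal.ofReal_one]

/-- The normalization of the predictive law cancels in the ratio, leaving unnormalized marginals,
for which there are unbiased particle estimates. -/
lemma integral_filt (t : ℕ) (f : X → ℝ) :
    ∫ x, f x ∂F.filt t = (∫ x, F.pot t x * f x ∂F.marg t) / ∫ x, F.pot t x ∂F.marg t := by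
  have hp := h.integral_pot_pred_pos t
  have h1 := (h.integral_marg_pos t (BddMeasurable.const 1) fun _ => one_pos).ne'
  rw [filt, integral_withDensity_eq_integral_toReal_smul
    (((F.pot_measurable t).div_const _).ennreal_ofReal)
    (ae_of_all _ fun _ => ENNReal.ofReal_lt_top)]
  simp_rw [ENNReal.toReal_ofReal (div_nonneg (F.pot_nonneg t _) hp.le), smul_eq_mul,
    div_mul_eq_mul_div]
  rw [integral_div, h.integral_pred, h.integral_pred]
  field_simp

lemma bddMeasurable_dens_left (s : ℕ) (x : X) : BddMeasurable fun y => m (s + 1) y x :=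
  (h.bddMeasurable_dens s).comp (φ := fun y => (y, x)) (by fun_prop)

lemma integral_dens_filt_pos (s : ℕ) (x : X) : 0 < ∫ y, m (s + 1) y x ∂F.filt s := by
  have := h.isProbabilityMeasure_filt s
  exact integral_pos_of_pos (h.bddMeasurable_dens_left s x) fun y => h.dens_pos s y x

lemma measurable_bwKer_density (s : ℕ) : Measurable (Function.uncurry fun x' x =>
    ENNReal.ofReal (m (s + 1) x x' / ∫ y, m (s + 1) y x' ∂F.filt s)) := by
  have h1 : Measurable fun p : X × X => m (s + 1) p.2 p.1 :=
    (h.measurable_dens s).comp measurable_swap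
  have h2 : Measurable fun x' => ∫ y, m (s + 1) y x' ∂F.filt s :=
    (StronglyMeasurable.integral_prod_right (f := fun x' y => m (s + 1) y x')
      h1.stronglyMeasurable).measurable
  exact (h1.div (h2.comp measurable_fst)).ennreal_ofReal

lemma integral_bwKer (s : ℕ) (x : X) (f : X → ℝ) :
    ∫ y, f y ∂F.bwKer m s x =
      (∫ y, m (s + 1) y x * f y ∂F.filt s) / ∫ y, m (s + 1) y x ∂F.filt s := by
  rw [bwKer, Kernel.withDensity_apply _ (h.measurable_bwKer_density s), Kernel.const_apply,
    integral_withDensity_eq_integral_toReal_smul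
      (((h.bddMeasurable_dens_left s x).1.div_const _).ennreal_ofReal)
      (ae_of_all _ fun _ => ENNReal.ofReal_lt_top)]
  simp_rw [ENNReal.toReal_ofReal (div_nonneg (h.dens_pos s _ x).le
    (h.integral_dens_filt_pos s x).le), smul_eq_mul, div_mul_eq_mul_div]
  rw [integral_div]

lemma isMarkovKernel_bwKer (s : ℕ) : IsMarkovKernel (F.bwKer m s) := by
  have := h.isProbabilityMeasure_filt s
  refine ⟨fun x => ⟨?_⟩⟩
  have hp := h.integral_dens_filt_pos s x
  rw [bwKer, Kernel.withDensity_apply _ (h.measurable_bwKer_density s), Kernel.const_apply,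
    withDensity_apply _ MeasurableSet.univ, Measure.restrict_univ,
    ← ofReal_integral_eq_lintegral_ofReal
      (((h.bddMeasurable_dens_left s x).integrable _).div_const _)
      (ae_of_all _ fun y => div_nonneg (h.dens_pos s y x).le hp.le), integral_div, div_self hp.ne',
    ENNReal.ofReal_one]

/-- The defining property of the backward kernel. -/
lemma integral_pot_mul_dens_mul_sub_bwKer (s : ℕ) (x : X) {f : X → ℝ} (hf : BddMeasurable f) :
    ∫ y, F.pot s y * (m (s + 1) y x * (f y - ∫ y', f y' ∂F.bwKer m s x)) ∂F.marg s = 0 := by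
  have := F.isFiniteMeasure_marg h.pot_le s
  have hg := h.integral_marg_pos s (h.bddMeasurable_pot s) (h.pot_pos s)
  have hp := h.integral_dens_filt_pos s x
  have hb := (h.bddMeasurable_pot s).mul (h.bddMeasurable_dens_left s x)
  rw [h.integral_bwKer]
  rw [h.integral_filt] at hp
  rw [h.integral_filt, h.integral_filt]
  have hp' := (div_pos_iff_of_pos_right hg).1 hp
  simp_rw [mul_sub, ← mul_assoc]
  rw [integral_sub ((hb.mul hf).integrable _) ((hb.mul (BddMeasurable.const _)).integrable _),
    integral_mul_const]
  field_simp
  ring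

lemma isMarkovKernel_bwPath (t : ℕ) : IsMarkovKernel (F.bwPath m t) := by
  induction t with
  | zero => unfold bwPath; infer_instance
  | succ t ih =>
    have := h.isMarkovKernel_bwKer t
    unfold bwPath
    exact Kernel.IsMarkovKernel.map _ (measurable_snoc.comp measurable_swap)

lemma bddMeasurable_bw {t : ℕ} {f : Path X t → ℝ} (hf : BddMeasurable f) :
    BddMeasurable (F.bw m t f) := by
  have := h.isMarkovKernel_bwPath t
  exact BddMeasurable.integral_kernel (κ := F.bwPath m t) (f := fun _ p => f p)
    (hf.comp measurable_snd)

omit h in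
lemma bw_zero (f : Path X 0 → ℝ) (hf : BddMeasurable f) (x : X) :
    F.bw m 0 f x = f fun _ => x := by
  rw [bw, bwPath, Kernel.deterministic_apply, integral_dirac' _ _ hf.1.stronglyMeasurable]

lemma bw_succ {t : ℕ} {f : Path X (t + 1) → ℝ} (hf : BddMeasurable f) (x : X) :
    F.bw m (t + 1) f x = ∫ y, F.bw m t (fun p => f (snoc p x)) y ∂F.bwKer m t x := by
  have i1 := h.isMarkovKernel_bwKer t
  have i2 := h.isMarkovKernel_bwPath t
  have hms : Measurable fun p : X × Path X t => snoc p.2 p.1 :=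
    measurable_snoc.comp measurable_swap
  have hf' : BddMeasurable fun p : X × Path X t => f (snoc p.2 p.1) := hf.comp hms
  have hfx : BddMeasurable fun p : Path X t => f (snoc p x) := hf'.comp measurable_prodMk_left
  rw [bw, bwPath, integral_kernel_map _ hms hf, Kernel.prod_apply, Kernel.id_apply,
    integral_prod _ (hf'.integrable _)]
  have h4 : Measurable fun x' : X => ∫ p, f (snoc p x') ∂(F.bwPath m t ∘ₖ F.bwKer m t) x :=
    (StronglyMeasurable.integral_prod_right' hf'.1.stronglyMeasurable).measurable
  rw [integral_dirac' _ _ h4.stronglyMeasurable, Kernel.integral_comp (hfx.integrable _)]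
  rfl

omit h in
lemma bw_const_mul (t : ℕ) (a : ℝ) (f : Path X t → ℝ) (x : X) :
    F.bw m t (fun p => a * f p) x = a * F.bw m t f x := integral_const_mul _ _

lemma bw_add {t : ℕ} {f g : Path X t → ℝ} (hf : BddMeasurable f) (hg : BddMeasurable g) (x : X) :
    F.bw m t (fun p => f p + g p) x = F.bw m t f x + F.bw m t g x := by
  have := h.isMarkovKernel_bwPath t
  exact integral_add (hf.integrable _) (hg.integrable _)

lemma bw_const (t : ℕ) (a : ℝ) (x : X) : F.bw m t (fun _ => a) x = a := by
  have := h.isMarkovKernel_bwPath t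
  simp [bw]

/-- The backward path kernel keeps the last point. -/
lemma bw_last_mul {t : ℕ} {a : X → ℝ} (ha : BddMeasurable a) {f : Path X t → ℝ}
    (hf : BddMeasurable f) (x : X) :
    F.bw m t (fun p => a (last p) * f p) x = a x * F.bw m t f x := by
  have hm := (ha.comp (measurable_last (t := t))).mul hf
  cases t with
  | zero => rw [bw_zero _ hm, bw_zero _ hf]; rfl
  | succ t =>
    rw [h.bw_succ hm, h.bw_succ hf, ← integral_const_mul]
    simp only [last_snoc, bw_const_mul]

lemma bw_last {t : ℕ} {a : X → ℝ} (ha : BddMeasurable a) (x : X) :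
    F.bw m t (fun p => a (last p)) x = a x := by
  have := h.bw_last_mul (t := t) ha (BddMeasurable.const 1) x
  simpa [h.bw_const] using this

/-- Only the last increment involves the new point, and it depends on the past through x_s alone,
which the backward path kernel keeps. This gives a recursion between functions of one variable. -/
lemma bw_additive_succ {s : ℕ} {q : ℕ → X → X → ℝ}
    (hq : ∀ ℓ < s + 1, BddMeasurable (Function.uncurry (q ℓ))) (x : X) :
    F.bw m (s + 1) (additive q 0 (s + 1)) x =
      ∫ y, (F.bw m s (additive q 0 s) y + q s y x) ∂F.bwKer m s x := by
  have h1 : BddMeasurable (additive q 0 s : Path X s → ℝ) :=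
    bddMeasurable_additive fun ℓ hℓ => hq ℓ (hℓ.trans (Nat.lt_succ_self s))
  have h2 : BddMeasurable fun y => q s y x :=
    (hq s (Nat.lt_succ_self s)).comp (φ := fun y => (y, x)) (by fun_prop)
  rw [h.bw_succ (bddMeasurable_additive hq)]
  refine integral_congr_ae (ae_of_all _ fun y => ?_)
  simp only [additive_snoc q s.zero_le]
  rw [h.bw_add h1 (h2.comp measurable_last), h.bw_last h2]

section Particle

variable {N : ℕ} [NeZero N]

lemma bwN_add_const (z : Cloud X N) (t : ℕ) (f : Path X t → ℝ) (a : ℝ) (x : X) :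
    F.bwN m z t (fun p => f p + a) x = F.bwN m z t f x + a := by
  induction t generalizing x with
  | zero => rfl
  | succ t ih =>
    simp only [bwN, ih, mul_add, Finset.sum_add_distrib, ← Finset.sum_mul, h.sum_beta, one_mul]

lemma bwN_add_last (z : Cloud X N) (t : ℕ) (f : Path X t → ℝ) (a : X → ℝ) (x : X) :
    F.bwN m z t (fun p => f p + a (last p)) x = F.bwN m z t f x + a x := by
  cases t with
  | zero => rfl
  | succ t =>
    simp only [bwN, last_snoc, h.bwN_add_const, mul_add, Finset.sum_add_distrib, ← Finset.sum_mul,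
      h.sum_beta, one_mul]

/-- The particle version of the recursion, with the backward weights in place of the backward
kernel; the errors of T_s^N are studied by subtracting the two. -/
lemma bwN_additive_succ (z : Cloud X N) (s : ℕ) (q : ℕ → X → X → ℝ) (x : X) :
    F.bwN m z (s + 1) (additive q 0 (s + 1)) x =
      ∑ i, F.beta m z s x i * (F.bwN m z s (additive q 0 s) (z s i) + q s (z s i) x) := by
  simp only [bwN, additive_snoc q s.zero_le]
  exact Finset.sum_congr rfl fun i _ => by
    rw [h.bwN_add_last z s (additive q 0 s) fun y => q s y x]

/-- The inequality is strict: T_s^N reads only particles before time s. Given the past, it is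
therefore a fixed function of the particles drawn at time s. -/
lemma bwN_additive_congr {z z' : Cloud X N} (s : ℕ) (hz : ∀ u < s, z u = z' u)
    (q : ℕ → X → X → ℝ) (x : X) :
    F.bwN m z s (additive q 0 s) x = F.bwN m z' s (additive q 0 s) x := by
  induction s generalizing x with
  | zero => simp only [bwN, additive_self]
  | succ s ih =>
    rw [h.bwN_additive_succ, h.bwN_additive_succ]
    have h1 := hz s (Nat.lt_succ_self s)
    refine Finset.sum_congr rfl fun i _ => ?_
    rw [beta_congr h1, ih (fun u hu => hz u (hu.trans (Nat.lt_succ_self s))), h1]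

lemma bddMeasurable_bwN {s : ℕ} {q : ℕ → X → X → ℝ}
    (hq : ∀ ℓ < s, BddMeasurable (Function.uncurry (q ℓ))) :
    BddMeasurable fun p : Cloud X N × X => F.bwN m p.1 s (additive q 0 s) p.2 := by
  induction s with
  | zero =>
    simp only [bwN, additive_self]
    exact BddMeasurable.const 0
  | succ s ih =>
    simp only [h.bwN_additive_succ]
    have hev (i : Fin N) : Measurable fun p : Cloud X N × X => p.1 s i :=
      (measurable_pi_apply i).comp ((measurable_pi_apply s).comp measurable_fst)
    refine BddMeasurable.sum _ fun i _ => (h.bddMeasurable_beta s i).mul (BddMeasurable.add ?_ ?_)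
    · exact (ih fun ℓ hℓ => hq ℓ (hℓ.trans (Nat.lt_succ_self s))).comp
        (φ := fun p : Cloud X N × X => (p.1, p.1 s i)) (measurable_fst.prodMk (hev i))
    · exact (hq s (Nat.lt_succ_self s)).comp ((hev i).prodMk measurable_snd)

/-- A bound for `T_s^N[h_{0:s}]` that does not depend on the particles or on `N`. -/
lemma exists_abs_bwN_le {s : ℕ} {q : ℕ → X → X → ℝ}
    (hq : ∀ ℓ < s, BddMeasurable (Function.uncurry (q ℓ))) :
    ∃ K, 0 ≤ K ∧ ∀ (N : ℕ) [NeZero N] (z : Cloud X N) (x : X),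
      |F.bwN m z s (additive q 0 s) x| ≤ K := by
  induction s with
  | zero => exact ⟨0, le_rfl, fun N _ z x => by simp [bwN, additive_self]⟩
  | succ s ih =>
    obtain ⟨K, hK0, hK⟩ := ih fun ℓ hℓ => hq ℓ (hℓ.trans (Nat.lt_succ_self s))
    obtain ⟨K', hK'⟩ := (hq s (Nat.lt_succ_self s)).2
    refine ⟨K + |K'|, by positivity, fun N _ z x => ?_⟩
    rw [h.bwN_additive_succ]
    calc _ ≤ ∑ i, F.beta m z s x i * (K + |K'|) := by
          refine (Finset.abs_sum_le_sum_abs _ _).trans (Finset.sum_le_sum fun i _ => ?_)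
          rw [abs_mul, abs_of_nonneg (h.beta_nonneg z s x i)]
          exact mul_le_mul_of_nonneg_left ((abs_add_le _ _).trans
            (add_le_add (hK N z _) ((hK' (z s i, x)).trans (le_abs_self _))))
            (h.beta_nonneg z s x i)
      _ = _ := by rw [← Finset.sum_mul, h.sum_beta, one_mul]

end Particle

end IsDominated

end FeynmanKac

end FFBS

/-! ### Consistency of the particle backward kernels -/

namespace FFBS

/-- Cauchy-Schwarz against a probability measure. -/
lemma integral_abs_le_sqrt {E : Type*} [MeasurableSpace E] (μ : Measure E) [IsProbabilityMeasure μ]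
    {f : E → ℝ} (hf : BddMeasurable f) : ∫ x, |f x| ∂μ ≤ √(∫ x, f x ^ 2 ∂μ) := by
  refine Real.le_sqrt_of_sq_le ?_
  set θ := ∫ x, |f x| ∂μ
  have h1 : ∫ x, (|f x| - θ) ^ 2 ∂μ = ∫ x, f x ^ 2 ∂μ - θ ^ 2 := by
    have e (x : E) : (|f x| - θ) ^ 2 = f x ^ 2 - 2 * θ * |f x| + θ ^ 2 := by
      rw [sub_sq, sq_abs]; ring
    simp_rw [e]
    rw [integral_add (((hf.pow 2).sub ((BddMeasurable.const (2 * θ)).mul hf.abs)).integrable _)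
      (integrable_const _), integral_sub ((hf.pow 2).integrable _)
      (((BddMeasurable.const (2 * θ)).mul hf.abs).integrable _), integral_const_mul]
    simp only [integral_const, probReal_univ, one_smul]
    change _ - 2 * θ * θ + _ = _
    ring
  have h2 : 0 ≤ ∫ x, (|f x| - θ) ^ 2 ∂μ := integral_nonneg fun x => sq_nonneg _
  linarith

namespace FeynmanKac

variable {X : Type*} [MeasurableSpace X] {F : FeynmanKac X} {m : ℕ → X → X → ℝ}

/-- The error `T_s^N[h_{0:s}] - T_s[h_{0:s}]`. -/
noncomputable def bwErr (F : FeynmanKac X) (m : ℕ → X → X → ℝ) {N : ℕ} (q : ℕ → X → X → ℝ)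
    (z : Cloud X N) (s : ℕ) (x : X) : ℝ :=
  F.bwN m z s (additive q 0 s) x - F.bw m s (additive q 0 s) x

/-- The difference between `T_s[h_{0:s}](y) + h̃_s(y, x)` and its mean under `B_s(x, dy)`. -/
noncomputable def bwDev (F : FeynmanKac X) (m : ℕ → X → X → ℝ) (q : ℕ → X → X → ℝ) (s : ℕ)
    (x y : X) : ℝ :=
  F.bw m s (additive q 0 s) y + q s y x - F.bw m (s + 1) (additive q 0 (s + 1)) x

namespace IsDominated

variable {ν : Measure X} {G σ : ℝ} (h : F.IsDominated ν m G σ) {q : ℕ → X → X → ℝ}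

include h

/-- The space is nonempty since it carries a probability, and M_1(x, ·) has a positive finite
density. Hence ν is M_1(x, ·) reweighted by the reciprocal density. This is what makes Fubini
available for ν. -/
lemma sFinite : SFinite ν := by
  obtain ⟨x⟩ : Nonempty X := by
    by_contra hX
    rw [not_nonempty_iff] at hX
    have := F.init_prob.measure_univ
    simp [Measure.eq_zero_of_isEmpty F.init] at this
  have h1 : SFinite (ν.withDensity fun y => ENNReal.ofReal (m 1 x y)) := by
    rw [← h.trans_eq 0 x]; infer_instance
  rw [← withDensity_inv_same (μ := ν) (h.measurable_dens_right 0 x).ennreal_ofReal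
    (ae_of_all _ fun y => by simpa using h.dens_pos 0 x y)
    (ae_of_all _ fun y => ENNReal.ofReal_ne_top)]
  infer_instance

lemma bddMeasurable_bwErr {N : ℕ} [NeZero N] {s : ℕ}
    (hq : ∀ ℓ < s, BddMeasurable (Function.uncurry (q ℓ))) :
    BddMeasurable fun p : Cloud X N × X => F.bwErr m q p.1 s p.2 :=
  (h.bddMeasurable_bwN hq).sub ((h.bddMeasurable_bw (bddMeasurable_additive hq)).comp
    measurable_snd)

lemma bwErr_congr {N : ℕ} [NeZero N] {z z' : Cloud X N} (s : ℕ) (hz : ∀ u < s, z u = z' u)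
    (x : X) : F.bwErr m q z s x = F.bwErr m q z' s x := by
  rw [bwErr, bwErr, h.bwN_additive_congr s hz]

lemma bddMeasurable_bwDev {s : ℕ} (hq : ∀ ℓ < s + 1, BddMeasurable (Function.uncurry (q ℓ))) :
    BddMeasurable (Function.uncurry (F.bwDev m q s)) := by
  have h1 := h.bddMeasurable_bw (bddMeasurable_additive (s := 0) fun ℓ hℓ =>
    hq ℓ (hℓ.trans (Nat.lt_succ_self s)))
  have h2 := h.bddMeasurable_bw (bddMeasurable_additive (s := 0) hq)
  exact ((h1.comp measurable_snd).add ((hq s (Nat.lt_succ_self s)).comp measurable_swap)).sub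
    (h2.comp measurable_fst)

/-- The potential times the transition density is, up to normalization, the density of the backward
kernel with respect to γ_s, and the recursion for T_s says that the deviation is centred under that
kernel. -/
lemma integral_pot_mul_dens_mul_bwDev {s : ℕ}
    (hq : ∀ ℓ < s + 1, BddMeasurable (Function.uncurry (q ℓ))) (x : X) :
    ∫ y, F.pot s y * (m (s + 1) y x * F.bwDev m q s x y) ∂F.marg s = 0 := by
  have h1 := h.bddMeasurable_bw (bddMeasurable_additive (s := 0) fun ℓ hℓ =>
    hq ℓ (hℓ.trans (Nat.lt_succ_self s)))
  have := h.integral_pot_mul_dens_mul_sub_bwKer s x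
    (f := fun y => F.bw m s (additive q 0 s) y + q s y x)
    (h1.add ((hq s (Nat.lt_succ_self s)).comp (φ := fun y => (y, x)) (by fun_prop)))
  simp only [bwDev, h.bw_additive_succ hq]
  exact this

lemma bddMeasurable_pot_mul_dens_mul {s : ℕ} {a : X → X → ℝ}
    (ha : BddMeasurable (Function.uncurry a)) :
    BddMeasurable fun p : X × X => F.pot s p.2 * (m (s + 1) p.2 p.1 * a p.1 p.2) :=
  ((h.bddMeasurable_pot s).comp measurable_snd).mul
    (((h.bddMeasurable_dens s).comp measurable_swap).mul ha)

lemma integrable_dens (s : ℕ) (y : X) : Integrable (m (s + 1) y) ν := by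
  refine ⟨(h.measurable_dens_right s y).aestronglyMeasurable, ?_⟩
  rw [hasFiniteIntegral_iff_ofReal (ae_of_all _ fun x => (h.dens_pos s y x).le)]
  have h1 : F.trans (s + 1) y Set.univ = 1 := measure_univ
  rw [h.trans_eq, withDensity_apply _ MeasurableSet.univ, Measure.restrict_univ] at h1
  rw [h1]
  exact ENNReal.one_lt_top

lemma integral_dens (s : ℕ) (y : X) : ∫ x, m (s + 1) y x ∂ν = 1 := by
  have := h.integral_trans s y fun _ => 1
  simpa using this.symm

/-- Integrating first in the arrival point uses up the transition density and leaves γ_s(g_s), which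
is finite. The function will serve as the dominating function. -/
lemma integrable_integral_pot_mul_dens (s : ℕ) :
    Integrable (fun x => ∫ y, F.pot s y * m (s + 1) y x ∂F.marg s) ν := by
  have i1 := h.sFinite
  have i2 := F.isFiniteMeasure_marg h.pot_le s
  have hm : Measurable fun p : X × X => F.pot s p.1 * m (s + 1) p.1 p.2 :=
    ((F.pot_measurable s).comp measurable_fst).mul (h.measurable_dens s)
  have : Integrable (fun p : X × X => F.pot s p.1 * m (s + 1) p.1 p.2) ((F.marg s).prod ν) := by
    rw [integrable_prod_iff hm.aestronglyMeasurable]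
    refine ⟨ae_of_all _ fun y => (h.integrable_dens s y).const_mul (F.pot s y), ?_⟩
    have e (y : X) : ∫ x, ‖F.pot s y * m (s + 1) y x‖ ∂ν = F.pot s y := by
      simp_rw [norm_mul, Real.norm_of_nonneg (F.pot_nonneg s y),
        Real.norm_of_nonneg (h.dens_pos s y _).le]
      rw [integral_const_mul, h.integral_dens, mul_one]
    simp_rw [e]
    exact (h.bddMeasurable_pot s).integrable _
  exact this.integral_prod_right

section Step

variable {N : ℕ} [NeZero N]

/-- Since the backward weights sum to one, the two recursions can be subtracted under the sum. The
error splits into the average of the previous errors and the average of the centred deviation. -/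
lemma abs_bwErr_succ_le (z : Cloud X N) (s : ℕ) (x : X) :
    |F.bwErr m q z (s + 1) x| ≤ ∑ i, F.beta m z s x i * |F.bwErr m q z s (z s i)| +
      |∑ i, F.beta m z s x i * F.bwDev m q s x (z s i)| := by
  have e : F.bwErr m q z (s + 1) x = ∑ i, F.beta m z s x i * F.bwErr m q z s (z s i) +
      ∑ i, F.beta m z s x i * F.bwDev m q s x (z s i) := by
    rw [bwErr, h.bwN_additive_succ, ← Finset.sum_add_distrib]
    nth_rw 1 [← one_mul (F.bw m (s + 1) _ x)]
    rw [← h.sum_beta z s x, Finset.sum_mul, ← Finset.sum_sub_distrib]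
    exact Finset.sum_congr rfl fun i _ => by simp only [bwErr, bwDev]; ring
  rw [e]
  refine (abs_add_le _ _).trans (add_le_add_left ((Finset.abs_sum_le_sum_abs _ _).trans
    (le_of_eq (Finset.sum_congr rfl fun i _ => ?_))) _)
  rw [abs_mul, abs_of_nonneg (h.beta_nonneg _ _ _ _)]

omit h [NeZero N] in
lemma abs_margN_le (z : Cloud X N) (s : ℕ) {f g : X → ℝ} (hfg : ∀ x, |f x| ≤ g x) :
    |F.margN z s f| ≤ F.margN z s g := by
  rw [margN, margN, abs_mul, abs_mul, abs_of_nonneg (massN_nonneg z s),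
    abs_of_nonneg (by positivity : (0 : ℝ) ≤ (N : ℝ)⁻¹)]
  exact mul_le_mul_of_nonneg_left (mul_le_mul_of_nonneg_left
    ((Finset.abs_sum_le_sum_abs _ _).trans (Finset.sum_le_sum fun i _ => hfg _)) (by positivity))
    (massN_nonneg z s)

/-- Up to the total weight, the mixture density is the denominator of `beta`. Integrating against
the mixture removes this random denominator, and for each arrival point leaves a linear particle
estimate; no lower bound on the densities is required. -/
lemma massN_mul_integral_abs_beta (z : Cloud X N) (s : ℕ) (a : X → X → ℝ) :
    F.massN z (s + 1) * ∫ x, |∑ i, F.beta m z s x i * a x (z s i)| ∂F.mix z s =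
      ∫ x, |F.margN z s fun y => F.pot s y * (m (s + 1) y x * a x y)| ∂ν := by
  rw [h.integral_mix_eq, ← integral_const_mul]
  refine integral_congr_ae (ae_of_all _ fun x => ?_)
  have hW := (F.totalWeight_pos h.pot_pos z s).ne'
  have h0 : 0 ≤ ∑ j, F.weight z s j * m (s + 1) (z s j) x := Finset.sum_nonneg fun j _ =>
    mul_nonneg (F.weight_nonneg _ _ _) (h.dens_pos _ _ _).le
  simp only
  rw [← abs_of_nonneg h0, ← abs_mul, ← abs_of_nonneg (massN_nonneg (F := F) z (s + 1)), ← abs_mul,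
    massN_succ, margN, Finset.mul_sum]
  congr 1
  simp only [Finset.mul_sum]
  refine Finset.sum_congr rfl fun i _ => ?_
  rw [← mul_assoc _ (F.beta m z s x i), h.sum_weight_mul_dens_mul_beta, weight]
  field_simp

/-- The propagated part is reversed into forward weights and loses at most a factor `G`; the
deviation part becomes a ν-integral of particle estimates. -/
lemma massN_mul_integral_bwErr_succ_le {s : ℕ}
    (hq : ∀ ℓ < s + 1, BddMeasurable (Function.uncurry (q ℓ))) (z : Cloud X N) :
    F.massN z (s + 1) * ∫ x, |F.bwErr m q z (s + 1) x| ∂F.mix z s ≤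
      G * F.margN z s (fun x => |F.bwErr m q z s x|) +
      ∫ x, |F.margN z s fun y => F.pot s y * (m (s + 1) y x * F.bwDev m q s x y)| ∂ν := by
  have hpr := F.isProbabilityMeasure_mix h.pot_pos z s
  have hW := (F.totalWeight_pos h.pot_pos z s).ne'
  have b1 : BddMeasurable fun x => |F.bwErr m q z (s + 1) x| :=
    ((h.bddMeasurable_bwErr (N := N) hq).comp (φ := fun x => (z, x)) measurable_prodMk_left).abs
  have b2 : BddMeasurable fun x => ∑ i, F.beta m z s x i * |F.bwErr m q z s (z s i)| :=
    BddMeasurable.sum _ fun i _ => (h.bddMeasurable_beta_fixed z s i).mul (BddMeasurable.const _)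
  have b3 : BddMeasurable fun x => |∑ i, F.beta m z s x i * F.bwDev m q s x (z s i)| :=
    (BddMeasurable.sum _ fun i _ => (h.bddMeasurable_beta_fixed z s i).mul
      ((h.bddMeasurable_bwDev hq).comp (φ := fun x => (x, z s i)) measurable_prodMk_right)).abs
  rw [← h.massN_mul_integral_abs_beta]
  calc _ ≤ F.massN z (s + 1) * ∫ x, (∑ i, F.beta m z s x i * |F.bwErr m q z s (z s i)| +
        |∑ i, F.beta m z s x i * F.bwDev m q s x (z s i)|) ∂F.mix z s :=
        mul_le_mul_of_nonneg_left (integral_mono (b1.integrable _) ((b2.add b3).integrable _)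
          fun x => h.abs_bwErr_succ_le z s x) (massN_nonneg z _)
    _ = F.massN z (s + 1) * ∑ i, F.weight z s i * |F.bwErr m q z s (z s i)| +
        F.massN z (s + 1) * ∫ x, |∑ i, F.beta m z s x i * F.bwDev m q s x (z s i)| ∂F.mix z s := by
        rw [integral_add (b2.integrable _) (b3.integrable _), mul_add,
          h.integral_sum_beta_mul z s (a := fun i _ => |F.bwErr m q z s (z s i)|)
            fun i => BddMeasurable.const _]
        simp
    _ ≤ _ := by
        refine add_le_add_left ?_ _
        calc _ = F.margN z s (fun x => F.pot s x * |F.bwErr m q z s x|) := by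
              simp only [margN, massN_succ, weight, Finset.mul_sum]
              exact Finset.sum_congr rfl fun i _ => by field_simp
          _ ≤ F.margN z s (fun x => G * |F.bwErr m q z s x|) := by
              refine (le_abs_self _).trans (abs_margN_le z s fun x => ?_)
              rw [abs_mul, abs_abs, abs_of_nonneg (F.pot_nonneg s x)]
              exact mul_le_mul_of_nonneg_right (h.pot_le s x) (abs_nonneg _)
          _ = _ := by simp only [margN, ← Finset.mul_sum]; ring

lemma bddMeasurable_margN_bwErr {s : ℕ} (hq : ∀ ℓ < s, BddMeasurable (Function.uncurry (q ℓ))) :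
    BddMeasurable fun z : Cloud X N => F.margN z s fun x => |F.bwErr m q z s x| :=
  (h.bddMeasurable_massN s).mul ((BddMeasurable.const _).mul (BddMeasurable.sum _ fun i _ =>
    ((h.bddMeasurable_bwErr hq).comp (φ := fun z : Cloud X N => (z, z s i))
      (measurable_id.prodMk ((measurable_pi_apply i).comp (measurable_pi_apply s)))).abs))

/-- The error function at time `s + 1` is fixed by the past, so its empirical average over the new
particles has the mixture integral as conditional mean. -/
lemma integral_margN_bwErr_succ {L : Measure (Cloud X N)} (hL : F.IsParticleLaw L) {s : ℕ}
    (hq : ∀ ℓ < s + 1, BddMeasurable (Function.uncurry (q ℓ))) :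
    ∫ z, F.margN z (s + 1) (fun x => |F.bwErr m q z (s + 1) x|) ∂L =
      ∫ z, F.massN z (s + 1) * ∫ x, |F.bwErr m q z (s + 1) x| ∂F.mix z s ∂L := by
  have b (z : Cloud X N) : BddMeasurable fun x => |F.bwErr m q z (s + 1) x| :=
    ((h.bddMeasurable_bwErr hq).comp (φ := fun x => (z, x)) measurable_prodMk_left).abs
  have b2 : BddMeasurable fun p : Cloud X N × (Fin N → X) =>
      ∑ i, |F.bwErr m q p.1 (s + 1) (p.2 i)| :=
    BddMeasurable.sum _ fun i _ => ((h.bddMeasurable_bwErr hq).comp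
      (φ := fun p : Cloud X N × (Fin N → X) => (p.1, p.2 i))
      (measurable_fst.prodMk ((measurable_pi_apply i).comp measurable_snd))).abs
  have b3 : BddMeasurable (Function.uncurry fun (z : Cloud X N) (y : Fin N → X) =>
      F.massN z (s + 1) * ((N : ℝ)⁻¹ * ∑ i, |F.bwErr m q z (s + 1) (y i)|)) :=
    ((h.bddMeasurable_massN (s + 1)).comp measurable_fst).mul ((BddMeasurable.const _).mul b2)
  have b4 : ∀ (z z' : Cloud X N) (y : Fin N → X), (∀ u ≤ s, z u = z' u) →
      F.massN z (s + 1) * ((N : ℝ)⁻¹ * ∑ i, |F.bwErr m q z (s + 1) (y i)|) =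
        F.massN z' (s + 1) * ((N : ℝ)⁻¹ * ∑ i, |F.bwErr m q z' (s + 1) (y i)|) := by
    intro z z' y hz
    have hz' : ∀ u < s + 1, z u = z' u := fun u hu => hz u (Nat.lt_succ_iff.1 hu)
    rw [massN_congr hz']
    simp only [h.bwErr_congr (s + 1) hz']
  have h1 := hL.step s _ b3 b4
  simp only [margN]
  rw [h1]
  refine integral_congr_ae (ae_of_all _ fun z => ?_)
  have hN : (N : ℝ) ≠ 0 := NeZero.ne _
  have hpr := F.isProbabilityMeasure_mix h.pot_pos z s
  simp only
  rw [integral_const_mul, integral_const_mul, integral_sum_eval_pi _ (b z),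
    inv_mul_cancel_left₀ hN]

end Step

/-- Convergence to `0` of the `ν`-integral of the estimates of functions with mean `0`. -/
lemma tendsto_integral_integral_margN (L : (N : ℕ) → Measure (Cloud X N))
    (hL : ∀ N, 1 ≤ N → F.IsParticleLaw (L N)) (s : ℕ) {a : X → X → ℝ}
    (ha : BddMeasurable (Function.uncurry a))
    (ha0 : ∀ x, ∫ y, F.pot s y * (m (s + 1) y x * a x y) ∂F.marg s = 0) :
    (∀ N, 1 ≤ N → Integrable (fun z : Cloud X N =>
      ∫ x, |F.margN z s fun y => F.pot s y * (m (s + 1) y x * a x y)| ∂ν) (L N)) ∧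
    Tendsto (fun N => ∫ z : Cloud X N,
      ∫ x, |F.margN z s fun y => F.pot s y * (m (s + 1) y x * a x y)| ∂ν ∂L N) atTop (𝓝 0) := by
  have i1 := h.sFinite
  have hk := h.bddMeasurable_pot_mul_dens_mul (s := s) ha
  have hkx (x : X) : BddMeasurable fun y => F.pot s y * (m (s + 1) y x * a x y) :=
    hk.comp (φ := fun y => (x, y)) measurable_prodMk_left
  obtain ⟨K, hK⟩ := ha.2
  set ψ : (N : ℕ) → Cloud X N → X → ℝ := fun N z x =>
    F.margN z s fun y => F.pot s y * (m (s + 1) y x * a x y)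
  have hψm (N : ℕ) : Measurable fun p : Cloud X N × X => |ψ N p.1 p.2| := by
    refine Measurable.abs (((h.bddMeasurable_massN s).1.comp measurable_fst).mul
      (measurable_const.mul (Finset.measurable_sum _ fun i _ =>
        hk.1.comp (f := fun p : Cloud X N × X => (p.2, p.1 s i)) ?_)))
    exact measurable_snd.prodMk
      ((measurable_pi_apply i).comp ((measurable_pi_apply s).comp measurable_fst))
  have hψb (N : ℕ) (x : X) : BddMeasurable fun z => ψ N z x := h.bddMeasurable_margN (hkx x) s
  -- Unbiasedness of the particle estimates gives a bound free of `N`, hence a dominating function.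
  have hbd (N : ℕ) (hN : 1 ≤ N) (x : X) : ∫ z, |ψ N z x| ∂L N ≤
      (∫ y, F.pot s y * m (s + 1) y x ∂F.marg s) * K := by
    have : NeZero N := ⟨by omega⟩
    have hp := (hL N hN).prob
    have hb : BddMeasurable fun y => F.pot s y * m (s + 1) y x :=
      (h.bddMeasurable_pot s).mul (h.bddMeasurable_dens_left s x)
    have hbK := hb.mul (BddMeasurable.const K)
    rw [← integral_mul_const, ← h.integral_margN (hL N hN) s hbK]
    refine integral_mono ((hψb N x).abs.integrable _)
      ((h.bddMeasurable_margN hbK s).integrable _) fun z => abs_margN_le z s fun y => ?_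
    rw [← mul_assoc, abs_mul, abs_of_nonneg (mul_nonneg (F.pot_nonneg s y) (h.dens_pos s y x).le)]
    exact mul_le_mul_of_nonneg_left (hK (x, y))
      (mul_nonneg (F.pot_nonneg s y) (h.dens_pos s y x).le)
  have hdom : Integrable (fun x => (∫ y, F.pot s y * m (s + 1) y x ∂F.marg s) * K) ν :=
    (h.integrable_integral_pot_mul_dens s).mul_const K
  have hm2 (N : ℕ) (hN : 1 ≤ N) : AEStronglyMeasurable (fun x => ∫ z, |ψ N z x| ∂L N) ν := by
    have hp := (hL N hN).prob
    exact (StronglyMeasurable.integral_prod_left' (hψm N).stronglyMeasurable).aestronglyMeasurable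
  have hint (N : ℕ) (hN : 1 ≤ N) :
      Integrable (fun p : Cloud X N × X => |ψ N p.1 p.2|) ((L N).prod ν) := by
    have hp := (hL N hN).prob
    rw [integrable_prod_iff' (hψm N).aestronglyMeasurable]
    refine ⟨ae_of_all _ fun x => (hψb N x).abs.integrable _, ?_⟩
    simp only [Real.norm_eq_abs, abs_abs]
    refine hdom.mono' (hm2 N hN) (ae_of_all _ fun x => ?_)
    rw [Real.norm_of_nonneg (integral_nonneg fun z => abs_nonneg _)]
    exact hbd N hN x
  refine ⟨fun N hN => by
    have hp := (hL N hN).prob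
    exact (hint N hN).integral_prod_left, ?_⟩
  -- For each `x` the law of large numbers applies to a function with mean zero. Its constant is
  -- allowed to depend on `x`, so the ν-integral is handled by dominated convergence and no rate
  -- results.
  have hlim : Tendsto (fun N => ∫ x, ∫ z, |ψ N z x| ∂L N ∂ν) atTop (𝓝 (∫ _, (0 : ℝ) ∂ν)) := by
    refine tendsto_integral_filter_of_dominated_convergence _
      (eventually_atTop.2 ⟨1, fun N hN => hm2 N hN⟩)
      (eventually_atTop.2 ⟨1, fun N hN => ae_of_all _ fun x => ?_⟩) hdom
      (ae_of_all _ fun x => ?_)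
    · rw [Real.norm_of_nonneg (integral_nonneg fun z => abs_nonneg _)]
      exact hbd N hN x
    · obtain ⟨C, hC⟩ := h.exists_integral_margN_sub_sq_le s (hkx x)
      simp only [ha0, sub_zero] at hC
      have hz : Tendsto (fun N : ℕ => √(C / N)) atTop (𝓝 0) := by
        have := (tendsto_const_div_atTop_nhds_zero_nat C).sqrt
        rwa [Real.sqrt_zero] at this
      refine tendsto_of_tendsto_of_tendsto_of_le_of_le' tendsto_const_nhds hz
        (Eventually.of_forall fun N => integral_nonneg fun z => abs_nonneg _)
        (eventually_atTop.2 ⟨1, fun N hN => ?_⟩)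
      have : NeZero N := ⟨by omega⟩
      have hp := (hL N hN).prob
      exact (integral_abs_le_sqrt _ (hψb N x)).trans (Real.sqrt_le_sqrt (hC N (L N) (hL N hN)))
  rw [integral_zero] at hlim
  refine hlim.congr' (eventually_atTop.2 ⟨1, fun N hN => ?_⟩)
  have hp := (hL N hN).prob
  exact (integral_integral_swap (hint N hN)).symm

/-- The particle approximation of `T_s[h_{0:s}]` is consistent along the particles. -/
theorem tendsto_integral_margN_bwErr (L : (N : ℕ) → Measure (Cloud X N))
    (hL : ∀ N, 1 ≤ N → F.IsParticleLaw (L N)) (s : ℕ)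
    (hq : ∀ ℓ < s, BddMeasurable (Function.uncurry (q ℓ))) :
    Tendsto (fun N => ∫ z : Cloud X N, F.margN z s (fun x => |F.bwErr m q z s x|) ∂L N)
      atTop (𝓝 0) := by
  induction s with
  | zero =>
    have e (N : ℕ) (z : Cloud X N) (x : X) : F.bwErr m q z 0 x = 0 := by
      rw [bwErr, bw_zero _ (bddMeasurable_additive hq)]
      simp [bwN, additive_self]
    simp [e, margN]
  | succ s ih =>
    obtain ⟨hi, ht⟩ := h.tendsto_integral_integral_margN L hL s (h.bddMeasurable_bwDev hq)
      (h.integral_pot_mul_dens_mul_bwDev hq)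
    have hq' : ∀ ℓ < s, BddMeasurable (Function.uncurry (q ℓ)) :=
      fun ℓ hℓ => hq ℓ (hℓ.trans (Nat.lt_succ_self s))
    have hlim := ((ih hq').const_mul G).add ht
    rw [mul_zero, zero_add] at hlim
    have h0 (N : ℕ) : 0 ≤ ∫ z : Cloud X N,
        F.margN z (s + 1) (fun x => |F.bwErr m q z (s + 1) x|) ∂L N :=
      integral_nonneg fun z => mul_nonneg (massN_nonneg z _) (mul_nonneg (by positivity)
        (Finset.sum_nonneg fun i _ => abs_nonneg _))
    refine tendsto_of_tendsto_of_tendsto_of_le_of_le' tendsto_const_nhds hlim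
      (Eventually.of_forall h0) (eventually_atTop.2 ⟨1, fun N hN => ?_⟩)
    have : NeZero N := ⟨by omega⟩
    have hp := (hL N hN).prob
    rw [h.integral_margN_bwErr_succ (hL N hN) hq, ← integral_const_mul, ← integral_add
      (((h.bddMeasurable_margN_bwErr hq').integrable _).const_mul _) (hi N hN)]
    refine integral_mono_of_nonneg (ae_of_all _ fun z => mul_nonneg (massN_nonneg z _)
      (integral_nonneg fun x => abs_nonneg _))
      ((((h.bddMeasurable_margN_bwErr hq').integrable _).const_mul _).add (hi N hN))
      (ae_of_all _ fun z => h.massN_mul_integral_bwErr_succ_le hq z)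

end IsDominated

end FeynmanKac

end FFBS

/-! ### Plug-in test functions in μ^BS -/

namespace FFBS

lemma e_self (s : ℕ) : e s s = true := by simp [e]

lemma e_of_ne {s r : ℕ} (h : r ≠ s) : e s r = false := by simp [e, h]

namespace FeynmanKac

variable {X : Type*} [MeasurableSpace X] {F : FeynmanKac X} {m : ℕ → X → X → ℝ} {N : ℕ}
  {b : ℕ → Bool}

lemma muBS_const_mul (z : Cloud X N) (t : ℕ) (a : ℝ) (f : Path X t → Path X t → ℝ) :
    F.muBS m z b t (fun p q => a * f p q) = a * F.muBS m z b t f := by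
  simp only [muBS_eq_sum_pairSum, pairSum_const_mul, Finset.mul_sum]

lemma muBS_add (z : Cloud X N) (t : ℕ) (f g : Path X t → Path X t → ℝ) :
    F.muBS m z b t (fun p q => f p q + g p q) = F.muBS m z b t f + F.muBS m z b t g := by
  simp only [muBS_eq_sum_pairSum, pairSum_add, Finset.sum_add_distrib]

namespace IsDominated

variable {ν : Measure X} {G σ : ℝ} (h : F.IsDominated ν m G σ)

include h

lemma muBS_mono (hN : 2 ≤ N) (z : Cloud X N) (t : ℕ) {f g : Path X t → Path X t → ℝ}
    (hfg : ∀ p q, f p q ≤ g p q) : F.muBS m z b t f ≤ F.muBS m z b t g := by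
  simp only [muBS_eq_sum_pairSum]
  exact Finset.sum_le_sum fun k _ => Finset.sum_le_sum fun l _ => h.pairSum_mono hN z t k l hfg

lemma muBS_nonneg (hN : 2 ≤ N) (z : Cloud X N) (t : ℕ) {f : Path X t → Path X t → ℝ}
    (hf : ∀ p q, 0 ≤ f p q) : 0 ≤ F.muBS m z b t f := by
  simp only [muBS_eq_sum_pairSum]
  exact Finset.sum_nonneg fun k _ => Finset.sum_nonneg fun l _ => h.pairSum_nonneg hN z t k l hf

lemma abs_muBS_sub_le (hN : 2 ≤ N) (z : Cloud X N) (t : ℕ) {f g a : Path X t → Path X t → ℝ}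
    (hfg : ∀ p q, |f p q - g p q| ≤ a p q) :
    |F.muBS m z b t f - F.muBS m z b t g| ≤ F.muBS m z b t a := by
  simp only [muBS_eq_sum_pairSum, ← Finset.sum_sub_distrib]
  refine (Finset.abs_sum_le_sum_abs _ _).trans (Finset.sum_le_sum fun k _ =>
    (Finset.abs_sum_le_sum_abs _ _).trans (Finset.sum_le_sum fun l _ => ?_))
  have e1 : F.pairSum m b z t k l f - F.pairSum m b z t k l g =
      F.pairSum m b z t k l fun p q => f p q - g p q := by
    have := pairSum_add (F := F) (m := m) (b := b) (z := z) t k l (fun p q => f p q - g p q) g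
    simp only [sub_add_cancel] at this
    linarith
  rw [e1]
  exact h.abs_pairSum_le hN z t k l hfg

/-- Without coalescence each step costs a factor at most 2, and both families of weights sum to one.
No pair of indices therefore gets more than order N⁻², for every realization of the particles. -/
lemma pairSum_one_le (hN : 2 ≤ N) (z : Cloud X N) (r : ℕ) (hb : ∀ u ≤ r, b u = false)
    (k l : Fin N) :
    F.pairSum m b z r k l (fun _ _ => 1) ≤ 2 ^ (r + 1) * F.massN z r ^ 2 * (N : ℝ)⁻¹ ^ 2 := by
  have : NeZero N := ⟨by omega⟩
  have h2 : coalFactor N false ≤ 2 := by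
    simpa [coalFactor] using div_sub_one_le_two hN
  have h0 := coalFactor_nonneg hN false
  induction r generalizing k l with
  | zero =>
    simp only [pairSum, hb 0 le_rfl, massN_zero]
    have : (if (k = l ↔ false = true) then (1 : ℝ) else 0) ≤ 1 := by split_ifs <;> norm_num
    calc _ ≤ 2 * 1 * (N : ℝ)⁻¹ ^ 2 * 1 := by gcongr
      _ = _ := by ring
  | succ r ih =>
    have ih' := ih fun u hu => hb u (hu.trans (Nat.le_succ r))
    simp only [pairSum, hb (r + 1) le_rfl]
    set B := 2 ^ (r + 1) * F.massN z r ^ 2 * (N : ℝ)⁻¹ ^ 2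
    have h1 : (if (k = l ↔ false = true) then (1 : ℝ) else 0) ≤ 1 := by split_ifs <;> norm_num
    have h1' : (0 : ℝ) ≤ if (k = l ↔ false = true) then (1 : ℝ) else 0 := by
      split_ifs <;> norm_num
    have hw (j : Fin N) : 0 ≤ if l = k then F.weight z r j else F.beta m z r (z (r + 1) l) j := by
      split_ifs
      exacts [F.weight_nonneg _ _ _, h.beta_nonneg _ _ _ _]
    have hw1 : ∑ j, (if l = k then F.weight z r j else F.beta m z r (z (r + 1) l) j) = 1 := by
      split_ifs
      exacts [F.sum_weight h.pot_pos z r, h.sum_beta _ _ _]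
    have hB : 0 ≤ B := by positivity
    have hsum : ∑ i, ∑ j, F.beta m z r (z (r + 1) k) i *
        (if l = k then F.weight z r j else F.beta m z r (z (r + 1) l) j) *
        F.pairSum m b z r i j (fun _ _ => 1) ≤ B := by
      calc _ ≤ ∑ i, ∑ j, F.beta m z r (z (r + 1) k) i *
            (if l = k then F.weight z r j else F.beta m z r (z (r + 1) l) j) * B :=
            Finset.sum_le_sum fun i _ => Finset.sum_le_sum fun j _ =>
              mul_le_mul_of_nonneg_left (ih' i j) (mul_nonneg (h.beta_nonneg _ _ _ _) (hw j))
        _ = B := by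
            simp_rw [← Finset.sum_mul, ← Finset.mul_sum, hw1, mul_one, h.sum_beta, one_mul]
    calc _ ≤ 2 * 1 * ((N : ℝ)⁻¹ * F.totalWeight z r) ^ 2 * B := by
          gcongr
          exact Finset.sum_nonneg fun i _ => Finset.sum_nonneg fun j _ =>
            mul_nonneg (mul_nonneg (h.beta_nonneg _ _ _ _) (hw j))
              (h.pairSum_nonneg hN z r i j fun _ _ => zero_le_one)
      _ = _ := by rw [massN_succ]; ring

/-- At a coalescence time, `μ^BS` is dominated by the empirical measure of the particles. -/
lemma muBS_e_le (hN : 2 ≤ N) (z : Cloud X N) (s : ℕ) {A : X → X → ℝ} (hA : ∀ x y, 0 ≤ A x y) :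
    F.muBS m z (e s) s (fun p q => A (last p) (last q)) ≤
      (2 * G) ^ s * F.margN z s fun x => A x x := by
  have : NeZero N := ⟨by omega⟩
  have hN0 : (N : ℝ) ≠ 0 := NeZero.ne _
  -- The weights produce the square of the mass: one factor is kept to form `margN`, the other is
  -- bounded by `G ^ s`.
  suffices h1 : F.muBS m z (e s) s (fun p q => A (last p) (last q)) ≤
      2 ^ s * F.massN z s ^ 2 * ((N : ℝ)⁻¹ * ∑ k, A (z s k) (z s k)) by
    refine h1.trans ?_
    have hS : 0 ≤ (N : ℝ)⁻¹ * ∑ k, A (z s k) (z s k) :=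
      mul_nonneg (by positivity) (Finset.sum_nonneg fun k _ => hA _ _)
    calc _ = 2 ^ s * F.massN z s * (F.massN z s * ((N : ℝ)⁻¹ * ∑ k, A (z s k) (z s k))) := by ring
      _ ≤ 2 ^ s * G ^ s * (F.massN z s * ((N : ℝ)⁻¹ * ∑ k, A (z s k) (z s k))) := by
          have := h.massN_le z s
          have := massN_nonneg (F := F) z s
          gcongr
      _ = _ := by rw [mul_pow, margN]
  rw [muBS_eq_sum_pairSum]
  cases s with
  | zero =>
    simp only [pairSum, e_self, coalFactor, if_true, iff_true, mul_ite, mul_one, mul_zero, ite_mul,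
      zero_mul, Finset.sum_ite_eq, Finset.mem_univ, massN_zero, pow_zero, one_pow, one_mul, last,
      Finset.mul_sum]
    refine Finset.sum_le_sum fun k _ => le_of_eq ?_
    field_simp
  | succ s =>
    simp only [pairSum_succ_of_true (e_self (s + 1)), Finset.sum_ite_eq, Finset.mem_univ, if_true,
      Finset.mul_sum]
    refine Finset.sum_le_sum fun k _ => ?_
    simp only [stepDiag, last_snoc]
    set a := A (z (s + 1) k) (z (s + 1) k)
    have ha : 0 ≤ a := hA _ _
    set B := 2 ^ (s + 1) * F.massN z s ^ 2 * (N : ℝ)⁻¹ ^ 2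
    have hP (i j : Fin N) : F.pairSum m (e (s + 1)) z s i j (fun _ _ => a) ≤ a * B := by
      have e1 := pairSum_const_mul (F := F) (m := m) (b := e (s + 1)) (z := z) s i j a
        fun _ _ => 1
      simp only [mul_one] at e1
      rw [e1]
      exact mul_le_mul_of_nonneg_left (h.pairSum_one_le hN z s
        (fun u hu => e_of_ne (by omega)) i j) ha
    have hsum : ∑ i, ∑ j, F.beta m z s (z (s + 1) k) i * F.weight z s j *
        F.pairSum m (e (s + 1)) z s i j (fun _ _ => a) ≤ a * B := by
      calc _ ≤ ∑ i, ∑ j, F.beta m z s (z (s + 1) k) i * F.weight z s j * (a * B) :=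
            Finset.sum_le_sum fun i _ => Finset.sum_le_sum fun j _ =>
              mul_le_mul_of_nonneg_left (hP i j)
                (mul_nonneg (h.beta_nonneg _ _ _ _) (F.weight_nonneg _ _ _))
        _ = a * B := by
            simp_rw [← Finset.sum_mul, ← Finset.mul_sum, F.sum_weight h.pot_pos, mul_one,
              h.sum_beta, one_mul]
    calc _ ≤ (N : ℝ) * (((N : ℝ)⁻¹ * F.totalWeight z s) ^ 2 * (a * B)) := by gcongr
      _ = _ := by
        simp only [B]
        rw [massN_succ]
        field_simp

/-- Propagation of the first moment of `μ^BS` after the coalescence time. -/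
lemma integral_muBS_point_le (hN : 2 ≤ N) {L : Measure (Cloud X N)} (hL : F.IsParticleLaw L)
    {s t : ℕ} (hst : s ≤ t) {A : Cloud X N → X → X → ℝ}
    (hAm : BddMeasurable fun p : Cloud X N × X × X => A p.1 p.2.1 p.2.2)
    (hA : ∀ z x y, 0 ≤ A z x y) (hAz : ∀ z z' x y, (∀ u < s, z u = z' u) → A z x y = A z' x y) :
    ∫ z, F.muBS m z b t (fun p q => A z (point p s hst) (point q s hst)) ∂L ≤
      (G ^ 2) ^ (t - s) * ∫ z, F.muBS m z b s (fun p q => A z (last p) (last q)) ∂L := by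
  have : NeZero N := ⟨by omega⟩
  have hp := hL.prob
  have hmeas (t : ℕ) (hst : s ≤ t) : BddMeasurable fun p : Cloud X N × Path X t × Path X t =>
      A p.1 (point p.2.1 s hst) (point p.2.2 s hst) :=
    hAm.comp (φ := fun p : Cloud X N × Path X t × Path X t =>
      (p.1, point p.2.1 s hst, point p.2.2 s hst)) (measurable_fst.prodMk
        (((measurable_point hst).comp (measurable_fst.comp measurable_snd)).prodMk
        ((measurable_point hst).comp (measurable_snd.comp measurable_snd))))
  induction t, hst using Nat.le_induction with
  | base => simp
  | succ t hst ih =>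
    set f : Cloud X N → Path X (t + 1) → Path X (t + 1) → ℝ := fun z p q =>
      A z (point p s (hst.trans (Nat.le_succ t))) (point q s (hst.trans (Nat.le_succ t)))
    have hf := hmeas (t + 1) (hst.trans (Nat.le_succ t))
    have hf' (z : Cloud X N) : BddMeasurable (Function.uncurry (f z)) :=
      hf.comp (φ := fun w : Path X (t + 1) × Path X (t + 1) => (z, w)) measurable_prodMk_left
    have mstep := h.bddMeasurable_stepBS (b := b) (f := f) hf
    -- The plug-in function reads only times before `s`, hence before the generation being
    -- integrated out.
    have hdep : ∀ (z z' : Cloud X N) (y : Fin N → X), (∀ u ≤ t, z u = z' u) →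
        F.stepBS m b z t (f z) y = F.stepBS m b z' t (f z') y := by
      intro z z' y hz
      have : f z = f z' := by
        funext p q
        exact hAz _ _ _ _ fun u hu => hz u (hu.le.trans hst)
      rw [stepBS_congr hz, this]
    have mm := h.bddMeasurable_muBS (b := b) t
      (f := fun z p q => A z (point p s hst) (point q s hst)) (hmeas t hst)
    have hpush (z : Cloud X N) : ∫ y, F.stepBS m b z t (f z) y
        ∂Measure.pi (fun _ : Fin N => F.mix z t) ≤
        G ^ 2 * F.muBS m z b t (fun p q => A z (point p s hst) (point q s hst)) := by
      rw [h.integral_stepBS z t hN (hf' z), ← muBS_const_mul]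
      refine h.muBS_mono hN z t fun p q => ?_
      -- The test function ignores the new points, so the transitions integrate to one whatever the
      -- flag is.
      have e1 : F.pairPush (b (t + 1)) (f z) p q =
          F.pot t (last p) * F.pot t (last q) * A z (point p s hst) (point q s hst) := by
        simp only [pairPush, f, point_snoc _ _ hst]
        cases b (t + 1) <;> simp
      rw [e1]
      have := h.G_nonneg
      refine mul_le_mul_of_nonneg_right ?_ (hA _ _ _)
      rw [pow_two]
      exact mul_le_mul (h.pot_le _ _) (h.pot_le _ _) (F.pot_nonneg _ _) this
    calc ∫ z, F.muBS m z b (t + 1) (f z) ∂L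
        = ∫ z, ∫ y, F.stepBS m b z t (f z) y ∂Measure.pi (fun _ : Fin N => F.mix z t) ∂L := by
          simp_rw [muBS_succ]
          exact hL.step t _ mstep hdep
      _ ≤ ∫ z, G ^ 2 * F.muBS m z b t (fun p q => A z (point p s hst) (point q s hst)) ∂L :=
          integral_mono ((BddMeasurable.integral_kernel (κ := F.moveKer h.pot_pos t)
            (f := fun (z : Cloud X N) y => F.stepBS m b z t (f z) y) mstep).integrable L)
            ((mm.integrable L).const_mul _) hpush
      _ = G ^ 2 * ∫ z, F.muBS m z b t (fun p q => A z (point p s hst) (point q s hst)) ∂L :=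
          integral_const_mul _ _
      _ ≤ G ^ 2 * ((G ^ 2) ^ (t - s) *
            ∫ z, F.muBS m z b s (fun p q => A z (last p) (last q)) ∂L) := by gcongr
      _ = _ := by rw [show t + 1 - s = t - s + 1 by omega, pow_succ]; ring

/-- Consistency of `μ^BS_{e_s,t}` on functions that depend on the particles and are close to a fixed
one along the particles at time `s`. -/
theorem tendsto_integral_muBS_sub_sq (L : (N : ℕ) → Measure (Cloud X N))
    (hL : ∀ N, 1 ≤ N → F.IsParticleLaw (L N)) {s t : ℕ} (hst : s ≤ t)
    {Φ : (N : ℕ) → Cloud X N → Path X t → Path X t → ℝ} {f : Path X t → Path X t → ℝ}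
    {A : (N : ℕ) → Cloud X N → X → X → ℝ} {M : ℝ}
    (hf : BddMeasurable (Function.uncurry f))
    (hΦ : ∀ N, 1 ≤ N → BddMeasurable fun p : Cloud X N × Path X t × Path X t =>
      Φ N p.1 p.2.1 p.2.2)
    (hAm : ∀ N, 1 ≤ N → BddMeasurable fun p : Cloud X N × X × X => A N p.1 p.2.1 p.2.2)
    (hA : ∀ N z x y, 0 ≤ A N z x y) (hAM : ∀ N, 1 ≤ N → ∀ z x y, A N z x y ≤ M)
    (hAz : ∀ N, 1 ≤ N → ∀ z z' x y, (∀ u < s, z u = z' u) → A N z x y = A N z' x y)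
    (hΦf : ∀ N, 1 ≤ N → ∀ z p q, |Φ N z p q - f p q| ≤ A N z (point p s hst) (point q s hst))
    (hlim : Tendsto (fun N => ∫ z, F.margN z s (fun x => A N z x x) ∂L N) atTop (𝓝 0)) :
    Tendsto (fun N => ∫ z, (F.muBS m z (e s) t (Φ N z) - F.muInt (e s) t f) ^ 2 ∂L N)
      atTop (𝓝 0) := by
  obtain ⟨C₁, hC₁⟩ := h.exists_integral_muBS_sub_sq_le (e s) t hf
  have h1bdd : BddMeasurable (Function.uncurry fun _ _ : Path X t => (1 : ℝ)) :=
    BddMeasurable.const 1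
  obtain ⟨C₂, hC₂⟩ := h.exists_integral_muBS_sub_sq_le (e s) t h1bdd
  set κ := |F.muInt (e s) t fun _ _ => 1|
  set K := (G ^ 2) ^ (t - s) * (2 * G) ^ s
  -- This is the bound that will be obtained: the total mass contributes its L² and L¹ errors, the
  -- plug-in error its mean along the particles at time `s`, and the fixed test function its own
  -- rate.
  have hlim' : Tendsto (fun N : ℕ => 2 * (|M| * (|M| * (C₂ / N + κ * √(C₂ / N)) +
      κ * (K * ∫ z, F.margN z s (fun x => A N z x x) ∂L N))) + 2 * (C₁ / N)) atTop (𝓝 0) := by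
    have z1 := tendsto_const_div_atTop_nhds_zero_nat C₁
    have z2 := tendsto_const_div_atTop_nhds_zero_nat C₂
    have z3 := z2.sqrt
    have := ((((((z2.add (z3.const_mul κ)).const_mul |M|).add
      ((hlim.const_mul K).const_mul κ)).const_mul |M|).const_mul 2).add (z1.const_mul 2))
    simpa using this
  refine tendsto_of_tendsto_of_tendsto_of_le_of_le' tendsto_const_nhds hlim'
    (Eventually.of_forall fun N => integral_nonneg fun z => sq_nonneg _)
    (eventually_atTop.2 ⟨2, fun N hN => ?_⟩)
  have : NeZero N := ⟨by omega⟩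
  have hN1 : 1 ≤ N := by omega
  have hp := (hL N hN1).prob
  set S : Cloud X N → (Path X t → Path X t → ℝ) → ℝ := fun z => F.muBS m z (e s) t
  set ψ : Cloud X N → Path X t → Path X t → ℝ := fun z p q =>
    A N z (point p s hst) (point q s hst)
  have hψ : BddMeasurable fun p : Cloud X N × Path X t × Path X t => ψ p.1 p.2.1 p.2.2 :=
    (hAm N hN1).comp (φ := fun p : Cloud X N × Path X t × Path X t =>
      (p.1, point p.2.1 s hst, point p.2.2 s hst)) (measurable_fst.prodMk
        (((measurable_point hst).comp (measurable_fst.comp measurable_snd)).prodMk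
        ((measurable_point hst).comp (measurable_snd.comp measurable_snd))))
  have m1 : BddMeasurable fun z => S z (Φ N z) := h.bddMeasurable_muBS t (hΦ N hN1)
  have m2 : BddMeasurable fun z => S z f := h.bddMeasurable_muBS t (f := fun _ => f)
    hf.of_const_cloud
  have m3 : BddMeasurable fun z => S z (ψ z) := h.bddMeasurable_muBS t hψ
  have m4 : BddMeasurable fun z => S z (fun _ _ => 1) := h.bddMeasurable_muBS t
    (f := fun _ _ _ => 1) (BddMeasurable.const 1)
  set I := F.muInt (e s) t fun _ _ => 1
  have m5 : BddMeasurable fun z => S z (fun _ _ => 1) - I := m4.sub (BddMeasurable.const _)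
  -- The first moment is carried back from `t` to the coalescence time, where it is compared with
  -- the empirical measure.
  have hfirst : ∫ z, S z (ψ z) ∂L N ≤ K * ∫ z, F.margN z s (fun x => A N z x x) ∂L N := by
    refine (h.integral_muBS_point_le hN (hL N hN1) hst (hAm N hN1) (hA N) (hAz N hN1)).trans ?_
    rw [mul_assoc]
    refine mul_le_mul_of_nonneg_left ?_ (by positivity)
    rw [← integral_const_mul]
    have m6 : BddMeasurable fun z : Cloud X N => F.margN z s (fun x => A N z x x) :=
      (h.bddMeasurable_massN s).mul ((BddMeasurable.const _).mul (BddMeasurable.sum _ fun i _ =>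
        (hAm N hN1).comp (φ := fun z : Cloud X N => (z, z s i, z s i)) (by fun_prop)))
    have m7 : BddMeasurable fun p : Cloud X N × Path X s × Path X s =>
        A N p.1 (last p.2.1) (last p.2.2) :=
      (hAm N hN1).comp (φ := fun p : Cloud X N × Path X s × Path X s =>
        (p.1, last p.2.1, last p.2.2)) (measurable_fst.prodMk
        ((measurable_last.comp (measurable_fst.comp measurable_snd)).prodMk
        (measurable_last.comp (measurable_snd.comp measurable_snd))))
    exact integral_mono ((h.bddMeasurable_muBS s m7).integrable _) ((m6.integrable _).const_mul _)
      fun z => h.muBS_e_le hN z s (hA N z)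
  -- Only the first moment of `S z (ψ z)` is known to vanish. In the square one factor is bounded by
  -- `|M|` times the total mass, and the total mass by its limit plus an error that is small in L².
  have hpt (z : Cloud X N) : (S z (Φ N z) - S z f) ^ 2 ≤ |M| * (|M| * ((S z (fun _ _ => 1) - I) ^ 2 +
      κ * |S z (fun _ _ => 1) - I|) + κ * S z (ψ z)) := by
    have a1 : |S z (Φ N z) - S z f| ≤ S z (ψ z) := h.abs_muBS_sub_le hN z t (hΦf N hN1 z)
    have a2 : 0 ≤ S z (ψ z) := h.muBS_nonneg hN z t fun p q => hA _ _ _ _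
    have a3 : 0 ≤ S z (fun _ _ => 1) := h.muBS_nonneg hN z t fun p q => zero_le_one
    have a4 : S z (ψ z) ≤ |M| * S z (fun _ _ => 1) := by
      simp only [S]
      rw [← muBS_const_mul]
      exact h.muBS_mono hN z t fun p q => by
        rw [mul_one]; exact (hAM N hN1 _ _ _).trans (le_abs_self M)
    have a5 : S z (fun _ _ => 1) ≤ |S z (fun _ _ => 1) - I| + κ := by
      have := le_abs_self (S z (fun _ _ => 1) - I)
      have := le_abs_self I
      linarith
    set y := |S z (fun _ _ => 1) - I|
    have hy : 0 ≤ y := abs_nonneg _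
    have hκ : 0 ≤ κ := abs_nonneg _
    rw [← sq_abs (S z (fun _ _ => 1) - I), ← sq_abs (S z (Φ N z) - S z f)]
    change _ ≤ |M| * (|M| * (y ^ 2 + κ * y) + κ * S z (ψ z))
    have b1 : |S z (Φ N z) - S z f| ^ 2 ≤ S z (ψ z) ^ 2 := pow_le_pow_left₀ (abs_nonneg _) a1 2
    have b2 : S z (ψ z) ^ 2 ≤ (|M| * S z (fun _ _ => 1)) * S z (ψ z) := by
      rw [pow_two]; exact mul_le_mul_of_nonneg_right a4 a2
    have b3 : S z (fun _ _ => 1) * S z (ψ z) ≤ (y + κ) * S z (ψ z) :=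
      mul_le_mul_of_nonneg_right a5 a2
    have b4 : y * S z (ψ z) ≤ y * (|M| * (y + κ)) :=
      mul_le_mul_of_nonneg_left (a4.trans (mul_le_mul_of_nonneg_left a5 (abs_nonneg _))) hy
    have hM := abs_nonneg M
    calc _ ≤ |M| * (S z (fun _ _ => 1) * S z (ψ z)) := by linarith
      _ ≤ |M| * (y * (|M| * (y + κ)) + κ * S z (ψ z)) :=
          mul_le_mul_of_nonneg_left (by linarith) hM
      _ = _ := by ring
  have hI : ∫ z, (S z (Φ N z) - S z f) ^ 2 ∂L N ≤ |M| * (|M| * (C₂ / N + κ * √(C₂ / N)) +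
      κ * (K * ∫ z, F.margN z s (fun x => A N z x x) ∂L N)) := by
    have hκ : 0 ≤ κ := abs_nonneg _
    have c1 : ∫ z, (S z (fun _ _ => 1) - I) ^ 2 ∂L N ≤ C₂ / N := hC₂ N (L N) hN (hL N hN1)
    have c2 : ∫ z, |S z (fun _ _ => 1) - I| ∂L N ≤ √(C₂ / N) :=
      (integral_abs_le_sqrt _ m5).trans (Real.sqrt_le_sqrt c1)
    have i1 := (m5.pow 2).integrable (L N)
    have i2 := m5.abs.integrable (L N)
    have i3 := m3.integrable (L N)
    have i4 : Integrable (fun z => (S z (fun _ _ => 1) - I) ^ 2 +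
        κ * |S z (fun _ _ => 1) - I|) (L N) := i1.add (i2.const_mul κ)
    calc _ ≤ ∫ z, |M| * (|M| * ((S z (fun _ _ => 1) - I) ^ 2 +
          κ * |S z (fun _ _ => 1) - I|) + κ * S z (ψ z)) ∂L N :=
          integral_mono (((m1.sub m2).pow 2).integrable _)
            (((i4.const_mul _).add (i3.const_mul _)).const_mul _) hpt
      _ = |M| * (|M| * (∫ z, (S z (fun _ _ => 1) - I) ^ 2 ∂L N +
          κ * ∫ z, |S z (fun _ _ => 1) - I| ∂L N) + κ * ∫ z, S z (ψ z) ∂L N) := by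
          rw [integral_const_mul, integral_add (i4.const_mul _)
            (i3.const_mul _), integral_const_mul, integral_const_mul,
            integral_add i1 (i2.const_mul _), integral_const_mul]
      _ ≤ _ := by gcongr
  calc ∫ z, (S z (Φ N z) - F.muInt (e s) t f) ^ 2 ∂L N
      ≤ ∫ z, (2 * (S z (Φ N z) - S z f) ^ 2 + 2 * (S z f - F.muInt (e s) t f) ^ 2) ∂L N := by
        refine integral_mono (((m1.sub (BddMeasurable.const _)).pow 2).integrable _)
          ((((BddMeasurable.const 2).mul ((m1.sub m2).pow 2)).add ((BddMeasurable.const 2).mul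
            ((m2.sub (BddMeasurable.const _)).pow 2))).integrable _) fun z => ?_
        simp only
        nlinarith [sq_nonneg ((S z (Φ N z) - S z f) - (S z f - F.muInt (e s) t f))]
    _ ≤ _ := by
        rw [integral_add (((BddMeasurable.const 2).mul ((m1.sub m2).pow 2)).integrable _)
          (((BddMeasurable.const 2).mul ((m2.sub (BddMeasurable.const _)).pow 2)).integrable _),
          integral_const_mul, integral_const_mul]
        have := hC₁ N (L N) hN (hL N hN1)
        gcongr

end IsDominated

end FeynmanKac

end FFBS

/-! ### L² consistency for the functions of the theorem -/

namespace FFBS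

lemma measurable_segment {X : Type*} [MeasurableSpace X] (s t : ℕ) :
    Measurable (segment s : Path X t → Finset.Icc s t → X) :=
  measurable_pi_lambda _ fun _ => measurable_pi_apply _

/-- For bounded measurable functions the L² seminorm is the square root of the second moment, so the
moment estimates can be used as they stand. -/
lemma tendsto_eLpNorm_two {Ω : Type*} [MeasurableSpace Ω] {P : Measure Ω} [IsProbabilityMeasure P]
    {f : ℕ → Ω → ℝ} (hf : ∀ᶠ N in atTop, BddMeasurable (f N))
    (hlim : Tendsto (fun N => ∫ ω, f N ω ^ 2 ∂P) atTop (𝓝 0)) :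
    Tendsto (fun N => eLpNorm (f N) 2 P) atTop (𝓝 0) := by
  have h1 := ENNReal.tendsto_ofReal (hlim.sqrt)
  rw [Real.sqrt_zero, ENNReal.ofReal_zero] at h1
  refine h1.congr' (hf.mono fun N hN => ?_)
  obtain ⟨C, hC⟩ := hN.2
  have hL : MemLp (f N) 2 P := MemLp.of_bound hN.1.aestronglyMeasurable C (ae_of_all _ hC)
  change _ = eLpNorm (f N) 2 P
  rw [hL.eLpNorm_eq_integral_rpow_norm two_ne_zero ENNReal.ofNat_ne_top, Real.sqrt_eq_rpow]
  simp

namespace FeynmanKac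

variable {X : Type*} [MeasurableSpace X] {F : FeynmanKac X} {m : ℕ → X → X → ℝ}

/-- The function `T_s^N[h_{0:s}] c_t + h̃_{s:t}`. -/
noncomputable def obsN (F : FeynmanKac X) (m : ℕ → X → X → ℝ) {N : ℕ} (z : Cloud X N) {s t : ℕ}
    (hst : s ≤ t) (q : ℕ → X → X → ℝ) (c : X → ℝ) (f : (Finset.Icc s t → X) → ℝ)
    (p : Path X t) : ℝ :=
  F.bwN m z s (additive q 0 s) (point p s hst) * c (last p) + f (segment s p)

/-- The function `T_s[h_{0:s}] c_t + h̃_{s:t}`. -/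
noncomputable def obs (F : FeynmanKac X) (m : ℕ → X → X → ℝ) {s t : ℕ}
    (hst : s ≤ t) (q : ℕ → X → X → ℝ) (c : X → ℝ) (f : (Finset.Icc s t → X) → ℝ)
    (p : Path X t) : ℝ :=
  F.bw m s (additive q 0 s) (point p s hst) * c (last p) + f (segment s p)

namespace IsDominated

variable {ν : Measure X} {G σ : ℝ} (h : F.IsDominated ν m G σ) {q r : ℕ → X → X → ℝ}

include h

section Obs

variable {s t : ℕ} (hst : s ≤ t) (hq : ∀ ℓ < s, BddMeasurable (Function.uncurry (q ℓ)))
  {c : X → ℝ} (hc : BddMeasurable c) {f : (Finset.Icc s t → X) → ℝ} (hf : BddMeasurable f)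

include hq hc hf

lemma bddMeasurable_obs : BddMeasurable (F.obs m hst q c f) :=
  (((h.bddMeasurable_bw (bddMeasurable_additive hq)).comp (measurable_point hst)).mul
    (hc.comp measurable_last)).add (hf.comp (measurable_segment s t))

lemma bddMeasurable_obsN {N : ℕ} [NeZero N] :
    BddMeasurable fun w : Cloud X N × Path X t => F.obsN m w.1 hst q c f w.2 :=
  (((h.bddMeasurable_bwN hq).comp (φ := fun w : Cloud X N × Path X t => (w.1, point w.2 s hst))
    (measurable_fst.prodMk ((measurable_point hst).comp measurable_snd))).mul
    (hc.comp (measurable_last.comp measurable_snd))).add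
    (hf.comp ((measurable_segment s t).comp measurable_snd))

lemma exists_abs_obsN_le : ∃ K, 0 ≤ K ∧ ∀ (N : ℕ) [NeZero N] (z : Cloud X N) (p : Path X t),
    |F.obsN m z hst q c f p| ≤ K := by
  obtain ⟨K₁, hK₁, h1⟩ := h.exists_abs_bwN_le hq
  obtain ⟨K₂, h2⟩ := hc.2
  obtain ⟨K₃, h3⟩ := hf.2
  refine ⟨K₁ * |K₂| + |K₃|, by positivity, fun N _ z p => (abs_add_le _ _).trans
    (add_le_add ?_ ((h3 _).trans (le_abs_self _)))⟩
  rw [abs_mul]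
  exact mul_le_mul (h1 N z _) ((h2 _).trans (le_abs_self _)) (abs_nonneg _) hK₁

omit h hq hf in
lemma exists_abs_obsN_sub_obs_le : ∃ K, 0 ≤ K ∧ ∀ (N : ℕ) (z : Cloud X N) (p : Path X t),
    |F.obsN m z hst q c f p - F.obs m hst q c f p| ≤ K * |F.bwErr m q z s (point p s hst)| := by
  obtain ⟨K₂, h2⟩ := hc.2
  refine ⟨|K₂|, abs_nonneg _, fun N z p => ?_⟩
  have e1 : F.obsN m z hst q c f p - F.obs m hst q c f p =
      c (last p) * F.bwErr m q z s (point p s hst) := by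
    simp only [obsN, obs, bwErr]; ring
  rw [e1, abs_mul]
  exact mul_le_mul_of_nonneg_right ((h2 _).trans (le_abs_self _)) (abs_nonneg _)

end Obs

lemma exists_abs_bwErr_le {s : ℕ} (hq : ∀ ℓ < s, BddMeasurable (Function.uncurry (q ℓ))) :
    ∃ K, ∀ (N : ℕ) [NeZero N] (z : Cloud X N) (x : X), |F.bwErr m q z s x| ≤ K := by
  obtain ⟨K₁, hK₁, h1⟩ := h.exists_abs_bwN_le hq
  obtain ⟨K₂, h2⟩ := (h.bddMeasurable_bw (bddMeasurable_additive (s := 0) hq)).2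
  exact ⟨K₁ + K₂, fun N _ z x => (abs_sub _ _).trans (add_le_add (h1 N z x) (h2 x))⟩

/-- The `L²` consistency of `μ^BS_{e_s,t}`, for the laws of the particles. -/
theorem tendsto_integral_muBS_obsN_sub_sq (L : (N : ℕ) → Measure (Cloud X N))
    (hL : ∀ N, 1 ≤ N → F.IsParticleLaw (L N)) {s t : ℕ} (hst : s ≤ t)
    (hq : ∀ ℓ < s, BddMeasurable (Function.uncurry (q ℓ)))
    (hr : ∀ ℓ < s, BddMeasurable (Function.uncurry (r ℓ)))
    {c d : X → ℝ} (hc : BddMeasurable c) (hd : BddMeasurable d)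
    {f g : (Finset.Icc s t → X) → ℝ} (hf : BddMeasurable f) (hg : BddMeasurable g) :
    Tendsto (fun N => ∫ z : Cloud X N,
      (F.muBS m z (e s) t (fun p p' => F.obsN m z hst q c f p * F.obsN m z hst r d g p') -
        F.muInt (e s) t (fun p p' => F.obs m hst q c f p * F.obs m hst r d g p')) ^ 2 ∂L N)
      atTop (𝓝 0) := by
  obtain ⟨K₁, hK₁, h1⟩ := exists_abs_obsN_sub_obs_le (F := F) (m := m) (q := q) hst hc (f := f)
  obtain ⟨K₂, hK₂, h2⟩ := exists_abs_obsN_sub_obs_le (F := F) (m := m) (q := r) hst hd (f := g)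
  obtain ⟨B₁, hB₁⟩ := (h.bddMeasurable_obs hst hq hc hf).2
  obtain ⟨B₂, hB₂, hB₂'⟩ := h.exists_abs_obsN_le hst hr hd hg
  obtain ⟨E₁, hE₁⟩ := h.exists_abs_bwErr_le hq
  obtain ⟨E₂, hE₂⟩ := h.exists_abs_bwErr_le hr
  refine h.tendsto_integral_muBS_sub_sq L hL hst
    (A := fun N z x y => B₂ * K₁ * |F.bwErr m q z s x| + |B₁| * K₂ * |F.bwErr m r z s y|)
    (M := B₂ * K₁ * E₁ + |B₁| * K₂ * E₂)
    (((h.bddMeasurable_obs hst hq hc hf).comp measurable_fst).mul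
      ((h.bddMeasurable_obs hst hr hd hg).comp measurable_snd))
    (fun N hN => ?_) (fun N hN => ?_) (fun N z x y => by positivity) (fun N hN z x y => ?_)
    (fun N hN z z' x y hz => ?_) (fun N hN z p p' => ?_) ?_
  · have : NeZero N := ⟨by omega⟩
    exact ((h.bddMeasurable_obsN hst hq hc hf).comp
        (φ := fun w : Cloud X N × Path X t × Path X t => (w.1, w.2.1)) (by fun_prop)).mul
      ((h.bddMeasurable_obsN hst hr hd hg).comp
        (φ := fun w : Cloud X N × Path X t × Path X t => (w.1, w.2.2)) (by fun_prop))
  · have : NeZero N := ⟨by omega⟩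
    exact ((BddMeasurable.const _).mul ((h.bddMeasurable_bwErr hq).comp
        (φ := fun w : Cloud X N × X × X => (w.1, w.2.1)) (by fun_prop)).abs).add
      ((BddMeasurable.const _).mul ((h.bddMeasurable_bwErr hr).comp
        (φ := fun w : Cloud X N × X × X => (w.1, w.2.2)) (by fun_prop)).abs)
  · have : NeZero N := ⟨by omega⟩
    have := hE₁ N z x
    have := hE₂ N z y
    gcongr
  · have : NeZero N := ⟨by omega⟩
    simp only [h.bwErr_congr s hz]
  · have : NeZero N := ⟨by omega⟩
    set a := F.obsN m z hst q c f p
    set a' := F.obs m hst q c f p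
    set b := F.obsN m z hst r d g p'
    set b' := F.obs m hst r d g p'
    -- The particle factor `b` has a bound uniform in `N` and the limit factor `a'` is bounded;
    -- these two bounds are the coefficients in the choice of `A`.
    have e1 : a * b - a' * b' = b * (a - a') + a' * (b - b') := by ring
    rw [e1]
    refine (abs_add_le _ _).trans ?_
    rw [abs_mul, abs_mul, mul_assoc, mul_assoc]
    exact add_le_add (mul_le_mul (hB₂' N z p') (h1 N z p) (abs_nonneg _) hB₂)
      (mul_le_mul ((hB₁ p).trans (le_abs_self _)) (h2 N z p') (abs_nonneg _) (abs_nonneg _))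
  · have l1 := ((h.tendsto_integral_margN_bwErr L hL s hq).const_mul (B₂ * K₁)).add
      ((h.tendsto_integral_margN_bwErr L hL s hr).const_mul (|B₁| * K₂))
    rw [mul_zero, mul_zero, add_zero] at l1
    refine l1.congr' (eventually_atTop.2 ⟨1, fun N hN => ?_⟩)
    have : NeZero N := ⟨by omega⟩
    have hp := (hL N hN).prob
    rw [← integral_const_mul, ← integral_const_mul, ← integral_add
      (((h.bddMeasurable_margN_bwErr hq).integrable _).const_mul _)
      (((h.bddMeasurable_margN_bwErr hr).integrable _).const_mul _)]
    refine integral_congr_ae (ae_of_all _ fun z => ?_)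
    simp only [margN, Finset.sum_add_distrib, ← Finset.mul_sum]
    ring

lemma bddMeasurable_muBS_obsN {N : ℕ} [NeZero N] {s t : ℕ} (hst : s ≤ t)
    (hq : ∀ ℓ < s, BddMeasurable (Function.uncurry (q ℓ)))
    (hr : ∀ ℓ < s, BddMeasurable (Function.uncurry (r ℓ)))
    {c d : X → ℝ} (hc : BddMeasurable c) (hd : BddMeasurable d)
    {f g : (Finset.Icc s t → X) → ℝ} (hf : BddMeasurable f) (hg : BddMeasurable g) :
    BddMeasurable fun z : Cloud X N =>
      F.muBS m z (e s) t (fun p p' => F.obsN m z hst q c f p * F.obsN m z hst r d g p') :=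
  h.bddMeasurable_muBS t
    (f := fun z p p' => F.obsN m z hst q c f p * F.obsN m z hst r d g p')
    (((h.bddMeasurable_obsN hst hq hc hf).comp
        (φ := fun w : Cloud X N × Path X t × Path X t => (w.1, w.2.1)) (by fun_prop)).mul
      ((h.bddMeasurable_obsN hst hr hd hg).comp
        (φ := fun w : Cloud X N × Path X t × Path X t => (w.1, w.2.2)) (by fun_prop)))

section Filter

variable {Ω : Type*} [MeasurableSpace Ω] {P : Measure Ω} [IsProbabilityMeasure P]
  {ξ : (N : ℕ) → ℕ → Fin N → Ω → X} {A : (N : ℕ) → ℕ → Fin N → Ω → Fin N}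
  (hfilter : ∀ N, 1 ≤ N → IsBootstrapFilter F P (ξ N) (A N))

include hfilter

/-- The law of the particles. -/
lemma isParticleLaw_map (N : ℕ) (hN : 1 ≤ N) :
    F.IsParticleLaw (P.map fun ω => (fun u i => ξ N u i ω : Cloud X N)) := by
  have : NeZero N := ⟨by omega⟩
  exact (hfilter N hN).isParticleLaw h.pot_pos

omit h [IsProbabilityMeasure P] in
lemma integral_map_cloud {N : ℕ} (hN : 1 ≤ N) {f : Cloud X N → ℝ} (hf : BddMeasurable f) :
    ∫ z, f z ∂P.map (fun ω => (fun u i => ξ N u i ω : Cloud X N)) =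
      ∫ ω, f (fun u i => ξ N u i ω) ∂P :=
  integral_map (hfilter N hN).measurable_cloud.aemeasurable hf.1.aestronglyMeasurable

/-- The `L²` consistency of `μ^BS_{e_s,t}`. -/
theorem tendsto_eLpNorm_muBS_obsN_sub {s t : ℕ} (hst : s ≤ t)
    (hq : ∀ ℓ < s, BddMeasurable (Function.uncurry (q ℓ)))
    (hr : ∀ ℓ < s, BddMeasurable (Function.uncurry (r ℓ)))
    {c d : X → ℝ} (hc : BddMeasurable c) (hd : BddMeasurable d)
    {f g : (Finset.Icc s t → X) → ℝ} (hf : BddMeasurable f) (hg : BddMeasurable g) :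
    Tendsto (fun N => eLpNorm (fun ω =>
        F.muBS m (fun u i => ξ N u i ω) (e s) t (fun p p' =>
          F.obsN m (fun u i => ξ N u i ω) hst q c f p *
            F.obsN m (fun u i => ξ N u i ω) hst r d g p') -
        F.muInt (e s) t (fun p p' => F.obs m hst q c f p * F.obs m hst r d g p')) 2 P)
      atTop (𝓝 0) := by
  have hb (N : ℕ) (hN : 1 ≤ N) : BddMeasurable fun z : Cloud X N =>
      F.muBS m z (e s) t (fun p p' => F.obsN m z hst q c f p * F.obsN m z hst r d g p') -
        F.muInt (e s) t (fun p p' => F.obs m hst q c f p * F.obs m hst r d g p') := by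
    have : NeZero N := ⟨by omega⟩
    exact (h.bddMeasurable_muBS_obsN hst hq hr hc hd hf hg).sub (BddMeasurable.const _)
  refine tendsto_eLpNorm_two (eventually_atTop.2 ⟨1, fun N hN =>
    (hb N hN).comp (hfilter N hN).measurable_cloud⟩) ?_
  refine (h.tendsto_integral_muBS_obsN_sub_sq _ (h.isParticleLaw_map hfilter) hst hq hr hc hd hf
    hg).congr' (eventually_atTop.2 ⟨1, fun N hN => ?_⟩)
  exact integral_map_cloud hfilter hN ((hb N hN).pow 2)

end Filter

end IsDominated

end FeynmanKac

end FFBS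

/-! ### Identification of the asymptotic variance -/

namespace FFBS

section Paths

variable {X : Type*}

lemma additive_congr {q : ℕ → X → X → ℝ} {s t : ℕ} {p p' : Path X t}
    (hpp : ∀ u, s ≤ u → ∀ hu : u ≤ t, point p u hu = point p' u hu) :
    additive q s t p = additive q s t p' := by
  refine Finset.sum_congr rfl fun ℓ _ => ?_
  have := Finset.mem_Ico.1 ℓ.2
  rw [hpp ℓ this.1, hpp (ℓ + 1) (by omega)]

lemma additive_add {q : ℕ → X → X → ℝ} {s t : ℕ} (hst : s ≤ t) {p₀ : Path X s} {p : Path X t}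
    (hp : ∀ u, ∀ hu : u ≤ s, point p u (hu.trans hst) = point p₀ u hu) :
    additive q 0 t p = additive q 0 s p₀ + additive q s t p := by
  simp only [additive_eq_sum_Ico]
  rw [← Finset.sum_Ico_consecutive _ s.zero_le hst]
  congr 1
  refine Finset.sum_congr rfl fun ℓ hℓ => ?_
  have := (Finset.mem_Ico.1 hℓ).2
  rw [pointOr_of_le p (this.le.trans hst), pointOr_of_le p (show ℓ + 1 ≤ t by omega),
    pointOr_of_le p₀ this.le, pointOr_of_le p₀ this, hp ℓ this.le, hp (ℓ + 1) this]

end Paths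

namespace FeynmanKac

variable {X : Type*} [MeasurableSpace X] (F : FeynmanKac X) {m : ℕ → X → X → ℝ} {G : ℝ}
  (hG : ∀ t x, F.pot t x ≤ G)

include hG

lemma bddMeasurable_integral_Qpath {s t : ℕ} (hst : s ≤ t) {f : Path X t → ℝ}
    (hf : BddMeasurable f) : BddMeasurable fun p : Path X s => ∫ q, f q ∂F.Qpath s t p := by
  induction t, hst using Nat.le_induction with
  | base => simpa only [F.integral_Qpath_self hf] using hf
  | succ t hst ih =>
    simp only [F.integral_Qpath_succ hG hst hf]
    exact ih (F.bddMeasurable_push hG hf)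

/-- Integrals against `Q_{s+1:t}` of functions that agree along coupled paths. -/
lemma integral_Qpath_congr {s t : ℕ} (hst : s ≤ t) {f f' : Path X t → ℝ}
    (hf : BddMeasurable f) (hf' : BddMeasurable f') {p p' : Path X s} (hpp : last p = last p')
    (hff : ∀ q q' : Path X t, (∀ u, ∀ hu : u ≤ s, point q u (hu.trans hst) = point p u hu) →
      (∀ u, ∀ hu : u ≤ s, point q' u (hu.trans hst) = point p' u hu) →
      (∀ u, s ≤ u → ∀ hu : u ≤ t, point q u hu = point q' u hu) → f q = f' q') :
    ∫ q, f q ∂F.Qpath s t p = ∫ q, f' q ∂F.Qpath s t p' := by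
  induction t, hst using Nat.le_induction with
  | base =>
    rw [F.integral_Qpath_self hf, F.integral_Qpath_self hf']
    refine hff p p' (fun _ _ => rfl) (fun _ _ => rfl) fun u hu hu' => ?_
    obtain rfl := le_antisymm hu hu'
    exact hpp
  | succ t hst ih =>
    rw [F.integral_Qpath_succ hG hst hf, F.integral_Qpath_succ hG hst hf']
    refine ih (F.bddMeasurable_push hG hf) (F.bddMeasurable_push hG hf') fun q q' h1 h2 h3 => ?_
    have hl : last q = last q' := h3 t hst le_rfl
    simp only [push, hl]
    congr 1
    refine integral_congr_ae (ae_of_all _ fun y => hff _ _ (fun u hu => ?_) (fun u hu => ?_)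
      fun u hu hu' => ?_)
    · rw [point_snoc q y (hu.trans hst), h1]
    · rw [point_snoc q' y (hu.trans hst), h2]
    · rcases Nat.le_succ_iff.1 hu' with hu'' | rfl
      · rw [point_snoc q y hu'', point_snoc q' y hu'', h3 u hu hu'']
      · exact (last_snoc q y).trans (last_snoc q' y).symm

lemma integral_joint_eq {s t : ℕ} (hst : s ≤ t) {f : Path X t → ℝ} (hf : BddMeasurable f) :
    ∫ q, f q ∂F.joint t = ∫ p, ∫ q, f q ∂F.Qpath s t p ∂F.joint s := by
  induction t, hst using Nat.le_induction with
  | base => simp only [F.integral_Qpath_self hf]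
  | succ t hst ih =>
    rw [F.integral_joint_succ hG hf, ih (F.bddMeasurable_push hG hf)]
    simp only [F.integral_Qpath_succ hG hst hf]

lemma isFiniteKernel_Qmarg (s r : ℕ) : IsFiniteKernel (F.Qmarg s r) := by
  induction r with
  | zero => unfold Qmarg; infer_instance
  | succ r ih =>
    have := F.isFiniteKernel_Q hG (s + r)
    unfold Qmarg; infer_instance

/-- Both kernels obey the same one-step recursion, so the induction replaces `f` by `pushFun`. -/
lemma integral_Qmarg (s r : ℕ) {f : X → ℝ} (hf : BddMeasurable f) (p : Path X s) :
    ∫ y, f y ∂F.Qmarg s r (last p) = ∫ q, f (last q) ∂F.Qpath s (s + r) p := by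
  induction r generalizing f with
  | zero =>
    rw [Qmarg, Kernel.id_apply, integral_dirac' _ _ hf.1.stronglyMeasurable]
    exact (F.integral_Qpath_self (hf.comp measurable_last) p).symm
  | succ r ih =>
    have i1 := F.isFiniteKernel_Qmarg hG s r
    have i2 := F.isFiniteKernel_Q hG (s + r)
    rw [Qmarg, Kernel.integral_comp (hf.integrable _)]
    simp only [integral_Q]
    have e1 := ih (F.bddMeasurable_pushFun hG (s + r) hf)
    simp only [pushFun] at e1
    rw [e1]
    have e2 := F.integral_Qpath_succ hG (Nat.le_add_right s r) (hf.comp measurable_last) p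
    simp only [push, last_snoc] at e2
    exact e2.symm

lemma integral_Qmarg_sub {s t : ℕ} (hst : s ≤ t) {f : X → ℝ} (hf : BddMeasurable f)
    (p : Path X s) :
    ∫ y, f y ∂F.Qmarg s (t - s) (last p) = ∫ q, f (last q) ∂F.Qpath s t p := by
  obtain ⟨r, rfl⟩ := Nat.exists_eq_add_of_le hst
  rw [Nat.add_sub_cancel_left]
  exact F.integral_Qmarg hG s r hf p

/-- The bivariate measure without coalescence is the product measure. -/
lemma muInt_prod {b : ℕ → Bool} {t : ℕ} (hb : ∀ u ≤ t, b u = false) {f f' : Path X t → ℝ}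
    (hf : BddMeasurable f) (hf' : BddMeasurable f') :
    F.muInt b t (fun p p' => f p * f' p') = (∫ p, f p ∂F.joint t) * ∫ p, f' p ∂F.joint t := by
  have hff {t : ℕ} {f f' : Path X t → ℝ} (hf : BddMeasurable f) (hf' : BddMeasurable f') :
      BddMeasurable (Function.uncurry fun p p' => f p * f' p') :=
    (hf.comp measurable_fst).mul (hf'.comp measurable_snd)
  induction t with
  | zero =>
    rw [F.muInt_zero hG b (hff hf hf'), hb 0 le_rfl, cond_false, F.integral_joint_zero hG hf,
      F.integral_joint_zero hG hf']
    simp_rw [integral_const_mul]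
    rw [integral_mul_const]
  | succ t ih =>
    rw [F.muInt_succ hG b (hff hf hf'), hb (t + 1) le_rfl, F.integral_joint_succ hG hf,
      F.integral_joint_succ hG hf', ← ih (fun u hu => hb u (hu.trans (Nat.le_succ t)))
        (F.bddMeasurable_push hG hf) (F.bddMeasurable_push hG hf')]
    congr 1
    funext p p'
    simp only [pairPush, push, cond_false, integral_const_mul]
    rw [integral_mul_const]
    ring

/-- Before time s the coordinates are independent, and at time s the second is put on the first. The
history of the second coordinate is then seen only through its mass, whence the factor γ_s(1). -/
lemma muInt_e_last (s : ℕ) {a a' : X → ℝ} (ha : BddMeasurable a) (ha' : BddMeasurable a') :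
    F.muInt (e s) s (fun p p' => a (last p) * a' (last p')) =
      (∫ _, 1 ∂F.marg s) * ∫ x, a x * a' x ∂F.marg s := by
  have hff : BddMeasurable (Function.uncurry fun p p' : Path X s => a (last p) * a' (last p')) :=
    (ha.comp (measurable_last.comp measurable_fst)).mul
      (ha'.comp (measurable_last.comp measurable_snd))
  cases s with
  | zero =>
    rw [F.muInt_zero hG _ hff, e_self, cond_true, F.integral_marg_zero hG (BddMeasurable.const 1),
      F.integral_marg_zero hG (ha.mul ha')]
    simp [last]
  | succ s =>
    have h1 : BddMeasurable fun p : Path X s => F.pushFun s (fun x => a x * a' x) (last p) :=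
      (F.bddMeasurable_pushFun hG s (ha.mul ha')).comp measurable_last
    have h2 : BddMeasurable fun p : Path X s => F.pot s (last p) :=
      (F.bddMeasurable_pot hG s).comp measurable_last
    rw [F.muInt_succ hG _ hff, e_self, F.integral_marg_succ hG s (BddMeasurable.const 1),
      F.integral_marg_succ hG s (ha.mul ha'), F.integral_marg s (F.bddMeasurable_pushFun hG s
        (ha.mul ha')), F.integral_marg s (F.bddMeasurable_pushFun hG s (BddMeasurable.const 1))]
    have h3 : ∀ x, F.pushFun s (fun _ => 1) x = F.pot s x := fun x => by simp [pushFun]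
    simp only [h3]
    rw [mul_comm, ← F.muInt_prod hG (b := e (s + 1)) (fun u hu => e_of_ne (by omega)) h1 h2]
    congr 1
    funext p p'
    simp only [pairPush, pushFun, cond_true, last_snoc]
    ring

/-- The bivariate measure with one coalescence, in terms of the state at the coalescence time. -/
lemma muInt_e_eq {s t : ℕ} (hst : s ≤ t) {f f' : Path X t → ℝ} (hf : BddMeasurable f)
    (hf' : BddMeasurable f') :
    F.muInt (e s) t (fun p p' => f p * f' p') =
      F.muInt (e s) s (fun p p' => (∫ q, f q ∂F.Qpath s t p) * ∫ q, f' q ∂F.Qpath s t p') := by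
  induction t, hst using Nat.le_induction with
  | base => simp only [F.integral_Qpath_self hf, F.integral_Qpath_self hf']
  | succ t hst ih =>
    have hff : BddMeasurable (Function.uncurry fun p p' : Path X (t + 1) => f p * f' p') :=
      (hf.comp measurable_fst).mul (hf'.comp measurable_snd)
    -- After time `s` the coordinates move independently, so a product of functions is pushed to the
    -- product of the pushes.
    rw [F.muInt_succ hG _ hff, e_of_ne (by omega)]
    simp only [F.integral_Qpath_succ hG hst hf, F.integral_Qpath_succ hG hst hf']
    rw [← ih (F.bddMeasurable_push hG hf) (F.bddMeasurable_push hG hf')]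
    congr 1
    funext p p'
    simp only [pairPush, push, cond_false, integral_const_mul]
    rw [integral_mul_const]
    ring

omit hG in
/-- The mean of `g_t` under `Q_{s+1:t}(x, ·)`. -/
noncomputable def massAfter (F : FeynmanKac X) (s t : ℕ) (x : X) : ℝ :=
  ∫ q, F.pot t (last q) ∂F.Qpath s t (fun _ => x)

omit hG in
/-- The mean of `g_t (h̃_{s:t} - κ)` under `Q_{s+1:t}(x, ·)`. -/
noncomputable def centredAfter (F : FeynmanKac X) (q : ℕ → X → X → ℝ) (κ : ℝ) (s t : ℕ) (x : X) :
    ℝ :=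
  ∫ p, F.pot t (last p) * (additive q s t p - κ) ∂F.Qpath s t (fun _ => x)

omit hG in
/-- The function whose square is integrated in the asymptotic variance. -/
noncomputable def influence (F : FeynmanKac X) (m : ℕ → X → X → ℝ) (q : ℕ → X → X → ℝ) (κ : ℝ)
    (s t : ℕ) (x : X) : ℝ :=
  F.bw m s (additive q 0 s) x * F.massAfter s t x + F.centredAfter q κ s t x

lemma bddMeasurable_massAfter {s t : ℕ} (hst : s ≤ t) : BddMeasurable (F.massAfter s t) :=
  (F.bddMeasurable_integral_Qpath hG hst ((F.bddMeasurable_pot hG t).comp measurable_last)).comp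
    (φ := fun x : X => (fun _ => x : Path X s)) (by fun_prop)

section Centred

variable {q : ℕ → X → X → ℝ} {s t : ℕ} (hst : s ≤ t)
  (hq : ∀ ℓ < t, BddMeasurable (Function.uncurry (q ℓ))) (κ : ℝ)

include hq

lemma bddMeasurable_pot_mul_additive_sub : BddMeasurable fun p : Path X t =>
    F.pot t (last p) * (additive q s t p - κ) :=
  ((F.bddMeasurable_pot hG t).comp measurable_last).mul
    ((bddMeasurable_additive hq).sub (BddMeasurable.const κ))

include hst

lemma bddMeasurable_centredAfter : BddMeasurable (F.centredAfter q κ s t) :=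
  (F.bddMeasurable_integral_Qpath hG hst (F.bddMeasurable_pot_mul_additive_sub hG hq κ)).comp
    (φ := fun x : X => (fun _ => x : Path X s)) (by fun_prop)

/-- Integration against `Q_{s+1:t}` of functions that factorize at time `s`. -/
lemma integral_Qpath_factor (p : Path X s) (β : ℝ) {f : Path X t → ℝ} (hf : BddMeasurable f)
    (hfp : ∀ q' : Path X t, (∀ u, ∀ hu : u ≤ s, point q' u (hu.trans hst) = point p u hu) →
      f q' = β * F.pot t (last q') + F.pot t (last q') * (additive q s t q' - κ)) :
    ∫ q', f q' ∂F.Qpath s t p =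
      β * F.massAfter s t (last p) + F.centredAfter q κ s t (last p) := by
  have i1 := F.isFiniteKernel_Qpath hG s t
  have b1 : BddMeasurable fun q' : Path X t => β * F.pot t (last q') :=
    (BddMeasurable.const β).mul ((F.bddMeasurable_pot hG t).comp measurable_last)
  have b2 := F.bddMeasurable_pot_mul_additive_sub (s := s) hG hq κ
  rw [massAfter, centredAfter, ← integral_const_mul, ← integral_add (b1.integrable _)
    (b2.integrable _)]
  -- The path kernel depends on the past through its last point only. The path `p` can therefore be
  -- exchanged for the constant path at that point, which is the one used in `massAfter` and
  -- `centredAfter`.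
  refine F.integral_Qpath_congr hG hst hf (b1.add b2) rfl fun q₁ q₂ h1 _ h3 => ?_
  have hl : last q₁ = last q₂ := h3 t hst le_rfl
  rw [hfp q₁ h1, additive_congr h3, hl]

end Centred

namespace IsDominated

variable {F} {ν : Measure X} {σ : ℝ} (h : F.IsDominated ν m G σ)

section Influence

variable {q : ℕ → X → X → ℝ} {s t : ℕ} (hst : s ≤ t)
  (hq : ∀ ℓ < t, BddMeasurable (Function.uncurry (q ℓ))) (κ : ℝ)

omit hG
include h hst hq

lemma bddMeasurable_influence : BddMeasurable (F.influence m q κ s t) :=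
  ((h.bddMeasurable_bw (bddMeasurable_additive fun ℓ hℓ => hq ℓ (hℓ.trans_le hst))).mul
    (F.bddMeasurable_massAfter h.pot_le hst)).add (F.bddMeasurable_centredAfter h.pot_le hst hq κ)

/-- The functional splits at time s. The future part depends on the present point only, which the
backward path kernel keeps, and the past part is averaged into T_s. -/
lemma G_additive (x : X) :
    F.G m s t (fun y => F.pot t (last y) * (additive q 0 t y - κ)) x = F.influence m q κ s t x := by
  have b0 := F.bddMeasurable_pot_mul_additive_sub (s := 0) h.pot_le hq κ
  have hqs : BddMeasurable (additive q 0 s : Path X s → ℝ) :=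
    bddMeasurable_additive fun ℓ hℓ => hq ℓ (hℓ.trans_le hst)
  have e1 (p : Path X s) : ∫ y, F.pot t (last y) * (additive q 0 t y - κ) ∂F.Qpath s t p =
      F.massAfter s t (last p) * additive q 0 s p + F.centredAfter q κ s t (last p) := by
    rw [F.integral_Qpath_factor h.pot_le hst hq κ p (additive q 0 s p) b0 fun q' hq' => by
      rw [additive_add hst hq']; ring]
    ring
  have b1 := F.bddMeasurable_massAfter h.pot_le hst
  have b2 := F.bddMeasurable_centredAfter h.pot_le hst hq κ
  simp only [FeynmanKac.G, e1]
  rw [h.bw_add ((b1.comp measurable_last).mul hqs) (b2.comp measurable_last),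
    h.bw_last_mul b1 hqs, h.bw_last b2, influence]
  ring

/-- Integrating out the future gives the same `influence` when the past functional is replaced by
its backward mean at x_s. At the coalescence both coordinates sit at the same point, hence the
square. -/
lemma muInt_influence :
    F.muInt (e s) t (fun p p' =>
      (F.pot t (last p) * (F.bw m s (additive q 0 s) (point p s hst) + additive q s t p - κ)) *
      (F.pot t (last p') * (F.bw m s (additive q 0 s) (point p' s hst) + additive q s t p' - κ))) =
      (∫ _, 1 ∂F.marg s) * ∫ x, F.influence m q κ s t x ^ 2 ∂F.marg s := by
  have hqs : BddMeasurable (additive q 0 s : Path X s → ℝ) :=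
    bddMeasurable_additive fun ℓ hℓ => hq ℓ (hℓ.trans_le hst)
  have b0 : BddMeasurable fun p : Path X t =>
      F.pot t (last p) * (F.bw m s (additive q 0 s) (point p s hst) + additive q s t p - κ) :=
    ((h.bddMeasurable_pot t).comp measurable_last).mul ((((h.bddMeasurable_bw hqs).comp
      (measurable_point hst)).add (bddMeasurable_additive hq)).sub (BddMeasurable.const κ))
  have e1 (p : Path X s) : ∫ p, F.pot t (last p) * (F.bw m s (additive q 0 s) (point p s hst) +
      additive q s t p - κ) ∂F.Qpath s t p = F.influence m q κ s t (last p) := by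
    rw [F.integral_Qpath_factor h.pot_le hst hq κ p (F.bw m s (additive q 0 s) (last p)) b0
      fun q' hq' => by rw [hq' s le_rfl, point_self]; ring, influence]
  rw [F.muInt_e_eq h.pot_le hst b0 b0]
  simp only [e1]
  rw [F.muInt_e_last h.pot_le s (h.bddMeasurable_influence hst hq κ)
    (h.bddMeasurable_influence hst hq κ)]
  simp only [pow_two]

-- Mass conservation along the semigroup: Q_{s+1:t} carries γ_s to γ_t.
omit hq in
lemma integral_massAfter : ∫ x, F.massAfter s t x ∂F.marg s = ∫ x, F.pot t x ∂F.marg t := by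
  have hp := h.bddMeasurable_pot t
  have e1 (p : Path X s) : F.massAfter s t (last p) = ∫ q, F.pot t (last q) ∂F.Qpath s t p := by
    rw [massAfter, ← F.integral_Qmarg_sub h.pot_le hst hp, ← F.integral_Qmarg_sub h.pot_le hst hp]
    rfl
  rw [F.integral_marg s (F.bddMeasurable_massAfter h.pot_le hst), F.integral_marg t hp,
    F.integral_joint_eq h.pot_le hst (hp.comp measurable_last)]
  simp only [e1]

/-- The summands of the asymptotic variance. -/
lemma asymptVar_term_eq :
    (∫ x, (F.G m s t (fun y => F.pot t (last y) * (additive q 0 t y - κ)) x) ^ 2 ∂F.pred s) /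
      (∫ x, (∫ y, F.pot t y ∂F.Qmarg s (t - s) x) ∂F.pred s) ^ 2 =
    F.muInt (e s) t (fun p p' =>
      (F.pot t (last p) * (F.bw m s (additive q 0 s) (point p s hst) + additive q s t p - κ)) *
      (F.pot t (last p') * (F.bw m s (additive q 0 s) (point p' s hst) + additive q s t p' - κ))) /
      (∫ x, F.pot t x ∂F.marg t) ^ 2 := by
  have e1 (x : X) : ∫ y, F.pot t y ∂F.Qmarg s (t - s) x = F.massAfter s t x :=
    F.integral_Qmarg_sub h.pot_le hst (h.bddMeasurable_pot t) fun _ => x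
  have hc := (h.integral_marg_pos s (BddMeasurable.const 1) fun _ => one_pos).ne'
  have hg := (h.integral_marg_pos t (h.bddMeasurable_pot t) (h.pot_pos t)).ne'
  -- The normalization of η_s enters once in the numerator and twice in the denominator; the surplus
  -- is the factor γ_s(1) contributed by the coalesced pair.
  simp only [h.G_additive hst hq κ, e1, h.integral_pred]
  rw [h.muInt_influence hst hq κ, h.integral_massAfter hst]
  field_simp

end Influence

end IsDominated

end FeynmanKac

end FFBS

/-! ### Convergence in probability and the FFBS estimator -/

namespace FFBS

section ConvergenceInProbability

variable {Ω : Type*} [MeasurableSpace Ω] {P : Measure Ω}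

/-- Continuous mapping for convergence in probability to constants. -/
lemma tendstoInMeasure_map₂ {Y Z : ℕ → Ω → ℝ} {a b : ℝ}
    (hY : TendstoInMeasure P Y atTop fun _ => a) (hZ : TendstoInMeasure P Z atTop fun _ => b)
    {φ : ℝ → ℝ → ℝ} (hφ : ContinuousAt (fun p : ℝ × ℝ => φ p.1 p.2) (a, b)) :
    TendstoInMeasure P (fun N ω => φ (Y N ω) (Z N ω)) atTop fun _ => φ a b := by
  rw [tendstoInMeasure_iff_dist] at hY hZ ⊢
  intro ε hε
  obtain ⟨δ, hδ, hδ'⟩ := Metric.continuousAt_iff.1 hφ ε hε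
  have hlim := (hY δ hδ).add (hZ δ hδ)
  rw [add_zero] at hlim
  refine tendsto_of_tendsto_of_tendsto_of_le_of_le tendsto_const_nhds hlim (fun _ => zero_le)
    fun N => (measure_mono fun ω hω => ?_).trans (measure_union_le _ _)
  by_contra hcon
  simp only [Set.mem_union, Set.mem_ofPred_eq, not_or, not_le] at hcon
  have := hδ' (x := (Y N ω, Z N ω)) (by rw [Prod.dist_eq]; exact max_lt hcon.1 hcon.2)
  exact absurd hω (not_le.2 this)

lemma tendstoInMeasure_const_fun (a : ℝ) :
    TendstoInMeasure P (fun (_ : ℕ) (_ : Ω) => a) atTop fun _ => a := by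
  rw [tendstoInMeasure_iff_dist]
  intro ε hε
  simp [hε.not_ge]

lemma tendstoInMeasure_sum {ι : Type*} (S : Finset ι) {Y : ι → ℕ → Ω → ℝ} {a : ι → ℝ}
    (hY : ∀ i ∈ S, TendstoInMeasure P (Y i) atTop fun _ => a i) :
    TendstoInMeasure P (fun N ω => ∑ i ∈ S, Y i N ω) atTop fun _ => ∑ i ∈ S, a i := by
  classical
  induction S using Finset.induction_on with
  | empty => simpa using tendstoInMeasure_const_fun (P := P) 0
  | insert i S hi ih =>
    simp only [Finset.sum_insert hi]
    exact tendstoInMeasure_map₂ (φ := fun x y => x + y) (hY i (Finset.mem_insert_self i S))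
      (ih fun j hj => hY j (Finset.mem_insert_of_mem hj)) (by fun_prop)

/-- Convergence in `L¹` implies convergence in probability. -/
lemma tendstoInMeasure_of_integral_abs [IsProbabilityMeasure P] {Y : ℕ → Ω → ℝ} {a : ℝ}
    (hY : ∀ᶠ N in atTop, BddMeasurable (Y N))
    (hlim : Tendsto (fun N => ∫ ω, |Y N ω - a| ∂P) atTop (𝓝 0)) :
    TendstoInMeasure P Y atTop fun _ => a := by
  rw [tendstoInMeasure_iff_dist]
  intro ε hε
  have h1 := ENNReal.tendsto_ofReal (hlim.div_const ε)
  rw [zero_div, ENNReal.ofReal_zero] at h1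
  refine tendsto_of_tendsto_of_tendsto_of_le_of_le' tendsto_const_nhds h1
    (Eventually.of_forall fun _ => zero_le) (hY.mono fun N hN => ?_)
  have h2 := mul_meas_ge_le_integral_of_nonneg (μ := P) (f := fun ω => |Y N ω - a|)
    (ae_of_all _ fun ω => abs_nonneg _) ((hN.sub (BddMeasurable.const a)).abs.integrable P) ε
  rw [ENNReal.le_ofReal_iff_toReal_le (measure_ne_top _ _)
    (div_nonneg (integral_nonneg fun ω => abs_nonneg _) hε.le), le_div_iff₀ hε, mul_comm]
  exact h2

end ConvergenceInProbability

namespace FeynmanKac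

variable {X : Type*} [MeasurableSpace X] {F : FeynmanKac X} {m : ℕ → X → X → ℝ}

/-- The terminal weight is arbitrary so that the induction can absorb the last backward weight into
it. -/
lemma sum_prod_betaBS_eq {N : ℕ} (z : Cloud X N) (t : ℕ) (w : Fin N → ℝ) (f : Path X t → ℝ) :
    ∑ k : Fin (t + 1) → Fin N, w (k (Fin.last t)) *
      (∏ s : Fin t, F.betaBS m z s (k s.succ) (k s.castSucc)) * f (cloudPath z k) =
      ∑ a, w a * F.bwN m z t f (z t a) := by
  induction t generalizing w with
  | zero =>
    refine Fintype.sum_equiv (Equiv.funUnique (Fin 1) (Fin N)) _ _ fun k => ?_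
    have hp : (cloudPath z k : Path X 0) = fun _ => z 0 (k 0) := by
      funext i
      have hi : (i : ℕ) = 0 := Nat.le_zero.1 (Finset.mem_Iic.1 i.2)
      simp only [cloudPath, hi]
      rfl
    simp [bwN, hp]
  | succ t ih =>
    simp only [sum_snoc, bwN, Finset.mul_sum]
    refine Finset.sum_congr rfl fun a _ => ?_
    have h1 := ih (fun i => w a * F.beta m z t (z (t + 1) a) i) fun p => f (snoc p (z (t + 1) a))
    simp only [mul_assoc] at h1
    rw [← h1]
    refine Finset.sum_congr rfl fun k _ => ?_
    simp only [Fin.prod_univ_castSucc (n := t), Fin.succ_castSucc, Fin.succ_last,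
      Fin.snoc_castSucc (α := fun _ => Fin N), Fin.snoc_last (α := fun _ => Fin N),
      Fin.val_castSucc, Fin.val_last, cloudPath_snoc, betaBS]
    ring

lemma smoothN_eq {N : ℕ} (z : Cloud X N) (t : ℕ) (f : Path X t → ℝ) :
    F.smoothN m z t f = ∑ a, F.weight z t a * F.bwN m z t f (z t a) :=
  sum_prod_betaBS_eq z t (F.weight z t) f

lemma massN_succ_eq_margN {N : ℕ} (z : Cloud X N) (t : ℕ) :
    F.massN z (t + 1) = F.margN z t (F.pot t) := massN_succ z t

namespace IsDominated

variable {ν : Measure X} {G σ : ℝ} (h : F.IsDominated ν m G σ) {q : ℕ → X → X → ℝ}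

include h

/-- As a ratio of two unnormalized estimates, the estimator converges once numerator and denominator
do. -/
lemma smoothN_eq_div {N : ℕ} [NeZero N] (z : Cloud X N) (t : ℕ) (f : Path X t → ℝ) :
    F.smoothN m z t f =
      F.margN z t (fun x => F.pot t x * F.bwN m z t f x) / F.massN z (t + 1) := by
  have h1 := (h.massN_pos z t).ne'
  have h2 := (F.totalWeight_pos h.pot_pos z t).ne'
  have h3 : (N : ℝ) ≠ 0 := NeZero.ne _
  rw [smoothN_eq, massN_succ, margN]
  simp only [weight, div_mul_eq_mul_div]
  rw [← Finset.sum_div]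
  field_simp

lemma smooth_eq_div (t : ℕ) (f : Path X t → ℝ) :
    F.smooth m t f =
      (∫ x, F.pot t x * F.bw m t f x ∂F.marg t) / ∫ x, F.pot t x ∂F.marg t :=
  h.integral_filt t _

section Filter

variable {Ω : Type*} [MeasurableSpace Ω] {P : Measure Ω} [IsProbabilityMeasure P]
  {ξ : (N : ℕ) → ℕ → Fin N → Ω → X} {A : (N : ℕ) → ℕ → Fin N → Ω → Fin N}
  (hfilter : ∀ N, 1 ≤ N → IsBootstrapFilter F P (ξ N) (A N))

include hfilter

omit h in
lemma tendstoInMeasure_cloud {Y : (N : ℕ) → Cloud X N → ℝ} {a : ℝ}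
    (hY : ∀ N, 1 ≤ N → BddMeasurable (Y N))
    (hlim : Tendsto (fun N => ∫ z, |Y N z - a|
      ∂P.map (fun ω => (fun u i => ξ N u i ω : Cloud X N))) atTop (𝓝 0)) :
    TendstoInMeasure P (fun N ω => Y N fun u i => ξ N u i ω) atTop fun _ => a := by
  refine tendstoInMeasure_of_integral_abs (eventually_atTop.2 ⟨1, fun N hN =>
    (hY N hN).comp (hfilter N hN).measurable_cloud⟩) (hlim.congr' (eventually_atTop.2 ⟨1,
      fun N hN => ?_⟩))
  exact integral_map_cloud hfilter hN ((hY N hN).sub (BddMeasurable.const a)).abs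

lemma tendsto_integral_abs_margN_sub (t : ℕ) {f : X → ℝ} (hf : BddMeasurable f) :
    Tendsto (fun N => ∫ z, |F.margN z t f - ∫ x, f x ∂F.marg t|
      ∂P.map (fun ω => (fun u i => ξ N u i ω : Cloud X N))) atTop (𝓝 0) := by
  obtain ⟨C, hC⟩ := h.exists_integral_margN_sub_sq_le t hf
  have hz : Tendsto (fun N : ℕ => √(C / N)) atTop (𝓝 0) := by
    have := (tendsto_const_div_atTop_nhds_zero_nat C).sqrt
    rwa [Real.sqrt_zero] at this
  refine tendsto_of_tendsto_of_tendsto_of_le_of_le' tendsto_const_nhds hz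
    (Eventually.of_forall fun N => integral_nonneg fun z => abs_nonneg _)
    (eventually_atTop.2 ⟨1, fun N hN => ?_⟩)
  have : NeZero N := ⟨by omega⟩
  have hL := h.isParticleLaw_map hfilter N hN
  have hp := hL.prob
  exact (integral_abs_le_sqrt _ ((h.bddMeasurable_margN hf t).sub (BddMeasurable.const _))).trans
    (Real.sqrt_le_sqrt (hC N _ hL))

lemma tendstoInMeasure_massN_succ (t : ℕ) :
    TendstoInMeasure P (fun N ω => F.massN (fun u i => ξ N u i ω) (t + 1)) atTop
      fun _ => ∫ x, F.pot t x ∂F.marg t := by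
  simp only [massN_succ_eq_margN]
  exact tendstoInMeasure_cloud hfilter (Y := fun N z => F.margN z t (F.pot t))
    (fun N _ => h.bddMeasurable_margN (h.bddMeasurable_pot t) t)
    (h.tendsto_integral_abs_margN_sub hfilter t (h.bddMeasurable_pot t))

/-- Replacing T_t^N by T_t costs at most `G` times the mean backward error along the particles,
which vanishes. What is left is the law of large numbers for a fixed function. -/
lemma tendstoInMeasure_margN_bwN {t : ℕ} (hq : ∀ ℓ < t, BddMeasurable (Function.uncurry (q ℓ))) :
    TendstoInMeasure P (fun N ω => F.margN (fun u i => ξ N u i ω) t (fun x =>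
        F.pot t x * F.bwN m (fun u i => ξ N u i ω) t (additive q 0 t) x)) atTop
      fun _ => ∫ x, F.pot t x * F.bw m t (additive q 0 t) x ∂F.marg t := by
  have hg := h.bddMeasurable_pot t
  have hb := hg.mul (h.bddMeasurable_bw (bddMeasurable_additive (s := 0) hq))
  have m1 (N : ℕ) (hN : 1 ≤ N) : BddMeasurable fun z : Cloud X N => F.margN z t (fun x =>
      F.pot t x * F.bwN m z t (additive q 0 t) x) := by
    have : NeZero N := ⟨by omega⟩
    exact (h.bddMeasurable_massN t).mul ((BddMeasurable.const _).mul (BddMeasurable.sum _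
      fun i _ => (hg.eval_cloud t i).mul ((h.bddMeasurable_bwN hq).comp
        (φ := fun z : Cloud X N => (z, z t i)) (by fun_prop))))
  refine tendstoInMeasure_cloud hfilter (Y := fun N z => F.margN z t (fun x =>
      F.pot t x * F.bwN m z t (additive q 0 t) x)) m1 ?_
  have hlim := (h.tendsto_integral_abs_margN_sub hfilter t hb).add
    ((h.tendsto_integral_margN_bwErr _ (h.isParticleLaw_map hfilter) t hq).const_mul G)
  rw [mul_zero, add_zero] at hlim
  refine tendsto_of_tendsto_of_tendsto_of_le_of_le' tendsto_const_nhds hlim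
    (Eventually.of_forall fun N => integral_nonneg fun z => abs_nonneg _)
    (eventually_atTop.2 ⟨1, fun N hN => ?_⟩)
  have : NeZero N := ⟨by omega⟩
  have hL := h.isParticleLaw_map hfilter N hN
  have hp := hL.prob
  have m2 := ((h.bddMeasurable_margN (N := N) hb t).sub
    (BddMeasurable.const (∫ x, F.pot t x * F.bw m t (additive q 0 t) x ∂F.marg t))).abs
  have m3 := h.bddMeasurable_margN_bwErr (N := N) hq
  rw [← integral_const_mul, ← integral_add (m2.integrable _) ((m3.integrable _).const_mul _)]
  refine integral_mono (((m1 N hN).sub (BddMeasurable.const _)).abs.integrable _)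
    ((m2.integrable _).add ((m3.integrable _).const_mul _)) fun z => ?_
  have e1 : F.margN z t (fun x => F.pot t x * F.bwN m z t (additive q 0 t) x) =
      F.margN z t (fun x => F.pot t x * F.bw m t (additive q 0 t) x) +
        F.margN z t (fun x => F.pot t x * F.bwErr m q z t x) := by
    simp only [margN, ← mul_add, ← Finset.sum_add_distrib, bwErr]
    congr 2
    exact Finset.sum_congr rfl fun i _ => by ring
  have e2 : |F.margN z t (fun x => F.pot t x * F.bwErr m q z t x)| ≤
      G * F.margN z t (fun x => |F.bwErr m q z t x|) := by
    have e3 : G * F.margN z t (fun x => |F.bwErr m q z t x|) =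
        F.margN z t (fun x => G * |F.bwErr m q z t x|) := by
      simp only [margN, ← Finset.mul_sum]; ring
    rw [e3]
    refine abs_margN_le z t fun x => ?_
    rw [abs_mul, abs_of_nonneg (F.pot_nonneg t x)]
    exact mul_le_mul_of_nonneg_right (h.pot_le t x) (abs_nonneg _)
  simp only
  rw [e1, add_sub_right_comm]
  exact (abs_add_le _ _).trans (add_le_add_right e2 _)

/-- Consistency of the FFBS estimator for additive functionals. -/
theorem tendstoInMeasure_smoothN {t : ℕ} (hq : ∀ ℓ < t, BddMeasurable (Function.uncurry (q ℓ))) :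
    TendstoInMeasure P (fun N ω => F.smoothN m (fun u i => ξ N u i ω) t (additive q 0 t)) atTop
      fun _ => F.smooth m t (additive q 0 t) := by
  have hg := (h.integral_marg_pos t (h.bddMeasurable_pot t) (h.pot_pos t)).ne'
  rw [h.smooth_eq_div]
  refine TendstoInMeasure.congr' (eventually_atTop.2 ⟨1, fun N hN => ?_⟩) EventuallyEq.rfl
    (tendstoInMeasure_map₂ (φ := fun x y => x / y) (h.tendstoInMeasure_margN_bwN hfilter hq)
      (h.tendstoInMeasure_massN_succ hfilter t) (continuousAt_fst.div continuousAt_snd hg))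
  have : NeZero N := ⟨by omega⟩
  exact ae_of_all _ fun ω => (h.smoothN_eq_div _ t _).symm

lemma tendstoInMeasure_muBS_obsN {s t : ℕ} (hst : s ≤ t)
    (hq : ∀ ℓ < s, BddMeasurable (Function.uncurry (q ℓ)))
    {c d : X → ℝ} (hc : BddMeasurable c) (hd : BddMeasurable d)
    {f g : (Finset.Icc s t → X) → ℝ} (hf : BddMeasurable f) (hg : BddMeasurable g) :
    TendstoInMeasure P (fun N ω => F.muBS m (fun u i => ξ N u i ω) (e s) t (fun p p' =>
          F.obsN m (fun u i => ξ N u i ω) hst q c f p *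
            F.obsN m (fun u i => ξ N u i ω) hst q d g p')) atTop
      fun _ => F.muInt (e s) t (fun p p' => F.obs m hst q c f p * F.obs m hst q d g p') := by
  have m1 (N : ℕ) (hN : 1 ≤ N) : BddMeasurable fun z : Cloud X N => F.muBS m z (e s) t
      (fun p p' => F.obsN m z hst q c f p * F.obsN m z hst q d g p') := by
    have : NeZero N := ⟨by omega⟩
    exact h.bddMeasurable_muBS_obsN hst hq hq hc hd hf hg
  refine tendstoInMeasure_cloud hfilter (Y := fun N z => F.muBS m z (e s) t
      (fun p p' => F.obsN m z hst q c f p * F.obsN m z hst q d g p')) m1 ?_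
  have hlim := (h.tendsto_integral_muBS_obsN_sub_sq _ (h.isParticleLaw_map hfilter) hst hq hq hc hd
    hf hg).sqrt
  rw [Real.sqrt_zero] at hlim
  refine tendsto_of_tendsto_of_tendsto_of_le_of_le' tendsto_const_nhds hlim
    (Eventually.of_forall fun N => integral_nonneg fun z => abs_nonneg _)
    (eventually_atTop.2 ⟨1, fun N hN => ?_⟩)
  have hp := (h.isParticleLaw_map hfilter N hN).prob
  exact integral_abs_le_sqrt _ ((m1 N hN).sub (BddMeasurable.const _))

end Filter

end IsDominated

end FeynmanKac

end FFBS

/-! ### Consistency of the variance estimator -/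

namespace FFBS

namespace FeynmanKac

variable {X : Type*} [MeasurableSpace X] {F : FeynmanKac X} {m : ℕ → X → X → ℝ}

/-- The function `g_t` of the segment `x_{s:t}`. -/
def segPot (F : FeynmanKac X) {s t : ℕ} (hst : s ≤ t) (w : Finset.Icc s t → X) : ℝ :=
  F.pot t (w ⟨t, Finset.mem_Icc.2 ⟨hst, le_rfl⟩⟩)

/-- The function `g_t h̃_{s:t}` of the segment `x_{s:t}`. -/
def segAdditive (F : FeynmanKac X) (q : ℕ → X → X → ℝ) {s t : ℕ} (hst : s ≤ t)
    (w : Finset.Icc s t → X) : ℝ :=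
  F.segPot hst w * ∑ ℓ : Finset.Ico s t,
    q ℓ (w ⟨ℓ, Finset.mem_Icc.2 ⟨(Finset.mem_Ico.1 ℓ.2).1, (Finset.mem_Ico.1 ℓ.2).2.le⟩⟩)
      (w ⟨ℓ + 1, Finset.mem_Icc.2 ⟨(Finset.mem_Ico.1 ℓ.2).1.trans (Nat.le_succ _),
        (Finset.mem_Ico.1 ℓ.2).2⟩⟩)

lemma segPot_segment {s t : ℕ} (hst : s ≤ t) (p : Path X t) :
    F.segPot hst (segment s p) = F.pot t (last p) := rfl

lemma segAdditive_segment (q : ℕ → X → X → ℝ) {s t : ℕ} (hst : s ≤ t) (p : Path X t) :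
    F.segAdditive q hst (segment s p) = F.pot t (last p) * additive q s t p := rfl

namespace IsDominated

variable {ν : Measure X} {G σ : ℝ} (h : F.IsDominated ν m G σ) {q : ℕ → X → X → ℝ} {s t : ℕ}
  (hst : s ≤ t)

include h

lemma bddMeasurable_segPot : BddMeasurable (F.segPot hst) :=
  (h.bddMeasurable_pot t).comp (measurable_pi_apply _)

variable (hq : ∀ ℓ < t, BddMeasurable (Function.uncurry (q ℓ)))

include hq

lemma bddMeasurable_segAdditive : BddMeasurable (F.segAdditive q hst) :=
  (h.bddMeasurable_segPot hst).mul (BddMeasurable.sum _ fun ℓ _ =>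
    (hq ℓ (Finset.mem_Ico.1 ℓ.2).2).comp (φ := fun w : Finset.Icc s t → X =>
      (w ⟨ℓ, Finset.mem_Icc.2 ⟨(Finset.mem_Ico.1 ℓ.2).1, (Finset.mem_Ico.1 ℓ.2).2.le⟩⟩,
      w ⟨ℓ + 1, Finset.mem_Icc.2 ⟨(Finset.mem_Ico.1 ℓ.2).1.trans (Nat.le_succ _),
        (Finset.mem_Ico.1 ℓ.2).2⟩⟩))
      ((measurable_pi_apply _).prodMk (measurable_pi_apply _)))

-- The centring constant is random in the estimator, so it is factored out. Both remaining functions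
-- have the form covered by the L² result, the second one with coefficient zero in front of the
-- backward term.
omit h hq in
lemma mul_pot_eq_obs (κ : ℝ) (p : Path X t) :
    F.pot t (last p) * (F.bw m s (additive q 0 s) (point p s hst) + additive q s t p - κ) =
      F.obs m hst q (F.pot t) (F.segAdditive q hst) p -
        κ * F.obs m hst q (fun _ => 0) (F.segPot hst) p := by
  simp only [obs, segPot_segment, segAdditive_segment]; ring

omit h hq in
lemma mul_pot_eq_obsN {N : ℕ} (z : Cloud X N) (κ : ℝ) (p : Path X t) :
    F.pot t (last p) * (F.bwN m z s (additive q 0 s) (point p s hst) + additive q s t p - κ) =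
      F.obsN m z hst q (F.pot t) (F.segAdditive q hst) p -
        κ * F.obsN m z hst q (fun _ => 0) (F.segPot hst) p := by
  simp only [obsN, segPot_segment, segAdditive_segment]; ring

-- Bilinearity turns the estimator into a quadratic polynomial in the centring constant, which may
-- then be random; its coefficients are estimators for functions that do not involve it.
omit h hq in
lemma muBS_sub_mul_sub {b : ℕ → Bool} {N : ℕ} (z : Cloud X N) (κ : ℝ) (u v : Path X t → ℝ) :
    F.muBS m z b t (fun p p' => (u p - κ * v p) * (u p' - κ * v p')) =
      F.muBS m z b t (fun p p' => u p * u p') -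
        κ * (F.muBS m z b t (fun p p' => u p * v p') + F.muBS m z b t (fun p p' => v p * u p')) +
        κ * κ * F.muBS m z b t (fun p p' => v p * v p') := by
  have e1 : (fun p p' : Path X t => (u p - κ * v p) * (u p' - κ * v p')) =
      fun p p' => (u p * u p' + (-κ) * (u p * v p' + v p * u p')) + (κ * κ) * (v p * v p') := by
    funext p p'; ring
  rw [e1, muBS_add z t (fun p p' => u p * u p' + (-κ) * (u p * v p' + v p * u p'))
      fun p p' => (κ * κ) * (v p * v p'),
    muBS_add z t (fun p p' => u p * u p') fun p p' => (-κ) * (u p * v p' + v p * u p'),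
    muBS_const_mul z t (-κ) fun p p' => u p * v p' + v p * u p',
    muBS_const_mul z t (κ * κ) fun p p' => v p * v p',
    muBS_add z t (fun p p' => u p * v p') fun p p' => v p * u p']
  ring

omit hst hq in
lemma muInt_sub_mul_sub {b : ℕ → Bool} (κ : ℝ) {u v : Path X t → ℝ} (hu : BddMeasurable u)
    (hv : BddMeasurable v) :
    F.muInt b t (fun p p' => (u p - κ * v p) * (u p' - κ * v p')) =
      F.muInt b t (fun p p' => u p * u p') -
        κ * (F.muInt b t (fun p p' => u p * v p') + F.muInt b t (fun p p' => v p * u p')) +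
        κ * κ * F.muInt b t (fun p p' => v p * v p') := by
  have i1 : IsFiniteMeasure (F.mu b t) :=
    (F.pair b).isFiniteMeasure_joint (F.pot_pair_le h.pot_le b) t
  have hi {f g : Path X t → ℝ} (hf : BddMeasurable f) (hg : BddMeasurable g) :
      Integrable (fun p : Path (X × X) t => f (fun i => (p i).1) * g fun i => (p i).2)
        (F.mu b t) :=
    (bddMeasurable_unzip (h := fun p p' => f p * g p')
      ((hf.comp measurable_fst).mul (hg.comp measurable_snd))).integrable _
  simp only [muInt]
  have j1 : Integrable (fun p : Path (X × X) t => (u fun i => (p i).1) * (v fun i => (p i).2) +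
      (v fun i => (p i).1) * u fun i => (p i).2) (F.mu b t) := (hi hu hv).add (hi hv hu)
  have j2 : Integrable (fun p : Path (X × X) t => κ * ((u fun i => (p i).1) *
      (v fun i => (p i).2) + (v fun i => (p i).1) * u fun i => (p i).2)) (F.mu b t) :=
    j1.const_mul κ
  have j3 : Integrable (fun p : Path (X × X) t => (u fun i => (p i).1) * (u fun i => (p i).2) -
      κ * ((u fun i => (p i).1) * (v fun i => (p i).2) +
        (v fun i => (p i).1) * u fun i => (p i).2)) (F.mu b t) := (hi hu hu).sub j2
  rw [← integral_add (hi hu hv) (hi hv hu), ← integral_const_mul, ← integral_const_mul,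
    ← integral_sub (hi hu hu) j2, ← integral_add j3 ((hi hv hv).const_mul _)]
  refine integral_congr_ae (ae_of_all _ fun p => ?_)
  simp only
  ring

section Filter

variable {Ω : Type*} [MeasurableSpace Ω] {P : Measure Ω} [IsProbabilityMeasure P]
  {ξ : (N : ℕ) → ℕ → Fin N → Ω → X} {A : (N : ℕ) → ℕ → Fin N → Ω → Fin N}
  (hfilter : ∀ N, 1 ≤ N → IsBootstrapFilter F P (ξ N) (A N))

include hfilter

/-- The term is a continuous function of the FFBS estimator, four bilinear estimators and the mass
estimate. Each converges in probability to a constant, and the limit of the mass is positive, so the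
division is continuous there. -/
lemma tendstoInMeasure_varBS_term :
    TendstoInMeasure P (fun N ω => F.muBS m (fun u i => ξ N u i ω) (e s) t (fun p p' =>
        (F.pot t (last p) * (F.bwN m (fun u i => ξ N u i ω) s (additive q 0 s) (point p s hst) +
          additive q s t p - F.smoothN m (fun u i => ξ N u i ω) t (additive q 0 t))) *
        (F.pot t (last p') * (F.bwN m (fun u i => ξ N u i ω) s (additive q 0 s) (point p' s hst) +
          additive q s t p' - F.smoothN m (fun u i => ξ N u i ω) t (additive q 0 t)))) /
        F.massN (fun u i => ξ N u i ω) (t + 1) ^ 2) atTop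
      fun _ => F.muInt (e s) t (fun p p' =>
        (F.pot t (last p) * (F.bw m s (additive q 0 s) (point p s hst) + additive q s t p -
          F.smooth m t (additive q 0 t))) *
        (F.pot t (last p') * (F.bw m s (additive q 0 s) (point p' s hst) + additive q s t p' -
          F.smooth m t (additive q 0 t)))) / (∫ x, F.pot t x ∂F.marg t) ^ 2 := by
  have hqs : ∀ ℓ < s, BddMeasurable (Function.uncurry (q ℓ)) := fun ℓ hℓ => hq ℓ (hℓ.trans_le hst)
  have b1 := h.bddMeasurable_pot t
  have b2 : BddMeasurable fun _ : X => (0 : ℝ) := BddMeasurable.const 0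
  have b3 := h.bddMeasurable_segAdditive hst hq
  have b4 := h.bddMeasurable_segPot hst
  have hg := (h.integral_marg_pos t (h.bddMeasurable_pot t) (h.pot_pos t)).ne'
  simp only [mul_pot_eq_obs, mul_pot_eq_obsN, muBS_sub_mul_sub]
  rw [h.muInt_sub_mul_sub _ (h.bddMeasurable_obs hst hqs b1 b3)
    (h.bddMeasurable_obs hst hqs b2 b4)]
  have κ := h.tendstoInMeasure_smoothN hfilter hq
  have t1 := h.tendstoInMeasure_muBS_obsN hfilter hst hqs b1 b1 b3 b3
  have t2 := h.tendstoInMeasure_muBS_obsN hfilter hst hqs b1 b2 b3 b4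
  have t3 := h.tendstoInMeasure_muBS_obsN hfilter hst hqs b2 b1 b4 b3
  have t4 := h.tendstoInMeasure_muBS_obsN hfilter hst hqs b2 b2 b4 b4
  have c1 := tendstoInMeasure_map₂ (φ := fun x y => x + y) t2 t3 (by fun_prop)
  have c2 := tendstoInMeasure_map₂ (φ := fun x y => x * y) κ c1 (by fun_prop)
  have c3 := tendstoInMeasure_map₂ (φ := fun x y => x - y) t1 c2 (by fun_prop)
  have c4 := tendstoInMeasure_map₂ (φ := fun x y => x * x * y) κ t4 (by fun_prop)
  have c5 := tendstoInMeasure_map₂ (φ := fun x y => x + y) c3 c4 (by fun_prop)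
  exact tendstoInMeasure_map₂ (φ := fun x y => x / y ^ 2) c5
    (h.tendstoInMeasure_massN_succ hfilter t)
    (continuousAt_fst.div (continuousAt_snd.pow 2) (pow_ne_zero 2 hg))

omit hst in
/-- Consistency of the variance estimator. -/
theorem tendstoInMeasure_varBS :
    TendstoInMeasure P (fun N ω => F.varBS m (fun u i => ξ N u i ω) t q) atTop
      fun _ => F.asymptVar m t (additive q 0 t) := by
  have h1 := tendstoInMeasure_sum Finset.univ fun (s : Fin (t + 1)) _ =>
    h.tendstoInMeasure_varBS_term (Nat.le_of_lt_succ s.2) hq hfilter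
  have h2 : F.asymptVar m t (additive q 0 t) = ∑ s : Fin (t + 1),
      F.muInt (e s) t (fun p p' =>
        (F.pot t (last p) * (F.bw m s (additive q 0 s) (point p s (Nat.le_of_lt_succ s.2)) +
          additive q s t p - F.smooth m t (additive q 0 t))) *
        (F.pot t (last p') * (F.bw m s (additive q 0 s) (point p' s (Nat.le_of_lt_succ s.2)) +
          additive q s t p' - F.smooth m t (additive q 0 t)))) /
        (∫ x, F.pot t x ∂F.marg t) ^ 2 := by
    rw [asymptVar, Finset.sum_range]
    exact Finset.sum_congr rfl fun s _ => h.asymptVar_term_eq (Nat.le_of_lt_succ s.2) hq _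
  rw [h2]
  exact h1

end Filter

end IsDominated

end FeynmanKac

end FFBS

/-! ### Assembly under (A1)–(A4) -/

theorem mainTheorem6 {X : Type*} [MeasurableSpace X]
    (F : FFBS.FeynmanKac X) (ν : Measure X) (m0 : X → ℝ) (m : ℕ → X → X → ℝ)
    (hdens : F.HasDensities ν m0 m)
    (hpot : ∃ Ginf : ℝ, 0 < Ginf ∧ ∀ t x, 0 < F.pot t x ∧ F.pot t x ≤ Ginf)
    (hpos : ∀ t, 0 < t → ∀ x' x, 0 < m t x' x)
    (hbdd : ∃ σ : ℝ, 0 < σ ∧ ∀ t, 1 ≤ t → ∀ x' x, m t x' x ≤ σ)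
    {Ω : Type*} [MeasurableSpace Ω] (P : Measure Ω) [IsProbabilityMeasure P]
    (ξ : (N : ℕ) → ℕ → Fin N → Ω → X) (A : (N : ℕ) → ℕ → Fin N → Ω → Fin N)
    (hfilter : ∀ N, 1 ≤ N → FFBS.IsBootstrapFilter F P (ξ N) (A N))
    (t : ℕ) :
    (∀ (s : ℕ) (hst : s ≤ t) (hseg fseg : (Finset.Icc s t → X) → ℝ) (c d : X → ℝ)
        (q r : ℕ → X → X → ℝ),
      FFBS.BddMeasurable hseg → FFBS.BddMeasurable fseg →
      FFBS.BddMeasurable c → FFBS.BddMeasurable d →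
      (∀ ℓ < s, FFBS.BddMeasurable (Function.uncurry (q ℓ))) →
      (∀ ℓ < s, FFBS.BddMeasurable (Function.uncurry (r ℓ))) →
      Tendsto
        (fun N : ℕ => eLpNorm
          (fun ω =>
            F.muBS m (fun u i => ξ N u i ω) (FFBS.e s) t
              (fun x x' =>
                (F.bwN m (fun u i => ξ N u i ω) s (FFBS.additive q 0 s) (FFBS.point x s hst)
                    * c (FFBS.last x) + hseg (FFBS.segment s x)) *
                (F.bwN m (fun u i => ξ N u i ω) s (FFBS.additive r 0 s) (FFBS.point x' s hst)
                    * d (FFBS.last x') + fseg (FFBS.segment s x')))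
            - F.muInt (FFBS.e s) t
              (fun x x' =>
                (F.bw m s (FFBS.additive q 0 s) (FFBS.point x s hst)
                    * c (FFBS.last x) + hseg (FFBS.segment s x)) *
                (F.bw m s (FFBS.additive r 0 s) (FFBS.point x' s hst)
                    * d (FFBS.last x') + fseg (FFBS.segment s x'))))
          2 P)
        atTop (𝓝 0)) ∧
    (∀ q : ℕ → X → X → ℝ, (∀ ℓ < t, FFBS.BddMeasurable (Function.uncurry (q ℓ))) →
      TendstoInMeasure P
        (fun (N : ℕ) (ω : Ω) => F.varBS m (fun u i => ξ N u i ω) t q)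
        atTop
        (fun _ => F.asymptVar m t (FFBS.additive q 0 t))) := by
  obtain ⟨G, hG0, hG⟩ := hpot
  obtain ⟨σ, hσ0, hσ⟩ := hbdd
  -- `IsDominated` indexes transitions by `t + 1`, so nothing is asked of `trans 0`, and the
  -- assumptions are read at times at least 1.
  have h : F.IsDominated ν m G σ :=
    { G_nonneg := hG0.le
      pot_pos := fun t x => (hG t x).1
      pot_le := fun t x => (hG t x).2
      trans_eq := fun t x => hdens.trans_eq (t + 1) (Nat.le_add_left 1 t) x
      measurable_dens := fun t => hdens.trans_measurable (t + 1) (Nat.le_add_left 1 t)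
      dens_pos := fun t x y => hpos (t + 1) t.succ_pos x y
      dens_le := fun t x y => hσ (t + 1) (Nat.le_add_left 1 t) x y }
  exact ⟨fun s hst hseg fseg c d q r hh hf hc hd hq hr =>
    h.tendsto_eLpNorm_muBS_obsN_sub hfilter hst hq hr hc hd hh hf,
    fun q hq => h.tendstoInMeasure_varBS hq hfilter⟩
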